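/- Let $K$ be a finite extension of $\mathbb{Q}_p$ with ring of integers $\mathcal{O}_K$, uniformiser $\pi$, residue field $k$ and absolute value $|x|=c^{-v(x)}$, where $v$ is the normalised valuation and $c>1$. Reduction mod $\pi$ is denoted by a tilde. Let $\Phi=(Q_1,Q_2)$ be a pair of quadratic forms in $x_1,\dots,x_4$ over $\mathcal{O}_K$ that is non-singular, i.e. $\mathcal{C}_\Phi=\{Q_1=Q_2=0\}\subset\mathbb{P}^3_K$ is a smooth curve of genus one. Let $A,B$ be the matrices of second partial derivatives of $Q_1,Q_2$, and write $\sum_{i\le j}a^*_{ij}x_ix_j$ and $\sum_{i\le j}b^*_{ij}x_ix_j$ for the quadratic forms with matrices of second partial derivatives $\operatorname{adj}A$ and $\operatorname{adj}B$. Put $$T_1=\sum_{i,j=1}^4\sum_{r\le s}b^*_{rs}(A_{ij}A_{rs}-A_{is}A_{jr})x_ix_j,\qquad T_2=\sum_{i,j=1}^4\sum_{r\le s}a^*_{rs}(B_{ij}B_{rs}-B_{is}B_{jr})x_ix_j .$$ For a quadratic form $\Gamma=\sum_{i\le j}c_{ij}x_ix_j$ put $\operatorname{pf}(\Gamma)=c_{12}c_{34}+c_{13}c_{24}+c_{14}c_{23}$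 and define $\operatorname{rd}(\Gamma)$ by $\det(\partial^2\Gamma/\partial x_i\partial x_j)=\operatorname{pf}(\Gamma)^2+4\operatorname{rd}(\Gamma)$. Write $P=\operatorname{pf}(xQ_1+zQ_2)=lx^2+mxz+nz^2$ and $R=\operatorname{rd}(xQ_1+zQ_2)=ax^4+bx^3z+cx^2z^2+dxz^3+ez^4$, and put $F_2(x,z)=P^2+4R$ and $$\begin{aligned}G_2(x,z)={}&(-l^2c+lmb-m^2a-4ac+b^2)x^4+(-2l^2d+2lnb-4mna-8ad)x^3z\\&+(-4l^2e-lmd+2lnc-mnb-4n^2a-16ae-2bd)x^2z^2\\&+(-4lme+2lnd-2n^2b-8be)xz^3+(-m^2e+mnd-n^2c-4ce+d^2)z^4.\end{aligned}$$ Finally let $F_4=F_2(T_1,-T_2)$ and $G_4=G_2(T_1,-T_2)$. Suppose that the reduction $\{\widetilde Q_1=\widetilde Q_2=0\}\subset\mathbb{P}^3_k$ contains a $k$-rational (geometrically irreducible) conic $C$ as a component of multiplicity one. Then there is an integer $\alpha$ such that $$\frac{\max(|F_4(\mathbf{x})|,|G_4(\mathbf{x})|)}{\max(|x_1|,\dots,|x_4|)^8}=|\pi|^{2\alpha}$$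 for all $(x_1:\dots:x_4)\in\mathcal{C}_\Phi(K)$ whose reduction lies on $C$ and is a smooth point of $\{\widetilde Q_1=\widetilde Q_2=0\}$. Moreover, if $C$ is contained in the plane $\{x_1=0\}$, then the following algorithm, whatever choices are made in it, can always be carried out, terminates, and returns $\alpha$. (i) Set $\alpha=0$. (ii) Make a $\operatorname{GL}_2(\mathcal{O}_K)$-transformation $Q_i\leftarrow\sum_j m_{ij}Q_j$ so that $\widetilde Q_1$ vanishes on $\{x_1=0\}$. Replace $(Q_1,Q_2)$ by $(\pi^{-1}Q_1(\pi x_1,x_2,x_3,x_4),\,Q_2(\pi x_1,x_2,x_3,x_4))$ and let $\alpha=\alpha+1$. (iii) Write $Q_i=\lambda_ix_1^2+\ell_i(x_2,x_3,x_4)x_1+q_i(x_2,x_3,x_4)$ for $i=1,2$. If $\widetilde q_1$ belongs to the ideal generated by $\widetilde\ell_1$ and $\widetilde q_2$, say $q_1\equiv(a_2x_2+a_3x_3+a_4x_4)\ell_1+bq_2\pmod\pi$ with $a_2,a_3,a_4,b\in\mathcal{O}_K$, then substitute $x_1\leftarrow x_1-(a_2x_2+a_3x_3+a_4x_4)$ and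 go to step (ii). (iv) Return $\alpha$. -/

import Mathlib

open scoped WithZero

/-- The ring of integers of a finite extension `K` of `ℚ_p`. -/
abbrev PadicRingOfIntegers (p : ℕ) [Fact p.Prime] (K : Type*) [Field K] [Algebra ℤ_[p] K] :
    Type _ :=
  ↥(integralClosure ℤ_[p] K)

namespace PadicRingOfIntegers

variable {p : ℕ} [Fact p.Prime] {K : Type*} [Field K] [Algebra ℚ_[p] K]
  [FiniteDimensional ℚ_[p] K] [Algebra ℤ_[p] K] [IsScalarTower ℤ_[p] ℚ_[p] K]

theorem isIntegral_of_spectralNorm_le_one {x : K} (hx : spectralNorm ℚ_[p] K x ≤ 1) :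
    IsIntegral ℤ_[p] x := by
  have hint : IsIntegral ℚ_[p] x := Algebra.IsIntegral.isIntegral x
  have hm := minpoly.monic hint
  have hc := (spectralValue_le_one_iff hm).1 hx
  have hl : minpoly ℚ_[p] x ∈ Polynomial.lifts (algebraMap ℤ_[p] ℚ_[p]) := by
    rw [Polynomial.lifts_iff_coeff_lifts]
    intro n
    exact ⟨⟨_, hc n⟩, rfl⟩
  obtain ⟨q, hq, -, hqm⟩ := Polynomial.lifts_and_natDegree_eq_and_monic hl hm
  refine ⟨q, hqm, ?_⟩
  rw [IsScalarTower.algebraMap_eq ℤ_[p] ℚ_[p] K, ← Polynomial.eval₂_map, hq]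
  exact minpoly.aeval ℚ_[p] x

instance isFractionRing : IsFractionRing (PadicRingOfIntegers p K) K :=
  integralClosure.isFractionRing_of_finite_extension ℚ_[p] K

instance isDiscreteValuationRing : IsDiscreteValuationRing (PadicRingOfIntegers p K) := by
  have : IsNoetherianRing (PadicRingOfIntegers p K) :=
    integralClosure.isNoetherianRing (A := ℤ_[p]) (K := ℚ_[p]) K
  have : ValuationRing (PadicRingOfIntegers p K) := by
    rw [ValuationRing.iff_isInteger_or_isInteger _ K]
    intro x
    have key : ∀ y : K, spectralNorm ℚ_[p] K y ≤ 1 →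
        IsLocalization.IsInteger (PadicRingOfIntegers p K) y := fun y hy =>
      ⟨⟨y, isIntegral_of_spectralNorm_le_one hy⟩, rfl⟩
    rcases le_total (spectralNorm ℚ_[p] K x) 1 with h | h
    · exact Or.inl (key x h)
    · refine Or.inr (key _ ?_)
      have h1 : spectralMulAlgNorm ℚ_[p] K x⁻¹ = (spectralMulAlgNorm ℚ_[p] K x)⁻¹ :=
        map_inv₀ (spectralMulAlgNorm ℚ_[p] K) x
      rw [spectralMulAlgNorm_def, spectralMulAlgNorm_def] at h1
      rw [h1]
      exact inv_le_one_of_one_le₀ h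
  have : IsPrincipalIdealRing (PadicRingOfIntegers p K) := by
    have ht : IsNoetherianRing (PadicRingOfIntegers p K) ↔
        IsPrincipalIdealRing (PadicRingOfIntegers p K) := IsBezout.TFAE.out 0 1
    exact ht.1 inferInstance
  refine { not_a_field' := fun h => ?_ }
  have hf : IsField (PadicRingOfIntegers p K) := IsLocalRing.isField_iff_maximalIdeal_eq.2 h
  have hinj : Function.Injective (algebraMap ℤ_[p] (PadicRingOfIntegers p K)) := by
    have h2 : Function.Injective (algebraMap ℤ_[p] K) := by
      rw [IsScalarTower.algebraMap_eq ℤ_[p] ℚ_[p] K]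
      exact (algebraMap ℚ_[p] K).injective.comp (IsFractionRing.injective ℤ_[p] ℚ_[p])
    intro a b hab
    exact h2 (congrArg Subtype.val hab)
  exact IsDiscreteValuationRing.not_isField ℤ_[p] (isField_of_isIntegral_of_isField hinj hf)

end PadicRingOfIntegers

namespace GenusOne

open MvPolynomial

noncomputable section

/-! ### Generalised binary quartics `y² + P(x₁,x₂) y = Q(x₁,x₂)` -/

/-- `P = l x₁² + m x₁x₂ + n x₂²`, `Q = a x₁⁴ + b x₁³x₂ + c x₁²x₂² + d x₁x₂³ + e x₂⁴`. -/
structure GenBinaryQuartic (K : Type*) where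
  (l m n a b c d e : K)

namespace GenBinaryQuartic

variable {K : Type*} [CommRing K]

/-- `F₂ = P² + 4Q`. -/
def F₂ (f : GenBinaryQuartic K) (x₁ x₂ : K) : K :=
  (f.l * x₁ ^ 2 + f.m * x₁ * x₂ + f.n * x₂ ^ 2) ^ 2 +
    4 * (f.a * x₁ ^ 4 + f.b * x₁ ^ 3 * x₂ + f.c * x₁ ^ 2 * x₂ ^ 2 + f.d * x₁ * x₂ ^ 3 +
      f.e * x₂ ^ 4)

/-- The integral form `G₂ = (h - b₂ g) / 3`, where `g = P²/4 + Q`, `h = (g₁₂² - g₁₁ g₂₂) / 3` and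
`b₂ = m² + 4 (c - l n)`, written out. -/
def G₂ (f : GenBinaryQuartic K) (x₁ x₂ : K) : K :=
  let ⟨l, m, n, a, b, c, d, e⟩ := f
  (-l ^ 2 * c + l * m * b - m ^ 2 * a - 4 * a * c + b ^ 2) * x₁ ^ 4 +
  (-2 * l ^ 2 * d + 2 * l * n * b - 4 * m * n * a - 8 * a * d) * x₁ ^ 3 * x₂ +
  (-4 * l ^ 2 * e - l * m * d + 2 * l * n * c - m * n * b - 4 * n ^ 2 * a - 16 * a * e
    - 2 * b * d) * x₁ ^ 2 * x₂ ^ 2 +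
  (-4 * l * m * e + 2 * l * n * d - 2 * n ^ 2 * b - 8 * b * e) * x₁ * x₂ ^ 3 +
  (-m ^ 2 * e + m * n * d - n ^ 2 * c - 4 * c * e + d ^ 2) * x₂ ^ 4

end GenBinaryQuartic

/-! ### Quadric intersections -/

/-- A pair of polynomials `(Q₁, Q₂)` in `x₁, …, x₄`, numbered from `0` in the code. -/
abbrev QuadricPair (R : Type*) [CommSemiring R] := Fin 2 → MvPolynomial (Fin 4) R

namespace QuadricPair

/-- Both members are quadratic forms. -/
def IsModel {R : Type*} [CommSemiring R] (Q : QuadricPair R) : Prop :=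
  ∀ i, (Q i).IsHomogeneous 2

/-- Base change of a pair along a ring homomorphism. -/
def baseChange {R S : Type*} [CommSemiring R] [CommSemiring S] (φ : R →+* S)
    (Q : QuadricPair R) : QuadricPair S :=
  fun i => MvPolynomial.map φ (Q i)

/-- `z` is a common zero of `Q₁` and `Q₂`. -/
def IsZero {R : Type*} [CommSemiring R] (Q : QuadricPair R) (z : Fin 4 → R) : Prop :=
  ∀ i, eval z (Q i) = 0

/-- The Jacobian matrix of `(Q₁, Q₂)` at `z` has rank `2`. At a point `z` of projective
`3`-space on `{Q₁ = Q₂ = 0}` this means that the scheme `{Q₁ = Q₂ = 0}` is smooth of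
dimension one at `z`. -/
def IsSmoothAt {F : Type*} [Field F] (Q : QuadricPair F) (z : Fin 4 → F) : Prop :=
  LinearIndependent F (fun (i : Fin 2) (j : Fin 4) => eval z (pderiv j (Q i)))

/-- `{Q₁ = Q₂ = 0}` is smooth of dimension one at all its geometric points. For two quadratic
forms it is then a smooth complete intersection of two quadrics in projective `3`-space, hence a
smooth (geometrically connected) curve of genus one. -/
def IsNonsingular {F : Type*} [Field F] (Q : QuadricPair F) : Prop :=
  ∀ z : Fin 4 → AlgebraicClosure F, z ≠ 0 →
    (Q.baseChange (algebraMap F (AlgebraicClosure F))).IsZero z →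
    (Q.baseChange (algebraMap F (AlgebraicClosure F))).IsSmoothAt z

/-- The substitution `Q_i ← ∑ m_{ij} Q_j`. -/
def linComb {R : Type*} [CommSemiring R] (M : Matrix (Fin 2) (Fin 2) R) (Q : QuadricPair R) :
    QuadricPair R :=
  fun i => ∑ j, C (M i j) * Q j

/-! #### The forms `F₄` and `G₄` -/

section Covariants

variable {K : Type*} [Field K]

/-- The matrix of second partial derivatives of a quadratic form. -/
def hessian (q : MvPolynomial (Fin 4) K) : Matrix (Fin 4) (Fin 4) K :=
  fun i j => constantCoeff (pderiv i (pderiv j q))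

/-- For `r ≤ s`, the coefficient of `x_r x_s` in the quadratic form whose matrix of second partial
derivatives is `adj A`. -/
def dualCoeff (A : Matrix (Fin 4) (Fin 4) K) (r s : Fin 4) : K :=
  if r = s then A.adjugate r r / 2 else A.adjugate r s

/-- `∑_{i,j} ∑_{r ≤ s} b*_{rs} (A_{ij} A_{rs} - A_{is} A_{jr}) x_i x_j`, where the `b*_{rs}` are
the coefficients of the quadratic form with matrix of second partial derivatives `adj B`. -/
def covariantT (A B : Matrix (Fin 4) (Fin 4) K) (x : Fin 4 → K) : K :=
  ∑ i, ∑ j, ∑ r, ∑ s ∈ Finset.Ici r,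
    dualCoeff B r s * (A i j * A r s - A i s * A j r) * x i * x j

/-- The covariant `T₁` evaluated at `x`. -/
def T₁ (Q : QuadricPair K) (x : Fin 4 → K) : K := covariantT (hessian (Q 0)) (hessian (Q 1)) x

/-- The covariant `T₂` evaluated at `x`. -/
def T₂ (Q : QuadricPair K) (x : Fin 4 → K) : K := covariantT (hessian (Q 1)) (hessian (Q 0)) x

/-- For the quadratic form `Γ = ∑_{i ≤ j} c_{ij} x_i x_j` with matrix of second partial
derivatives `A`: `pf Γ = c₁₂ c₃₄ + c₁₃ c₂₄ + c₁₄ c₂₃`. -/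
def pf {R : Type*} [CommRing R] (A : Matrix (Fin 4) (Fin 4) R) : R :=
  A 0 1 * A 2 3 + A 0 2 * A 1 3 + A 0 3 * A 1 2

/-- The matrix of second partial derivatives of the pencil `x Q₁ + z Q₂`, dehomogenised by
`z = 1`. -/
def pencil (Q : QuadricPair K) : Matrix (Fin 4) (Fin 4) (Polynomial K) :=
  fun i j => Polynomial.C (hessian (Q 0) i j) * Polynomial.X + Polynomial.C (hessian (Q 1) i j)

/-- `P = pf (x Q₁ + z Q₂)`, dehomogenised by `z = 1`. -/
def pfPoly (Q : QuadricPair K) : Polynomial K := pf Q.pencil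

/-- `rd (x Q₁ + z Q₂)`, dehomogenised by `z = 1`, where `rd` is determined by
`det = pf² + 4 rd`. -/
def rdPoly (Q : QuadricPair K) : Polynomial K :=
  Polynomial.C (1 / 4) * (Q.pencil.det - Q.pfPoly ^ 2)

/-- The generalised binary quartic `(pf (x Q₁ + z Q₂), rd (x Q₁ + z Q₂))`. -/
def doubling (Q : QuadricPair K) : GenBinaryQuartic K where
  l := Q.pfPoly.coeff 2
  m := Q.pfPoly.coeff 1
  n := Q.pfPoly.coeff 0
  a := Q.rdPoly.coeff 4
  b := Q.rdPoly.coeff 3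
  c := Q.rdPoly.coeff 2
  d := Q.rdPoly.coeff 1
  e := Q.rdPoly.coeff 0

/-- `F₄ = F₂(T₁, -T₂)` evaluated at `x`. -/
def F₄ (Q : QuadricPair K) (x : Fin 4 → K) : K := Q.doubling.F₂ (Q.T₁ x) (-Q.T₂ x)

/-- `G₄ = G₂(T₁, -T₂)` evaluated at `x`. -/
def G₄ (Q : QuadricPair K) (x : Fin 4 → K) : K := Q.doubling.G₂ (Q.T₁ x) (-Q.T₂ x)

end Covariants

end QuadricPair

/-! ### Conics and multiplicities -/

section Conics

variable {k : Type*} [Field k]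

/-- `I` is the homogeneous ideal of a (geometrically irreducible) conic in projective `3`-space
defined over `k`: it is generated by a non-zero linear form and a quadratic form not divisible by
it, and stays prime over the algebraic closure. -/
def IsConic (I : Ideal (MvPolynomial (Fin 4) k)) : Prop :=
  (∃ ℓ q : MvPolynomial (Fin 4) k, ℓ.IsHomogeneous 1 ∧ ℓ ≠ 0 ∧ q.IsHomogeneous 2 ∧ ¬ ℓ ∣ q ∧
    I = Ideal.span {ℓ, q}) ∧
  (I.map (MvPolynomial.map (algebraMap k (AlgebraicClosure k)))).IsPrime

/-- The prime ideal `I` is (the ideal of) an irreducible component of `{Q₁ = Q₂ = 0}` and its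
multiplicity, the length of the local ring of `{Q₁ = Q₂ = 0}` at `I`, equals one. -/
def IsComponentOfMultiplicityOne (Q : QuadricPair k) (I : Ideal (MvPolynomial (Fin 4) k)) :
    Prop :=
  I ∈ (Ideal.span (Set.range Q)).minimalPrimes ∧
  ∃ _ : I.IsPrime, Module.length (Localization.AtPrime I)
    (Localization.AtPrime I ⧸ (Ideal.span (Set.range Q)).map
      (algebraMap (MvPolynomial (Fin 4) k) (Localization.AtPrime I))) = 1

/-- The point with coordinates `y` lies on the closed subscheme with homogeneous ideal `I`. -/
def LiesOn (y : Fin 4 → k) (I : Ideal (MvPolynomial (Fin 4) k)) : Prop :=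
  ∀ f ∈ I, eval y f = 0

end Conics

/-! ### Discrete valuation rings -/

section Local

variable (O : Type*) [CommRing O] [IsDomain O] [IsDiscreteValuationRing O]
  {K : Type*} [Field K] [Algebra O K] [IsFractionRing O K]

/-- The absolute value `|x| = c ^ (-v x)` on `K`, where `v` is the normalised discrete valuation,
with values in `ℤᵐ⁰ = {0} ∪ {c ^ i : i ∈ ℤ}` (`c > 1` a formal symbol). -/
def absVal : Valuation K ℤᵐ⁰ := (IsDiscreteValuationRing.maximalIdeal O).valuation K

/-- The projective point with coordinates `x` over `K` reduces to the one with coordinates `y` over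
the residue field: some scaling of `x` has coordinates in `O` reducing to `y ≠ 0`. -/
def ReducesTo (x : Fin 4 → K) (y : Fin 4 → IsLocalRing.ResidueField O) : Prop :=
  y ≠ 0 ∧ ∃ c : K, c ≠ 0 ∧ ∃ u : Fin 4 → O,
    (∀ i, x i = c * algebraMap O K (u i)) ∧ ∀ i, IsLocalRing.residue O (u i) = y i

/-- `max (|F₄(x)|, |G₄(x)|) / max (|x₁|, …, |x₄|) ^ 8`. -/
def localRatio (Q : QuadricPair O) (x : Fin 4 → K) : ℤᵐ⁰ :=
  max (absVal O ((Q.baseChange (algebraMap O K)).F₄ x))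
      (absVal O ((Q.baseChange (algebraMap O K)).G₄ x)) /
    (Finset.univ.sup fun i => absVal O (x i)) ^ 8

end Local

/-! ### The algorithm for conics -/

section Algorithm

variable {O : Type*} [CommRing O]

/-- `Q(π x₁, x₂, x₃, x₄)`. -/
def scaleFirst (π : O) (Q : MvPolynomial (Fin 4) O) : MvPolynomial (Fin 4) O :=
  bind₁ (fun i => if i = 0 then C π * X 0 else X i) Q

/-- `Q(x₁ - (a₂ x₂ + a₃ x₃ + a₄ x₄), x₂, x₃, x₄)`. -/
def shearFirst (a : Fin 3 → O) (Q : MvPolynomial (Fin 4) O) : MvPolynomial (Fin 4) O :=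
  bind₁ (fun i => if i = 0 then X 0 - ∑ j : Fin 3, C (a j) * X j.succ else X i) Q

/-- The term `q` of a quadratic form `λ x₁² + ℓ(x₂,x₃,x₄) x₁ + q(x₂,x₃,x₄)`. -/
def constPart (Q : MvPolynomial (Fin 4) O) : MvPolynomial (Fin 4) O :=
  bind₁ (fun i => if i = 0 then 0 else X i) Q

/-- The term `ℓ` of a quadratic form `λ x₁² + ℓ(x₂,x₃,x₄) x₁ + q(x₂,x₃,x₄)`. -/
def linPart (Q : MvPolynomial (Fin 4) O) : MvPolynomial (Fin 4) O :=
  constPart (pderiv 0 Q)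

/-- Reduction modulo the maximal ideal. -/
abbrev red [IsLocalRing O] :
    MvPolynomial (Fin 4) O →+* MvPolynomial (Fin 4) (IsLocalRing.ResidueField O) :=
  MvPolynomial.map (IsLocalRing.residue O)

/-- A configuration of the algorithm: about to execute Step (ii) or Step (iii) with the current
pair of quadratic forms and the current value of `α`, or stopped with output `α`. -/
inductive State (O : Type*) [CommRing O]
  | stepTwo (Q : QuadricPair O) (α : ℕ)
  | stepThree (Q : QuadricPair O) (α : ℕ)
  | done (α : ℕ)

/-- The transitions of the algorithm, all possible choices being allowed.

* Step (ii): make a `GL₂(O)`-transformation such that the reduction of `Q₁` vanishes on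
  `{x₁ = 0}`; replace `(Q₁, Q₂)` by `(π⁻¹ Q₁(π x₁, x₂, x₃, x₄), Q₂(π x₁, x₂, x₃, x₄))` and add `1`
  to `α`.
* Step (iii): if the reduction of `q₁` belongs to the ideal generated by the reductions of `ℓ₁` and
  `q₂`, say `q₁ ≡ (a₂ x₂ + a₃ x₃ + a₄ x₄) ℓ₁ + b q₂`, substitute
  `x₁ ← x₁ - (a₂ x₂ + a₃ x₃ + a₄ x₄)` and go to Step (ii); otherwise return `α`. -/
inductive Step [IsLocalRing O] (π : O) : State O → State O → Prop
  | two (Q Q' : QuadricPair O) (α : ℕ) (M : GL (Fin 2) O)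
      (hvanish : X 0 ∣ red (Q.linComb M.val 0))
      (h₁ : C π * Q' 0 = scaleFirst π (Q.linComb M.val 0))
      (h₂ : Q' 1 = scaleFirst π (Q.linComb M.val 1)) :
      Step π (.stepTwo Q α) (.stepThree Q' (α + 1))
  | threeLoop (Q : QuadricPair O) (α : ℕ) (a : Fin 3 → O) (b : O)
      (hmem : red (constPart (Q 0)) ∈ Ideal.span {red (linPart (Q 0)), red (constPart (Q 1))})
      (hcongr : red (constPart (Q 0)) =
        red ((∑ j : Fin 3, C (a j) * X j.succ) * linPart (Q 0) + C b * constPart (Q 1))) :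
      Step π (.stepThree Q α) (.stepTwo (fun i => shearFirst a (Q i)) α)
  | threeReturn (Q : QuadricPair O) (α : ℕ)
      (hmem : red (constPart (Q 0)) ∉ Ideal.span {red (linPart (Q 0)), red (constPart (Q 1))}) :
      Step π (.stepThree Q α) (.done α)

/-- Started on `Q`, the algorithm computes `α`: it terminates whatever choices are made, it never
gets stuck, and it always returns `α`. -/
def Computes [IsLocalRing O] (π : O) (Q : QuadricPair O) (α : ℤ) : Prop :=
  Acc (fun t s : State O => Step π s t) (.stepTwo Q 0) ∧
  ∀ s : State O, Relation.ReflTransGen (Step π) (.stepTwo Q 0) s → (∀ t, ¬ Step π s t) →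
    ∃ n : ℕ, s = .done n ∧ (n : ℤ) = α

end Algorithm

end

end GenusOne

open scoped WithZero

namespace GenusOne

open MvPolynomial

noncomputable section

/-! ### Integral formulas for the covariants -/

namespace QuadricPair

section Integral

variable {R S : Type*} [CommRing R] [CommRing S]

/-- The matrix of second partial derivatives of the quadratic form `xᵀ U x`. -/
def hess (U : Matrix (Fin 4) (Fin 4) R) : Matrix (Fin 4) (Fin 4) R := U + U.transpose

theorem hess_apply (U : Matrix (Fin 4) (Fin 4) R) (i j : Fin 4) : hess U i j = U i j + U j i := rfl

theorem hess_transpose (U : Matrix (Fin 4) (Fin 4) R) : (hess U).transpose = hess U := by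
  simp [hess, add_comm]

theorem hess_map (φ : R →+* S) (U : Matrix (Fin 4) (Fin 4) R) :
    hess (U.map φ) = (hess U).map φ := by
  ext i j; simp [hess]

theorem hess_mul (N U : Matrix (Fin 4) (Fin 4) R) :
    hess (N.transpose * U * N) = N.transpose * hess U * N := by
  simp [hess, Matrix.mul_add, Matrix.add_mul, Matrix.transpose_mul, Matrix.mul_assoc]

/-- Half of a diagonal entry of the adjugate of `hess U`. -/
def halfAdj (U : Matrix (Fin 4) (Fin 4) R) (i : Fin 4) : R :=
  let j := i.succAbove 0
  let k := i.succAbove 1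
  let l := i.succAbove 2
  4 * U j j * U k k * U l l + hess U j k * hess U k l * hess U j l
    - U j j * hess U k l ^ 2 - U k k * hess U j l ^ 2 - U l l * hess U j k ^ 2

theorem two_mul_halfAdj (U : Matrix (Fin 4) (Fin 4) R) (i : Fin 4) :
    2 * halfAdj U i = (hess U).adjugate i i := by
  rw [Matrix.adjugate_fin_succ_eq_det_submatrix]
  fin_cases i <;>
  · simp [halfAdj, hess, Matrix.det_fin_three, Fin.succAbove, Fin.lt_def]
    ring

/-- Integral version of `dualCoeff`. -/
def dualI (U : Matrix (Fin 4) (Fin 4) R) (r s : Fin 4) : R :=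
  if r = s then halfAdj U r else (hess U).adjugate r s

/-- Integral version of `covariantT`. -/
def TI (U V : Matrix (Fin 4) (Fin 4) R) (x : Fin 4 → R) : R :=
  ∑ i, ∑ j, ∑ r, ∑ s ∈ Finset.Ici r,
    dualI V r s * (hess U i j * hess U r s - hess U i s * hess U j r) * x i * x j

/-- The `rd` invariant of `xᵀ U x`. -/
def rdI (U : Matrix (Fin 4) (Fin 4) R) : R :=
  4 * U 0 0 * U 1 1 * U 2 2 * U 3 3
  - (U 0 0 * U 1 1 * hess U 2 3 ^ 2 + U 0 0 * U 2 2 * hess U 1 3 ^ 2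
    + U 0 0 * U 3 3 * hess U 1 2 ^ 2 + U 1 1 * U 2 2 * hess U 0 3 ^ 2
    + U 1 1 * U 3 3 * hess U 0 2 ^ 2 + U 2 2 * U 3 3 * hess U 0 1 ^ 2)
  + (U 0 0 * hess U 1 2 * hess U 1 3 * hess U 2 3 + U 1 1 * hess U 0 2 * hess U 0 3 * hess U 2 3
    + U 2 2 * hess U 0 1 * hess U 0 3 * hess U 1 3 + U 3 3 * hess U 0 1 * hess U 0 2 * hess U 1 2)
  - (hess U 0 1 * hess U 0 2 * hess U 1 3 * hess U 2 3
    + hess U 0 1 * hess U 0 3 * hess U 1 2 * hess U 2 3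
    + hess U 0 2 * hess U 0 3 * hess U 1 2 * hess U 1 3)

theorem det_hess (U : Matrix (Fin 4) (Fin 4) R) :
    (hess U).det = pf (hess U) ^ 2 + 4 * rdI U := by
  rw [Matrix.det_succ_row_zero]
  simp [Fin.sum_univ_four, Matrix.det_fin_three, Fin.succAbove, hess, pf, rdI]
  ring

/-- The pencil `x U + V`. -/
def pencilI (U V : Matrix (Fin 4) (Fin 4) R) : Matrix (Fin 4) (Fin 4) (Polynomial R) :=
  fun i j => Polynomial.C (U i j) * Polynomial.X + Polynomial.C (V i j)

/-- Integral version of `doubling`. -/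
def doublingI (U V : Matrix (Fin 4) (Fin 4) R) : GenBinaryQuartic R where
  l := (pf (hess (pencilI U V))).coeff 2
  m := (pf (hess (pencilI U V))).coeff 1
  n := (pf (hess (pencilI U V))).coeff 0
  a := (rdI (pencilI U V)).coeff 4
  b := (rdI (pencilI U V)).coeff 3
  c := (rdI (pencilI U V)).coeff 2
  d := (rdI (pencilI U V)).coeff 1
  e := (rdI (pencilI U V)).coeff 0

/-- Integral version of `F₄`. -/
def F4I (U V : Matrix (Fin 4) (Fin 4) R) (x : Fin 4 → R) : R :=
  (doublingI U V).F₂ (TI U V x) (-TI V U x)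

/-- Integral version of `G₄`. -/
def G4I (U V : Matrix (Fin 4) (Fin 4) R) (x : Fin 4 → R) : R :=
  (doublingI U V).G₂ (TI U V x) (-TI V U x)

theorem halfAdj_map (φ : R →+* S) (U : Matrix (Fin 4) (Fin 4) R) (i : Fin 4) :
    halfAdj (U.map φ) i = φ (halfAdj U i) := by
  simp [halfAdj, hess_map, map_ofNat]

theorem dualI_map (φ : R →+* S) (U : Matrix (Fin 4) (Fin 4) R) (r s : Fin 4) :
    dualI (U.map φ) r s = φ (dualI U r s) := by
  unfold dualI
  split_ifs
  · exact halfAdj_map φ U r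
  · rw [hess_map]
    have := congrFun (congrFun (RingHom.map_adjugate φ (hess U)) r) s
    simpa using this.symm

theorem TI_map (φ : R →+* S) (U V : Matrix (Fin 4) (Fin 4) R) (x : Fin 4 → R) :
    TI (U.map φ) (V.map φ) (fun i => φ (x i)) = φ (TI U V x) := by
  simp [TI, dualI_map, hess_map]

theorem rdI_map (φ : R →+* S) (U : Matrix (Fin 4) (Fin 4) R) : rdI (U.map φ) = φ (rdI U) := by
  simp [rdI, hess_map, map_ofNat]

theorem pf_map (φ : R →+* S) (U : Matrix (Fin 4) (Fin 4) R) : pf (U.map φ) = φ (pf U) := by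
  simp [pf]

theorem pencilI_map (φ : R →+* S) (U V : Matrix (Fin 4) (Fin 4) R) :
    pencilI (U.map φ) (V.map φ) = (pencilI U V).map (Polynomial.mapRingHom φ) := by
  ext1 i j
  simp [pencilI]

theorem doublingI_map (φ : R →+* S) (U V : Matrix (Fin 4) (Fin 4) R) :
    doublingI (U.map φ) (V.map φ) =
      let D := doublingI U V
      ⟨φ D.l, φ D.m, φ D.n, φ D.a, φ D.b, φ D.c, φ D.d, φ D.e⟩ := by
  simp only [doublingI, pencilI_map, rdI_map, hess_map, pf_map]
  simp only [Polynomial.coe_mapRingHom, Polynomial.coeff_map]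

theorem F4I_map (φ : R →+* S) (U V : Matrix (Fin 4) (Fin 4) R) (x : Fin 4 → R) :
    F4I (U.map φ) (V.map φ) (fun i => φ (x i)) = φ (F4I U V x) := by
  simp only [F4I, doublingI_map, TI_map]
  simp [GenBinaryQuartic.F₂, map_ofNat]

theorem G4I_map (φ : R →+* S) (U V : Matrix (Fin 4) (Fin 4) R) (x : Fin 4 → R) :
    G4I (U.map φ) (V.map φ) (fun i => φ (x i)) = φ (G4I U V x) := by
  simp only [G4I, doublingI_map, TI_map]
  simp [GenBinaryQuartic.G₂, map_ofNat]

end Integral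

section Field

variable {K : Type*} [Field K]

theorem dualI_eq_dualCoeff (h2 : (2 : K) ≠ 0) (U : Matrix (Fin 4) (Fin 4) K) (r s : Fin 4) :
    dualI U r s = dualCoeff (hess U) r s := by
  unfold dualI dualCoeff
  split_ifs
  · rw [← two_mul_halfAdj, mul_div_cancel_left₀ _ h2]
  · rfl

theorem hess_pencilI (U V : Matrix (Fin 4) (Fin 4) K) (Q : QuadricPair K)
    (h0 : hessian (Q 0) = hess U) (h1 : hessian (Q 1) = hess V) :
    Q.pencil = hess (pencilI U V) := by
  ext1 i j
  simp only [pencil, h0, h1, hess_apply, pencilI, Polynomial.C_add]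
  ring

theorem rdPoly_eq (h2 : (2 : K) ≠ 0) (U V : Matrix (Fin 4) (Fin 4) K) (Q : QuadricPair K)
    (h0 : hessian (Q 0) = hess U) (h1 : hessian (Q 1) = hess V) :
    Q.rdPoly = rdI (pencilI U V) := by
  have h4 : (4 : K) ≠ 0 := by
    have : (4 : K) = 2 * 2 := by norm_num
    rw [this]; exact mul_ne_zero h2 h2
  rw [rdPoly, pfPoly, hess_pencilI U V Q h0 h1, det_hess, add_sub_cancel_left, ← mul_assoc]
  have : (4 : Polynomial K) = Polynomial.C 4 := rfl
  rw [this, ← Polynomial.C_mul, one_div, inv_mul_cancel₀ h4, Polynomial.C_1, one_mul]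

theorem doubling_eq (h2 : (2 : K) ≠ 0) (U V : Matrix (Fin 4) (Fin 4) K) (Q : QuadricPair K)
    (h0 : hessian (Q 0) = hess U) (h1 : hessian (Q 1) = hess V) :
    Q.doubling = doublingI U V := by
  rw [doubling, doublingI, rdPoly_eq h2 U V Q h0 h1, pfPoly, hess_pencilI U V Q h0 h1]

theorem covariantT_eq_TI (h2 : (2 : K) ≠ 0) (U V : Matrix (Fin 4) (Fin 4) K) (x : Fin 4 → K) :
    covariantT (hess U) (hess V) x = TI U V x := by
  simp only [covariantT, TI, dualI_eq_dualCoeff h2]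

theorem F₄_eq_F4I (h2 : (2 : K) ≠ 0) (U V : Matrix (Fin 4) (Fin 4) K) (Q : QuadricPair K)
    (h0 : hessian (Q 0) = hess U) (h1 : hessian (Q 1) = hess V) (x : Fin 4 → K) :
    Q.F₄ x = F4I U V x := by
  rw [F₄, F4I, T₁, T₂, doubling_eq h2 U V Q h0 h1, h0, h1, covariantT_eq_TI h2, covariantT_eq_TI h2]

theorem G₄_eq_G4I (h2 : (2 : K) ≠ 0) (U V : Matrix (Fin 4) (Fin 4) K) (Q : QuadricPair K)
    (h0 : hessian (Q 0) = hess U) (h1 : hessian (Q 1) = hess V) (x : Fin 4 → K) :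
    Q.G₄ x = G4I U V x := by
  rw [G₄, G4I, T₁, T₂, doubling_eq h2 U V Q h0 h1, h0, h1, covariantT_eq_TI h2, covariantT_eq_TI h2]

end Field

end QuadricPair

namespace QuadricPair

section Covariance

variable {R : Type*} [CommRing R]

open Matrix in
theorem two_mul_TI (U V : Matrix (Fin 4) (Fin 4) R) (x : Fin 4 → R) :
    2 * TI U V x = (x ⬝ᵥ hess U *ᵥ x) * ((hess V).adjugate * hess U).trace
      - (hess U *ᵥ x) ⬝ᵥ (hess V).adjugate *ᵥ (hess U *ᵥ x) := by
  have hA : ∀ i j, hess U i j = hess U j i := fun i j => by rw [hess_apply, hess_apply, add_comm]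
  have hD : ∀ i j, (hess V).adjugate i j = (hess V).adjugate j i := fun i j => by
    conv_lhs => rw [← hess_transpose V, ← Matrix.adjugate_transpose]
    rfl
  have hh := two_mul_halfAdj V
  have i0 : Finset.Ici (0 : Fin 4) = {0, 1, 2, 3} := by decide
  have i1 : Finset.Ici (1 : Fin 4) = {1, 2, 3} := by decide
  have i2 : Finset.Ici (2 : Fin 4) = {2, 3} := by decide
  have i3 : Finset.Ici (3 : Fin 4) = {3} := by decide
  simp only [TI, dualI]
  generalize hess U = A at *
  generalize (hess V).adjugate = D at *
  generalize halfAdj V = h at *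
  simp only [Fin.sum_univ_four, i0, i1, i2, i3, dotProduct, mulVec, Matrix.trace, Matrix.diag,
    Matrix.mul_apply]
  simp only [← hh]
  simp [hA 1 0, hA 2 0, hA 3 0, hA 2 1, hA 3 1, hA 3 2, hD 1 0, hD 2 0, hD 3 0, hD 2 1, hD 3 1,
    hD 3 2]
  ring

variable [IsDomain R] [CharZero R]

open Matrix in
theorem TI_mul (N U V : Matrix (Fin 4) (Fin 4) R) (x : Fin 4 → R) :
    TI (Nᵀ * U * N) (Nᵀ * V * N) x = N.det ^ 2 * TI U V (N *ᵥ x) := by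
  have h2 : (2 : R) ≠ 0 := two_ne_zero
  apply mul_left_cancel₀ h2
  rw [mul_left_comm, two_mul_TI, two_mul_TI, hess_mul, hess_mul]
  generalize hess U = A
  generalize hess V = B
  have e1 : x ⬝ᵥ (Nᵀ * A * N) *ᵥ x = (N *ᵥ x) ⬝ᵥ A *ᵥ (N *ᵥ x) := by
    rw [← mulVec_mulVec, ← mulVec_mulVec, dotProduct_mulVec, vecMul_transpose]
  have e2 : (Nᵀ * B * N).adjugate * (Nᵀ * A * N) = N.det • (N.adjugate * (B.adjugate * A) * N) := by
    rw [adjugate_mul_distrib, adjugate_mul_distrib]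
    calc N.adjugate * (B.adjugate * Nᵀ.adjugate) * (Nᵀ * A * N)
        = N.adjugate * B.adjugate * (Nᵀ.adjugate * Nᵀ) * A * N := by simp only [Matrix.mul_assoc]
      _ = _ := by
        rw [adjugate_mul, det_transpose]
        simp [Matrix.mul_assoc]
  have e3 : ((Nᵀ * B * N).adjugate * (Nᵀ * A * N)).trace = N.det ^ 2 * (B.adjugate * A).trace := by
    rw [e2, trace_smul, Matrix.mul_assoc, trace_mul_comm, Matrix.mul_assoc, mul_adjugate]
    simp [sq, mul_assoc]
  have e4 : ((Nᵀ * A * N) *ᵥ x) ⬝ᵥ (Nᵀ * B * N).adjugate *ᵥ ((Nᵀ * A * N) *ᵥ x) =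
      N.det ^ 2 * ((A *ᵥ (N *ᵥ x)) ⬝ᵥ B.adjugate *ᵥ (A *ᵥ (N *ᵥ x))) := by
    rw [mulVec_mulVec, e2, smul_mulVec, dotProduct_smul, ← mulVec_mulVec, ← mulVec_mulVec,
      ← mulVec_mulVec, ← mulVec_mulVec, ← mulVec_mulVec]
    generalize N *ᵥ x = y
    rw [dotProduct_comm, dotProduct_mulVec, vecMul_transpose, mulVec_mulVec, mul_adjugate,
      smul_mulVec, one_mulVec, smul_dotProduct, dotProduct_comm]
    simp only [smul_eq_mul]; ring
  rw [e1, e3, e4]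
  ring

end Covariance

section Pencil

variable {R : Type*} [CommRing R]

/-- The polarisation of `pf`. -/
def pfPolar (A B : Matrix (Fin 4) (Fin 4) R) : R :=
  A 0 1 * B 2 3 + B 0 1 * A 2 3 + A 0 2 * B 1 3 + B 0 2 * A 1 3 + A 0 3 * B 1 2 + B 0 3 * A 1 2

theorem pf_add (A B : Matrix (Fin 4) (Fin 4) R) : pf (A + B) = pf A + pf B + pfPolar A B := by
  simp [pf, pfPolar]; ring

theorem pf_pencilI (U V : Matrix (Fin 4) (Fin 4) R) :
    pf (hess (pencilI U V)) = Polynomial.C (pf (hess U)) * Polynomial.X ^ 2 +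
      Polynomial.C (pfPolar (hess U) (hess V)) * Polynomial.X + Polynomial.C (pf (hess V)) := by
  simp [pf, pfPolar, hess_apply, pencilI]; ring

theorem doublingI_l (U V : Matrix (Fin 4) (Fin 4) R) : (doublingI U V).l = pf (hess U) := by
  simp [doublingI, pf_pencilI, Polynomial.coeff_X, Polynomial.coeff_C]

theorem doublingI_m (U V : Matrix (Fin 4) (Fin 4) R) :
    (doublingI U V).m = pfPolar (hess U) (hess V) := by
  simp [doublingI, pf_pencilI, Polynomial.coeff_X, Polynomial.coeff_C]

theorem doublingI_n (U V : Matrix (Fin 4) (Fin 4) R) : (doublingI U V).n = pf (hess V) := by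
  simp [doublingI, pf_pencilI, Polynomial.coeff_X, Polynomial.coeff_C]

/-- The determinant of the pencil of matrices of second partial derivatives. -/
def detPencil (U V : Matrix (Fin 4) (Fin 4) R) : Polynomial R := (hess (pencilI U V)).det

theorem coeff_quadratic_sq (l m n : R) (i : ℕ) :
    ((Polynomial.C l * Polynomial.X ^ 2 + Polynomial.C m * Polynomial.X + Polynomial.C n) ^ 2).coeff i
      = if i = 4 then l ^ 2 else if i = 3 then 2 * l * m else if i = 2 then m ^ 2 + 2 * l * n else
        if i = 1 then 2 * m * n else if i = 0 then n ^ 2 else 0 := by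
  have : (Polynomial.C l * Polynomial.X ^ 2 + Polynomial.C m * Polynomial.X + Polynomial.C n) ^ 2 =
      Polynomial.C (l ^ 2) * Polynomial.X ^ 4 + Polynomial.C (2 * l * m) * Polynomial.X ^ 3 +
      Polynomial.C (m ^ 2 + 2 * l * n) * Polynomial.X ^ 2 + Polynomial.C (2 * m * n) * Polynomial.X ^ 1
      + Polynomial.C (n ^ 2) * Polynomial.X ^ 0 := by
    simp only [Polynomial.C_add, Polynomial.C_mul, Polynomial.C_pow, Polynomial.C_ofNat]; ring
  rw [this]
  simp only [Polynomial.coeff_add, Polynomial.coeff_C_mul_X_pow]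
  split_ifs <;> first | omega | simp

theorem detPencil_coeff (U V : Matrix (Fin 4) (Fin 4) R) :
    let D := doublingI U V
    (detPencil U V).coeff 4 = D.l ^ 2 + 4 * D.a ∧
    (detPencil U V).coeff 3 = 2 * D.l * D.m + 4 * D.b ∧
    (detPencil U V).coeff 2 = D.m ^ 2 + 2 * D.l * D.n + 4 * D.c ∧
    (detPencil U V).coeff 1 = 2 * D.m * D.n + 4 * D.d ∧
    (detPencil U V).coeff 0 = D.n ^ 2 + 4 * D.e := by
  have key : ∀ i, (detPencil U V).coeff i =
      (pf (hess (pencilI U V)) ^ 2).coeff i + 4 * (rdI (pencilI U V)).coeff i := fun i => by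
    rw [detPencil, det_hess, Polynomial.coeff_add]
    congr 1
    rw [← Polynomial.C_ofNat, Polynomial.coeff_C_mul]
  simp only [key, pf_pencilI, coeff_quadratic_sq, doublingI_l, doublingI_m, doublingI_n]
  simp [doublingI]

open Matrix in
theorem pencilI_mul (N U V : Matrix (Fin 4) (Fin 4) R) :
    pencilI (Nᵀ * U * N) (Nᵀ * V * N) =
      (N.map Polynomial.C)ᵀ * pencilI U V * N.map Polynomial.C := by
  have h : ∀ U V : Matrix (Fin 4) (Fin 4) R, pencilI U V =
      (Polynomial.X : Polynomial R) • U.map Polynomial.C + V.map Polynomial.C := fun U V => by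
    ext1 i j; simp [pencilI]
  rw [h, h, Matrix.map_mul, Matrix.map_mul, Matrix.map_mul, Matrix.map_mul, Matrix.mul_add,
    Matrix.add_mul, Matrix.mul_smul, Matrix.smul_mul, Matrix.transpose_map]

open Matrix in
theorem detPencil_mul (N U V : Matrix (Fin 4) (Fin 4) R) :
    detPencil (Nᵀ * U * N) (Nᵀ * V * N) = Polynomial.C (N.det ^ 2) * detPencil U V := by
  have : (N.map Polynomial.C).det = Polynomial.C N.det :=
    (RingHom.map_det Polynomial.C N).symm
  rw [detPencil, pencilI_mul, hess_mul, det_mul, det_mul, det_transpose, this, detPencil,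
    Polynomial.C_pow]
  ring

theorem pf_hess_mul_of_two_eq_zero (h2 : (2 : R) = 0) (N U : Matrix (Fin 4) (Fin 4) R) :
    pf (hess (N.transpose * U * N)) = N.det * pf (hess U) := by
  have hd : ∀ i, hess U i i = 0 := fun i => by rw [hess_apply, ← two_mul, h2, zero_mul]
  have hs : ∀ i j, hess U i j = - hess U j i := fun i j => by
    rw [hess_apply, hess_apply, eq_neg_iff_add_eq_zero]
    linear_combination (U i j + U j i) * h2
  rw [hess_mul]
  generalize hess U = A at *
  have hdet : N.det = N 0 0 * (N 1 1 * (N 2 2 * N 3 3 - N 2 3 * N 3 2)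
      - N 1 2 * (N 2 1 * N 3 3 - N 2 3 * N 3 1) + N 1 3 * (N 2 1 * N 3 2 - N 2 2 * N 3 1))
      - N 0 1 * (N 1 0 * (N 2 2 * N 3 3 - N 2 3 * N 3 2)
      - N 1 2 * (N 2 0 * N 3 3 - N 2 3 * N 3 0) + N 1 3 * (N 2 0 * N 3 2 - N 2 2 * N 3 0))
      + N 0 2 * (N 1 0 * (N 2 1 * N 3 3 - N 2 3 * N 3 1)
      - N 1 1 * (N 2 0 * N 3 3 - N 2 3 * N 3 0) + N 1 3 * (N 2 0 * N 3 1 - N 2 1 * N 3 0))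
      - N 0 3 * (N 1 0 * (N 2 1 * N 3 2 - N 2 2 * N 3 1)
      - N 1 1 * (N 2 0 * N 3 2 - N 2 2 * N 3 0) + N 1 2 * (N 2 0 * N 3 1 - N 2 1 * N 3 0)) := by
    rw [Matrix.det_succ_row_zero]
    simp [Fin.sum_univ_four, Matrix.det_fin_three, Fin.succAbove]
    ring
  have hent : ∀ i j, (N.transpose * A * N) i j =
      A 0 1 * (N 0 i * N 1 j - N 1 i * N 0 j) + A 0 2 * (N 0 i * N 2 j - N 2 i * N 0 j) +
      A 0 3 * (N 0 i * N 3 j - N 3 i * N 0 j) + A 1 2 * (N 1 i * N 2 j - N 2 i * N 1 j) +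
      A 1 3 * (N 1 i * N 3 j - N 3 i * N 1 j) + A 2 3 * (N 2 i * N 3 j - N 3 i * N 2 j) := by
    intro i j
    simp only [Matrix.mul_apply, Fin.sum_univ_four, Matrix.transpose_apply]
    rw [hd 0, hd 1, hd 2, hd 3, hs 1 0, hs 2 0, hs 3 0, hs 2 1, hs 3 1, hs 3 2]
    ring
  rw [hdet]
  have key : ∀ B : Matrix (Fin 4) (Fin 4) R,
      pf B = B 0 1 * B 2 3 - B 0 2 * B 1 3 + B 0 3 * B 1 2 := fun B => by
    rw [pf]; linear_combination B 0 2 * B 1 3 * h2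
  rw [key, key, hent 0 1, hent 2 3, hent 0 2, hent 1 3, hent 0 3, hent 1 2]
  ring

theorem exists_pf_hess_mul (N U : Matrix (Fin 4) (Fin 4) R) :
    ∃ s, pf (hess (N.transpose * U * N)) = N.det * pf (hess U) + 2 * s := by
  let φ := Ideal.Quotient.mk (Ideal.span {(2 : R)})
  have h2 : (2 : R ⧸ Ideal.span {(2 : R)}) = 0 := by
    have : φ 2 = 0 := Ideal.Quotient.eq_zero_iff_mem.2 (Ideal.mem_span_singleton_self 2)
    rwa [map_ofNat] at this
  have h := pf_hess_mul_of_two_eq_zero h2 (N.map φ) (U.map φ)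
  rw [← Matrix.transpose_map, ← Matrix.map_mul, ← Matrix.map_mul, hess_map, pf_map, hess_map, pf_map,
    ← RingHom.mapMatrix_apply, ← RingHom.map_det, ← map_mul, ← sub_eq_zero, ← map_sub,
    Ideal.Quotient.eq_zero_iff_mem, Ideal.mem_span_singleton] at h
  obtain ⟨s, hs⟩ := h
  exact ⟨s, by linear_combination hs⟩

end Pencil

end QuadricPair

namespace QuadricPair

section Elementary

variable {R : Type*} [CommRing R]

/-- The coefficient of `x ^ i z ^ (4 - i)` in the product of the linear forms `a₁ x + a₂ z`,
`b₁ x + b₂ z`, `c₁ x + c₂ z`, `d₁ x + d₂ z`. -/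
def prodCoeff (i : Fin 5) (a b c d : R × R) : R :=
  match i with
  | 0 => a.2 * b.2 * c.2 * d.2
  | 1 => a.1 * b.2 * c.2 * d.2 + a.2 * b.1 * c.2 * d.2 + a.2 * b.2 * c.1 * d.2
      + a.2 * b.2 * c.2 * d.1
  | 2 => a.1 * b.1 * c.2 * d.2 + a.1 * b.2 * c.1 * d.2 + a.1 * b.2 * c.2 * d.1
      + a.2 * b.1 * c.1 * d.2 + a.2 * b.1 * c.2 * d.1 + a.2 * b.2 * c.1 * d.1
  | 3 => a.2 * b.1 * c.1 * d.1 + a.1 * b.2 * c.1 * d.1 + a.1 * b.1 * c.2 * d.1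
      + a.1 * b.1 * c.1 * d.2
  | 4 => a.1 * b.1 * c.1 * d.1

/-- The coefficient of `x ^ i z ^ (4 - i)` in `rd (x U + z V)`. -/
def rdCoeff (U V : Matrix (Fin 4) (Fin 4) R) (i : Fin 5) : R :=
  let u (j : Fin 4) : R × R := (U j j, V j j)
  let h (j k : Fin 4) : R × R := (hess U j k, hess V j k)
  let f := prodCoeff i
  4 * f (u 0) (u 1) (u 2) (u 3)
  - (f (u 0) (u 1) (h 2 3) (h 2 3) + f (u 0) (u 2) (h 1 3) (h 1 3)
    + f (u 0) (u 3) (h 1 2) (h 1 2) + f (u 1) (u 2) (h 0 3) (h 0 3)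
    + f (u 1) (u 3) (h 0 2) (h 0 2) + f (u 2) (u 3) (h 0 1) (h 0 1))
  + (f (u 0) (h 1 2) (h 1 3) (h 2 3) + f (u 1) (h 0 2) (h 0 3) (h 2 3)
    + f (u 2) (h 0 1) (h 0 3) (h 1 3) + f (u 3) (h 0 1) (h 0 2) (h 1 2))
  - (f (h 0 1) (h 0 2) (h 1 3) (h 2 3) + f (h 0 1) (h 0 3) (h 1 2) (h 2 3)
    + f (h 0 2) (h 0 3) (h 1 2) (h 1 3))

theorem rdI_smul_add (U V : Matrix (Fin 4) (Fin 4) R) (x z : R) :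
    rdI (x • U + z • V) = rdCoeff U V 4 * x ^ 4 + rdCoeff U V 3 * x ^ 3 * z
      + rdCoeff U V 2 * x ^ 2 * z ^ 2 + rdCoeff U V 1 * x * z ^ 3 + rdCoeff U V 0 * z ^ 4 := by
  have hh : ∀ i j, hess (x • U + z • V) i j = x * hess U i j + z * hess V i j := fun i j => by
    simp [hess_apply]; ring
  have hu : ∀ i j, (x • U + z • V) i j = x * U i j + z * V i j := fun i j => by simp
  simp only [rdI, hh, hu, rdCoeff, prodCoeff]
  ring

theorem rdCoeff_map {S : Type*} [CommRing S] (φ : R →+* S) (U V : Matrix (Fin 4) (Fin 4) R)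
    (i : Fin 5) : rdCoeff (U.map φ) (V.map φ) i = φ (rdCoeff U V i) := by
  fin_cases i <;> simp [rdCoeff, prodCoeff, hess_map, map_ofNat]

theorem doublingI_rd (U V : Matrix (Fin 4) (Fin 4) R) :
    (doublingI U V).a = rdCoeff U V 4 ∧ (doublingI U V).b = rdCoeff U V 3 ∧
    (doublingI U V).c = rdCoeff U V 2 ∧ (doublingI U V).d = rdCoeff U V 1 ∧
    (doublingI U V).e = rdCoeff U V 0 := by
  have h : rdI (pencilI U V) = Polynomial.C (rdCoeff U V 4) * Polynomial.X ^ 4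
      + Polynomial.C (rdCoeff U V 3) * Polynomial.X ^ 3
      + Polynomial.C (rdCoeff U V 2) * Polynomial.X ^ 2
      + Polynomial.C (rdCoeff U V 1) * Polynomial.X ^ 1
      + Polynomial.C (rdCoeff U V 0) * Polynomial.X ^ 0 := by
    have : pencilI U V = (Polynomial.X : Polynomial R) • U.map Polynomial.C
        + (1 : Polynomial R) • V.map Polynomial.C := by
      ext1 i j; simp [pencilI]
    rw [this, rdI_smul_add]
    simp only [rdCoeff_map]
    ring
  simp only [doublingI, h, Polynomial.coeff_add, Polynomial.coeff_C_mul_X_pow]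
  simp

theorem rdCoeff_swap (U V : Matrix (Fin 4) (Fin 4) R) (i : Fin 5) :
    rdCoeff V U i = rdCoeff U V i.rev := by
  have h : ∀ a b c d : R × R,
      prodCoeff i a.swap b.swap c.swap d.swap = prodCoeff i.rev a b c d := by
    intro a b c d
    fin_cases i <;> (simp [prodCoeff, Fin.rev]; try ring)
  simp only [rdCoeff, ← h, Prod.swap]

end Elementary

end QuadricPair

namespace GenBinaryQuartic

variable {R : Type*} [CommRing R]

theorem F₂_smul (D : GenBinaryQuartic R) (t x z : R) : D.F₂ (t * x) (t * z) = t ^ 4 * D.F₂ x z := by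
  simp only [F₂]; ring

theorem G₂_smul (D : GenBinaryQuartic R) (t x z : R) : D.G₂ (t * x) (t * z) = t ^ 4 * D.G₂ x z := by
  simp only [G₂]; ring

theorem G₂_shift [IsDomain R] [CharZero R] (D D' : GenBinaryQuartic R) (δ s₂ s₁ s₀ x z : R)
    (hl : D'.l = δ * D.l + 2 * s₂) (hm : D'.m = δ * D.m + 2 * s₁) (hn : D'.n = δ * D.n + 2 * s₀)
    (h4 : D'.l ^ 2 + 4 * D'.a = δ ^ 2 * (D.l ^ 2 + 4 * D.a))
    (h3 : 2 * D'.l * D'.m + 4 * D'.b = δ ^ 2 * (2 * D.l * D.m + 4 * D.b))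
    (h2 : D'.m ^ 2 + 2 * D'.l * D'.n + 4 * D'.c = δ ^ 2 * (D.m ^ 2 + 2 * D.l * D.n + 4 * D.c))
    (h1 : 2 * D'.m * D'.n + 4 * D'.d = δ ^ 2 * (2 * D.m * D.n + 4 * D.d))
    (h0 : D'.n ^ 2 + 4 * D'.e = δ ^ 2 * (D.n ^ 2 + 4 * D.e)) :
    D'.F₂ x z = δ ^ 2 * D.F₂ x z ∧
    D'.G₂ x z = δ ^ 4 * D.G₂ x z +
      δ ^ 2 * (δ * D.l * s₀ + δ * D.n * s₂ + 2 * s₀ * s₂) * D.F₂ x z := by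
  obtain ⟨l, m, n, a, b, c, d, e⟩ := D
  obtain ⟨l', m', n', a', b', c', d', e'⟩ := D'
  have h4z : (4 : R) ≠ 0 := by norm_num
  simp only at hl hm hn h4 h3 h2 h1 h0
  subst hl hm hn
  obtain rfl : a' = δ ^ 2 * a - δ * l * s₂ - s₂ ^ 2 :=
    mul_left_cancel₀ h4z (by linear_combination h4)
  obtain rfl : b' = δ ^ 2 * b - δ * (l * s₁ + m * s₂) - 2 * s₁ * s₂ :=
    mul_left_cancel₀ h4z (by linear_combination h3)
  obtain rfl : c' = δ ^ 2 * c - δ * (m * s₁ + l * s₀ + n * s₂) - s₁ ^ 2 - 2 * s₀ * s₂ :=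
    mul_left_cancel₀ h4z (by linear_combination h2)
  obtain rfl : d' = δ ^ 2 * d - δ * (m * s₀ + n * s₁) - 2 * s₁ * s₀ :=
    mul_left_cancel₀ h4z (by linear_combination h1)
  obtain rfl : e' = δ ^ 2 * e - δ * n * s₀ - s₀ ^ 2 :=
    mul_left_cancel₀ h4z (by linear_combination h0)
  constructor
  · simp only [F₂]; ring
  · simp only [G₂, F₂]; ring

end GenBinaryQuartic

namespace QuadricPair

section Substitution

variable {R : Type*} [CommRing R] [IsDomain R] [CharZero R]

open Matrix in
theorem F4I_G4I_mul (N U V : Matrix (Fin 4) (Fin 4) R) (x : Fin 4 → R) :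
    F4I (Nᵀ * U * N) (Nᵀ * V * N) x = N.det ^ 10 * F4I U V (N *ᵥ x) ∧
    ∃ r, G4I (Nᵀ * U * N) (Nᵀ * V * N) x =
      N.det ^ 12 * G4I U V (N *ᵥ x) + r * F4I U V (N *ᵥ x) := by
  obtain ⟨s₂, hs₂⟩ := exists_pf_hess_mul N U
  obtain ⟨s₀, hs₀⟩ := exists_pf_hess_mul N V
  obtain ⟨s, hs⟩ := exists_pf_hess_mul N (U + V)
  have hadd : ∀ A B : Matrix (Fin 4) (Fin 4) R, hess (A + B) = hess A + hess B := fun A B => by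
    ext i j; simp [hess_apply]; ring
  have hs₁ : pfPolar (hess (Nᵀ * U * N)) (hess (Nᵀ * V * N)) =
      N.det * pfPolar (hess U) (hess V) + 2 * (s - s₂ - s₀) := by
    rw [Matrix.mul_add, Matrix.add_mul, hadd, hadd, pf_add, pf_add, hs₂, hs₀] at hs
    linear_combination hs
  obtain ⟨e4, e3, e2, e1, e0⟩ := detPencil_coeff U V
  obtain ⟨f4, f3, f2, f1, f0⟩ := detPencil_coeff (Nᵀ * U * N) (Nᵀ * V * N)
  rw [detPencil_mul, Polynomial.coeff_C_mul] at f4 f3 f2 f1 f0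
  rw [e4] at f4
  rw [e3] at f3
  rw [e2] at f2
  rw [e1] at f1
  rw [e0] at f0
  have key := fun x z => GenBinaryQuartic.G₂_shift (doublingI U V)
    (doublingI (Nᵀ * U * N) (Nᵀ * V * N)) N.det s₂ (s - s₂ - s₀) s₀ x z
    (by rw [doublingI_l, doublingI_l, hs₂]) (by rw [doublingI_m, doublingI_m, hs₁])
    (by rw [doublingI_n, doublingI_n, hs₀]) f4.symm f3.symm f2.symm f1.symm f0.symm
  simp only [F4I, G4I, TI_mul, ← mul_neg, GenBinaryQuartic.F₂_smul, GenBinaryQuartic.G₂_smul,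
    (key _ _).1, (key _ _).2]
  refine ⟨by ring, ?_⟩
  exact ⟨N.det ^ 8 * (N.det ^ 2 * (N.det * (doublingI U V).l * s₀ + N.det * (doublingI U V).n * s₂
    + 2 * s₀ * s₂)), by ring⟩

end Substitution

end QuadricPair

namespace QuadricPair

section Pencil

variable {R : Type*} [CommRing R]

theorem doublingI_swap (U V : Matrix (Fin 4) (Fin 4) R) :
    doublingI V U = let D := doublingI U V; ⟨D.n, D.m, D.l, D.e, D.d, D.c, D.b, D.a⟩ := by
  have hm : pfPolar (hess V) (hess U) = pfPolar (hess U) (hess V) := by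
    simp only [pfPolar]; ring
  obtain ⟨ha, hb, hc, hd, he⟩ := doublingI_rd U V
  obtain ⟨ha', hb', hc', hd', he'⟩ := doublingI_rd V U
  rw [rdCoeff_swap] at ha' hb' hc' hd' he'
  rw [GenBinaryQuartic.mk.injEq, doublingI_l, doublingI_m, doublingI_n, hm]
  simp only [doublingI_l, doublingI_m, doublingI_n, ha, hb, hc, hd, he, ha', hb', hc', hd', he']
  simp [Fin.rev]

theorem F4I_swap (U V : Matrix (Fin 4) (Fin 4) R) (x : Fin 4 → R) :
    F4I V U x = F4I U V x := by
  simp only [F4I, doublingI_swap U V, GenBinaryQuartic.F₂]; ring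

theorem G4I_swap (U V : Matrix (Fin 4) (Fin 4) R) (x : Fin 4 → R) :
    G4I V U x = G4I U V x := by
  simp only [G4I, doublingI_swap U V, GenBinaryQuartic.G₂]; ring

theorem prodCoeff_smul (t : R) (i : Fin 5) (a b c d : R × R) :
    prodCoeff i (t * a.1, a.2) (t * b.1, b.2) (t * c.1, c.2) (t * d.1, d.2) =
      t ^ (i : ℕ) * prodCoeff i a b c d := by
  fin_cases i <;> (simp [prodCoeff]; try ring)

theorem rdCoeff_smul (t : R) (U V : Matrix (Fin 4) (Fin 4) R) (i : Fin 5) :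
    rdCoeff (t • U) V i = t ^ (i : ℕ) * rdCoeff U V i := by
  have hh : ∀ i j, hess (t • U) i j = t * hess U i j := fun i j => by
    simp [hess_apply]; ring
  have h := fun a b c d : R × R => prodCoeff_smul t i a b c d
  simp only [Prod.forall] at h
  simp only [rdCoeff, hh, Matrix.smul_apply, smul_eq_mul, h]
  ring

theorem hess_smul (t : R) (U : Matrix (Fin 4) (Fin 4) R) : hess (t • U) = t • hess U := by
  simp [hess]

theorem doublingI_smul (t : R) (U V : Matrix (Fin 4) (Fin 4) R) :
    doublingI (t • U) V = let D := doublingI U V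
      ⟨t ^ 2 * D.l, t * D.m, D.n, t ^ 4 * D.a, t ^ 3 * D.b, t ^ 2 * D.c, t * D.d, D.e⟩ := by
  obtain ⟨ha, hb, hc, hd, he⟩ := doublingI_rd U V
  obtain ⟨ha', hb', hc', hd', he'⟩ := doublingI_rd (t • U) V
  have hl : pf (t • hess U) = t ^ 2 * pf (hess U) := by simp [pf]; ring
  have hm : pfPolar (t • hess U) (hess V) = t * pfPolar (hess U) (hess V) := by
    simp [pfPolar]; ring
  rw [rdCoeff_smul] at ha' hb' hc' hd' he'
  rw [GenBinaryQuartic.mk.injEq, doublingI_l, doublingI_m, doublingI_n, hess_smul, hl, hm]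
  simp only [doublingI_l, doublingI_m, doublingI_n, ha, hb, hc, hd, he, ha', hb', hc', hd', he']
  simp

end Pencil

section Domain

variable {R : Type*} [CommRing R] [IsDomain R] [CharZero R]

theorem TI_smul_left (t : R) (U V : Matrix (Fin 4) (Fin 4) R) (x : Fin 4 → R) :
    TI (t • U) V x = t ^ 2 * TI U V x := by
  apply mul_left_cancel₀ (two_ne_zero (α := R))
  rw [mul_left_comm, two_mul_TI, two_mul_TI, hess_smul]
  simp [Matrix.smul_mulVec, Matrix.mulVec_smul]
  ring

theorem TI_smul_right (t : R) (U V : Matrix (Fin 4) (Fin 4) R) (x : Fin 4 → R) :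
    TI U (t • V) x = t ^ 3 * TI U V x := by
  apply mul_left_cancel₀ (two_ne_zero (α := R))
  rw [mul_left_comm, two_mul_TI, two_mul_TI, hess_smul, Matrix.adjugate_smul]
  simp [Matrix.smul_mulVec]
  ring

theorem F4I_smul (t : R) (U V : Matrix (Fin 4) (Fin 4) R) (x : Fin 4 → R) :
    F4I (t • U) V x = t ^ 12 * F4I U V x := by
  simp only [F4I, doublingI_smul, TI_smul_left, TI_smul_right, GenBinaryQuartic.F₂]; ring

theorem G4I_smul (t : R) (U V : Matrix (Fin 4) (Fin 4) R) (x : Fin 4 → R) :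
    G4I (t • U) V x = t ^ 14 * G4I U V x := by
  simp only [G4I, doublingI_smul, TI_smul_left, TI_smul_right, GenBinaryQuartic.G₂]; ring

open Matrix in
/-- For symmetric matrices `A`, `B` and a common zero `x` of the two quadratic forms,
`xᵀ B adj(A + t B) B x` is linear in `t`. -/
theorem adjugate_pencil (A B : Matrix (Fin 4) (Fin 4) R) (hA : Aᵀ = A) (hB : Bᵀ = B)
    (x : Fin 4 → R) (hxA : x ⬝ᵥ A *ᵥ x = 0) (hxB : x ⬝ᵥ B *ᵥ x = 0) (t : R) :
    (B *ᵥ x) ⬝ᵥ (A + t • B).adjugate *ᵥ (B *ᵥ x) =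
      (B *ᵥ x) ⬝ᵥ A.adjugate *ᵥ (B *ᵥ x) + t * ((A *ᵥ x) ⬝ᵥ B.adjugate *ᵥ (A *ᵥ x)) := by
  let A' := A.map Polynomial.C
  let B' := B.map Polynomial.C
  let x' : Fin 4 → Polynomial R := fun i => Polynomial.C (x i)
  let M : Matrix (Fin 4) (Fin 4) (Polynomial R) := (Polynomial.X : Polynomial R) • B' + A'
  have hmv : ∀ (C : Matrix (Fin 4) (Fin 4) R) (y : Fin 4 → R),
      C.map Polynomial.C *ᵥ (fun i => Polynomial.C (y i)) = fun i => Polynomial.C ((C *ᵥ y) i) :=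
    fun C y => by
      ext1 i
      simp [mulVec, dotProduct]
  have hdp : ∀ y z : Fin 4 → R, (fun i => Polynomial.C (y i)) ⬝ᵥ (fun i => Polynomial.C (z i)) =
      Polynomial.C (y ⬝ᵥ z) := fun y z => by simp [dotProduct]
  have hxA' : x' ⬝ᵥ A' *ᵥ x' = 0 := by simp only [A', x', hmv, hdp, hxA, map_zero]
  have hxB' : x' ⬝ᵥ B' *ᵥ x' = 0 := by simp only [B', x', hmv, hdp, hxB, map_zero]
  have hMs : Mᵀ = M := by
    simp only [M, A', B', transpose_add, transpose_smul, ← transpose_map, hA, hB]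
  have hadjs : M.adjugateᵀ = M.adjugate := by rw [adjugate_transpose, hMs]
  have hMx : M *ᵥ x' = (Polynomial.X : Polynomial R) • (B' *ᵥ x') + A' *ᵥ x' := by
    simp only [M, add_mulVec, smul_mulVec]
  have hadj : M.adjugate *ᵥ (M *ᵥ x') = M.det • x' := by
    rw [mulVec_mulVec, adjugate_mul, smul_mulVec, one_mulVec]
  set b := B' *ᵥ x' with hb
  set a := A' *ᵥ x' with ha
  have hsymm : ∀ y z, y ⬝ᵥ M.adjugate *ᵥ z = z ⬝ᵥ M.adjugate *ᵥ y := fun y z => by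
    rw [dotProduct_comm, ← hadjs, ← vecMul_transpose, transpose_transpose, ← dotProduct_mulVec,
      hadjs]
  have hkey : ∀ y, Polynomial.X * (y ⬝ᵥ M.adjugate *ᵥ b) + y ⬝ᵥ M.adjugate *ᵥ a =
      M.det * (x' ⬝ᵥ y) := fun y => by
    have := congrArg (y ⬝ᵥ ·) hadj
    simp only [hMx, mulVec_add, mulVec_smul, dotProduct_add, dotProduct_smul, smul_eq_mul] at this
    rw [this, dotProduct_comm]
  have h1 := hkey b
  have h2 := hkey a
  rw [hxB', mul_zero] at h1
  rw [hxA', mul_zero, hsymm a b] at h2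
  have h3 : Polynomial.X ^ 2 * (b ⬝ᵥ M.adjugate *ᵥ b) = a ⬝ᵥ M.adjugate *ᵥ a := by
    linear_combination Polynomial.X * h1 - h2
  have hdeg : ∀ i j, (M.adjugate i j).natDegree ≤ 3 ∧ (M.adjugate i j).coeff 3 = B.adjugate i j := by
    intro i j
    have hsub : M.submatrix j.succAbove i.succAbove =
        (Polynomial.X : Polynomial R) • (B.submatrix j.succAbove i.succAbove).map Polynomial.C +
          (A.submatrix j.succAbove i.succAbove).map Polynomial.C := rfl
    have hC : ∀ m : ℕ, (-1 : Polynomial R) ^ m = Polynomial.C ((-1) ^ m) := fun m => by simp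
    rw [adjugate_fin_succ_eq_det_submatrix, adjugate_fin_succ_eq_det_submatrix, hsub, hC]
    refine ⟨(Polynomial.natDegree_C_mul_le _ _).trans (Polynomial.natDegree_det_X_add_C_le _ _), ?_⟩
    rw [Polynomial.coeff_C_mul]
    congr 1
    exact Polynomial.coeff_det_X_add_C_card _ _
  have hq : ∀ y : Fin 4 → R, ∀ i,
      ((fun i => (Polynomial.C (y i) : Polynomial R)) ⬝ᵥ M.adjugate *ᵥ (fun i => Polynomial.C (y i))).coeff i =
        y ⬝ᵥ (Matrix.of fun j k => (M.adjugate j k).coeff i) *ᵥ y := by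
    intro y i
    simp [mulVec, dotProduct, Polynomial.finsetSum_coeff]
  have hbC : b = fun i => Polynomial.C ((B *ᵥ x) i) := hmv B x
  have haC : a = fun i => Polynomial.C ((A *ᵥ x) i) := hmv A x
  have hcoef : ∀ i, (b ⬝ᵥ M.adjugate *ᵥ b).coeff i = (a ⬝ᵥ M.adjugate *ᵥ a).coeff (i + 2) := by
    intro i
    rw [← h3, Polynomial.coeff_X_pow_mul]
  have hc1 : (b ⬝ᵥ M.adjugate *ᵥ b).coeff 1 = (A *ᵥ x) ⬝ᵥ B.adjugate *ᵥ (A *ᵥ x) := by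
    rw [hcoef, haC, hq]
    congr 2
    ext j k
    exact (hdeg j k).2
  have hc2 : ∀ i, 2 ≤ i → (b ⬝ᵥ M.adjugate *ᵥ b).coeff i = 0 := by
    intro i hi
    rw [hcoef, haC, hq]
    have : (Matrix.of fun j k => (M.adjugate j k).coeff (i + 2)) = 0 := by
      ext j k
      exact Polynomial.coeff_eq_zero_of_natDegree_lt (lt_of_le_of_lt (hdeg j k).1 (by omega))
    rw [this]; simp
  have hev : ∀ s : R, (b ⬝ᵥ M.adjugate *ᵥ b).eval s =
      (B *ᵥ x) ⬝ᵥ (A + s • B).adjugate *ᵥ (B *ᵥ x) := by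
    intro s
    have hM : M.adjugate.map (Polynomial.evalRingHom s) = (A + s • B).adjugate := by
      have := RingHom.map_adjugate (Polynomial.evalRingHom s) M
      rw [RingHom.mapMatrix_apply, RingHom.mapMatrix_apply] at this
      rw [this]
      congr 1
      ext j k
      simp [M, A', B']
      ring
    rw [← hM, hbC]
    generalize M.adjugate = J
    generalize B *ᵥ x = y
    simp only [mulVec, dotProduct, Polynomial.eval_finsetSum, Polynomial.eval_mul, Polynomial.eval_C,
      Matrix.map_apply, Polynomial.coe_evalRingHom]
  have hlin : b ⬝ᵥ M.adjugate *ᵥ b = Polynomial.C ((b ⬝ᵥ M.adjugate *ᵥ b).coeff 0) +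
      Polynomial.C ((b ⬝ᵥ M.adjugate *ᵥ b).coeff 1) * Polynomial.X := by
    ext i
    rcases i with _ | _ | i
    · simp
    · simp [Polynomial.coeff_C]
    · rw [hc2 _ (by omega)]
      simp [Polynomial.coeff_X, Polynomial.coeff_C]
  have h0 := hev 0
  have ht := hev t
  rw [hlin] at h0 ht
  simp only [Polynomial.eval_add, Polynomial.eval_C, Polynomial.eval_mul, Polynomial.eval_X,
    mul_zero, add_zero, zero_smul] at h0 ht
  rw [← ht, h0, hc1, mul_comm]

end Domain

end QuadricPair

theorem GenBinaryQuartic.G₂_shear {R : Type*} [CommRing R] (D D' : GenBinaryQuartic R) (t x z : R)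
    (hl : D'.l = D.l + t * D.m + t ^ 2 * D.n) (hm : D'.m = D.m + 2 * t * D.n) (hn : D'.n = D.n)
    (ha : D'.a = D.a + t * D.b + t ^ 2 * D.c + t ^ 3 * D.d + t ^ 4 * D.e)
    (hb : D'.b = D.b + 2 * t * D.c + 3 * t ^ 2 * D.d + 4 * t ^ 3 * D.e)
    (hc : D'.c = D.c + 3 * t * D.d + 6 * t ^ 2 * D.e) (hd : D'.d = D.d + 4 * t * D.e)
    (he : D'.e = D.e) :
    D'.F₂ x z = D.F₂ x (z + t * x) ∧
    D'.G₂ x z = D.G₂ x (z + t * x) - (t * D.d + 2 * t ^ 2 * D.e) * D.F₂ x (z + t * x) := by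
  obtain ⟨l, m, n, a, b, c, d, e⟩ := D
  obtain ⟨l', m', n', a', b', c', d', e'⟩ := D'
  simp only at hl hm hn ha hb hc hd he
  subst hl hm hn ha hb hc hd he
  constructor
  · simp only [F₂]; ring
  · simp only [G₂, F₂]; ring

namespace QuadricPair

section Shear

variable {R : Type*} [CommRing R]

theorem prodCoeff_shear (t : R) (a b c d : R × R) :
    let f (i : Fin 5) := prodCoeff i a b c d
    let g (i : Fin 5) := prodCoeff i (a.1 + t * a.2, a.2) (b.1 + t * b.2, b.2) (c.1 + t * c.2, c.2)
      (d.1 + t * d.2, d.2)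
    g 4 = f 4 + t * f 3 + t ^ 2 * f 2 + t ^ 3 * f 1 + t ^ 4 * f 0 ∧
    g 3 = f 3 + 2 * t * f 2 + 3 * t ^ 2 * f 1 + 4 * t ^ 3 * f 0 ∧
    g 2 = f 2 + 3 * t * f 1 + 6 * t ^ 2 * f 0 ∧
    g 1 = f 1 + 4 * t * f 0 ∧ g 0 = f 0 := by
  obtain ⟨a₁, a₂⟩ := a
  obtain ⟨b₁, b₂⟩ := b
  obtain ⟨c₁, c₂⟩ := c
  obtain ⟨d₁, d₂⟩ := d
  refine ⟨?_, ?_, ?_, ?_, ?_⟩ <;> simp only [prodCoeff] <;> ring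

theorem hess_add (A B : Matrix (Fin 4) (Fin 4) R) : hess (A + B) = hess A + hess B := by
  ext i j; simp [hess_apply]; ring

theorem doublingI_shear (t : R) (U V : Matrix (Fin 4) (Fin 4) R) (x z : R) :
    (doublingI (U + t • V) V).F₂ x z = (doublingI U V).F₂ x (z + t * x) ∧
    ∃ r, (doublingI (U + t • V) V).G₂ x z = (doublingI U V).G₂ x (z + t * x) +
      r * (doublingI U V).F₂ x (z + t * x) := by
  obtain ⟨ha, hb, hc, hd, he⟩ := doublingI_rd U V
  obtain ⟨ha', hb', hc', hd', he'⟩ := doublingI_rd (U + t • V) V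
  have hh : ∀ i j, hess (U + t • V) i j = hess U i j + t * hess V i j := fun i j => by
    simp [hess_apply]; ring
  have h4 := fun a b c d : R × R => (prodCoeff_shear t a b c d).1
  have h3 := fun a b c d : R × R => (prodCoeff_shear t a b c d).2.1
  have h2 := fun a b c d : R × R => (prodCoeff_shear t a b c d).2.2.1
  have h1 := fun a b c d : R × R => (prodCoeff_shear t a b c d).2.2.2.1
  have h0 := fun a b c d : R × R => (prodCoeff_shear t a b c d).2.2.2.2
  simp only [Prod.forall] at h4 h3 h2 h1 h0
  have key := GenBinaryQuartic.G₂_shear (doublingI U V) (doublingI (U + t • V) V) t x z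
    (by rw [doublingI_l, doublingI_l, doublingI_m, doublingI_n]; simp only [pf, pfPolar, hh]; ring)
    (by rw [doublingI_m, doublingI_m, doublingI_n]; simp only [pf, pfPolar, hh]; ring)
    (by rw [doublingI_n, doublingI_n])
    (by
      rw [ha, hb, hc, hd, he, ha']
      simp only [rdCoeff, hh, Matrix.add_apply, Matrix.smul_apply, smul_eq_mul, h4]
      ring)
    (by
      rw [hb, hc, hd, he, hb']
      simp only [rdCoeff, hh, Matrix.add_apply, Matrix.smul_apply, smul_eq_mul, h3]
      ring)
    (by
      rw [hc, hd, he, hc']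
      simp only [rdCoeff, hh, Matrix.add_apply, Matrix.smul_apply, smul_eq_mul, h2]
      ring)
    (by
      rw [hd, he, hd']
      simp only [rdCoeff, hh, Matrix.add_apply, Matrix.smul_apply, smul_eq_mul, h1]
      ring)
    (by
      rw [he, he']
      simp only [rdCoeff, hh, Matrix.add_apply, Matrix.smul_apply, smul_eq_mul, h0])
  exact ⟨key.1, -(t * (doublingI U V).d + 2 * t ^ 2 * (doublingI U V).e), by rw [key.2]; ring⟩

variable [IsDomain R] [CharZero R]

open Matrix in
theorem TI_shear (t : R) (U V : Matrix (Fin 4) (Fin 4) R) (x : Fin 4 → R)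
    (hU : x ⬝ᵥ hess U *ᵥ x = 0) (hV : x ⬝ᵥ hess V *ᵥ x = 0) :
    TI (U + t • V) V x = TI U V x ∧ TI V (U + t • V) x = TI V U x + t * TI U V x := by
  have h2 : (2 : R) ≠ 0 := two_ne_zero
  have hUV : x ⬝ᵥ (hess U + t • hess V) *ᵥ x = 0 := by
    rw [add_mulVec, smul_mulVec, dotProduct_add, dotProduct_smul, hU, hV]; simp
  constructor
  · apply mul_left_cancel₀ h2
    rw [two_mul_TI, two_mul_TI, hess_add, hess_smul, hU, hUV, zero_mul, zero_mul, zero_sub,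
      zero_sub]
    congr 1
    have hsym : ((hess V).adjugate)ᵀ = (hess V).adjugate := by
      rw [adjugate_transpose, hess_transpose]
    have hadj : (hess V).adjugate *ᵥ (hess V *ᵥ x) = (hess V).det • x := by
      rw [mulVec_mulVec, adjugate_mul, smul_mulVec, one_mulVec]
    have hcomm : (hess V *ᵥ x) ⬝ᵥ (hess V).adjugate *ᵥ (hess U *ᵥ x) =
        (hess V).det * (x ⬝ᵥ hess U *ᵥ x) := by
      rw [dotProduct_mulVec, ← mulVec_transpose, hsym, hadj, smul_dotProduct, smul_eq_mul]
    rw [add_mulVec, smul_mulVec, mulVec_add, mulVec_smul, hadj, dotProduct_add, add_dotProduct,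
      smul_dotProduct, hcomm, hU]
    simp only [dotProduct_smul, add_dotProduct, smul_dotProduct]
    rw [dotProduct_comm _ x, dotProduct_comm _ x, hU, hV]
    simp
  · apply mul_left_cancel₀ h2
    rw [mul_add, mul_left_comm 2 t, two_mul_TI, two_mul_TI, two_mul_TI, hess_add, hess_smul, hU, hV,
      adjugate_pencil _ _ (hess_transpose U) (hess_transpose V) x hU hV]
    ring

end Shear

/-- The ideal generated by the values of `F₄` and `G₄`. -/
def covIdeal {R : Type*} [CommRing R] (U V : Matrix (Fin 4) (Fin 4) R) (x : Fin 4 → R) : Ideal R :=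
  Ideal.span {F4I U V x, G4I U V x}

theorem span_pair_unit {R : Type*} [CommRing R] {f g u v r : R} (hu : IsUnit u) (hv : IsUnit v) :
    Ideal.span {u * f, v * g + r * f} = Ideal.span {f, g} := by
  obtain ⟨u, rfl⟩ := hu
  obtain ⟨v, rfl⟩ := hv
  apply le_antisymm
  · rw [Ideal.span_le]
    rintro _ (rfl | rfl)
    · exact Ideal.mem_span_pair.2 ⟨u, 0, by ring⟩
    · exact Ideal.mem_span_pair.2 ⟨r, v, by ring⟩
  · rw [Ideal.span_le]
    rintro y (hy | hy) <;> rw [hy]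
    · exact Ideal.mem_span_pair.2 ⟨(u⁻¹ : Rˣ), 0, by simp⟩
    · refine Ideal.mem_span_pair.2 ⟨-(r * (u⁻¹ : Rˣ) * (v⁻¹ : Rˣ)), (v⁻¹ : Rˣ), ?_⟩
      linear_combination g * v.inv_mul - r * (v⁻¹ : Rˣ) * f * u.inv_mul

section CovIdeal

variable {R : Type*} [CommRing R] [IsDomain R] [CharZero R]

open Matrix in
theorem covIdeal_mul (N U V : Matrix (Fin 4) (Fin 4) R) (hN : IsUnit N.det) (x : Fin 4 → R) :
    covIdeal (Nᵀ * U * N) (Nᵀ * V * N) x = covIdeal U V (N *ᵥ x) := by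
  obtain ⟨hF, r, hG⟩ := F4I_G4I_mul N U V x
  rw [covIdeal, hF, hG, span_pair_unit (hN.pow _) (hN.pow _), covIdeal]

theorem covIdeal_swap (U V : Matrix (Fin 4) (Fin 4) R) (x : Fin 4 → R) :
    covIdeal V U x = covIdeal U V x := by
  rw [covIdeal, F4I_swap, G4I_swap, covIdeal]

theorem covIdeal_smul (t : R) (ht : IsUnit t) (U V : Matrix (Fin 4) (Fin 4) R) (x : Fin 4 → R) :
    covIdeal (t • U) V x = covIdeal U V x := by
  have := span_pair_unit (f := F4I U V x) (g := G4I U V x) (r := 0) (ht.pow 12) (ht.pow 14)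
  rw [zero_mul, add_zero] at this
  rw [covIdeal, F4I_smul, G4I_smul, this, covIdeal]

open Matrix in
theorem covIdeal_shear (t : R) (U V : Matrix (Fin 4) (Fin 4) R) (x : Fin 4 → R)
    (hU : x ⬝ᵥ hess U *ᵥ x = 0) (hV : x ⬝ᵥ hess V *ᵥ x = 0) :
    covIdeal (U + t • V) V x = covIdeal U V x := by
  obtain ⟨h1, h2⟩ := TI_shear t U V x hU hV
  obtain ⟨hF, r, hG⟩ := doublingI_shear t U V (TI (U + t • V) V x) (-TI V (U + t • V) x)
  have e : -TI V (U + t • V) x + t * TI (U + t • V) V x = -TI V U x := by rw [h1, h2]; ring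
  have e1 : F4I (U + t • V) V x = 1 * F4I U V x := by
    rw [F4I, hF, e, h1, F4I, one_mul]
  have e2 : G4I (U + t • V) V x = 1 * G4I U V x + r * F4I U V x := by
    rw [G4I, hG, e, h1, F4I, G4I, one_mul]
  rw [covIdeal, e1, e2, span_pair_unit isUnit_one isUnit_one, covIdeal]

open Matrix in
theorem covIdeal_gl [IsLocalRing R] (M : Matrix (Fin 2) (Fin 2) R) (hM : IsUnit M.det)
    (U V : Matrix (Fin 4) (Fin 4) R) (x : Fin 4 → R)
    (hU : x ⬝ᵥ hess U *ᵥ x = 0) (hV : x ⬝ᵥ hess V *ᵥ x = 0) :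
    covIdeal (M 0 0 • U + M 0 1 • V) (M 1 0 • U + M 1 1 • V) x = covIdeal U V x := by
  have main : ∀ a b c d : R, IsUnit a → IsUnit (a * d - b * c) →
      ∀ U V : Matrix (Fin 4) (Fin 4) R, x ⬝ᵥ hess U *ᵥ x = 0 → x ⬝ᵥ hess V *ᵥ x = 0 →
      covIdeal (a • U + b • V) (c • U + d • V) x = covIdeal U V x := by
    intro a b c d ha hdet U V hU hV
    obtain ⟨a, rfl⟩ := ha
    have hq : ∀ (s t : R), x ⬝ᵥ hess (s • U + t • V) *ᵥ x = 0 := fun s t => by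
      rw [hess_add, hess_smul, hess_smul, add_mulVec, smul_mulVec, smul_mulVec, dotProduct_add,
        dotProduct_smul, dotProduct_smul, hU, hV]; simp
    set e := d - b * c * (a⁻¹ : Rˣ) with he
    have hunit : IsUnit e := by
      have : e = (a⁻¹ : Rˣ) * (a * d - b * c) := by
        rw [he]; linear_combination (-d) * a.inv_mul
      rw [this]; exact (Units.isUnit _).mul hdet
    have h1 : c • U + d • V = (0 • U + e • V) + (c * (a⁻¹ : Rˣ)) • ((a : R) • U + b • V) := by
      ext i j
      simp only [he, Matrix.add_apply, Matrix.smul_apply, smul_eq_mul]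
      linear_combination (-c * U i j) * a.inv_mul
    have h2 : (a : R) • U + b • V = (a : R) • (U + (b * (a⁻¹ : Rˣ)) • V) := by
      ext i j
      simp only [Matrix.add_apply, Matrix.smul_apply, smul_eq_mul]
      linear_combination (-b * V i j) * a.mul_inv
    rw [← covIdeal_swap, h1, covIdeal_shear _ _ _ _ (by simpa using hq 0 e) (hq _ _), zero_smul,
      zero_add, covIdeal_smul e hunit, ← covIdeal_swap, h2, covIdeal_smul _ a.isUnit,
      covIdeal_shear _ _ _ _ hU hV]
  rw [det_fin_two] at hM
  by_cases ha : IsUnit (M 0 0)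
  · exact main _ _ _ _ ha hM U V hU hV
  · have hb : IsUnit (M 0 1) := by
      have h1 : IsUnit (M 0 1 * M 1 0) := by
        have h := (IsLocalRing.nonunits_add (a := M 0 0 * M 1 1)
          (b := -(M 0 1 * M 1 0)) (fun h => ha (isUnit_of_mul_isUnit_left h))).mt
          (by rw [← sub_eq_add_neg]; exact not_not.2 hM)
        exact (IsUnit.neg_iff _).1 (not_not.1 h)
      exact isUnit_of_mul_isUnit_left h1
    rw [add_comm (M 0 0 • U), add_comm (M 1 0 • U), main _ _ _ _ hb ?_ V U hV hU, covIdeal_swap]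
    rw [← IsUnit.neg_iff]; convert hM using 1; ring

end CovIdeal

end QuadricPair

/-! ### Quadratic forms given by matrices -/

section Forms

variable {R S : Type*} [CommRing R] [CommRing S]

/-- The quadratic form `xᵀ U x`. -/
def form (U : Matrix (Fin 4) (Fin 4) R) : MvPolynomial (Fin 4) R :=
  ∑ i, ∑ j, C (U i j) * X i * X j

/-- The linear form `c₂ x₂ + c₃ x₃ + c₄ x₄`. -/
def linForm (c : Fin 3 → R) : MvPolynomial (Fin 4) R := ∑ j : Fin 3, C (c j) * X j.succ

/-- The linear substitution `x ← N x`. -/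
def subst (N : Matrix (Fin 4) (Fin 4) R) : MvPolynomial (Fin 4) R →ₐ[R] MvPolynomial (Fin 4) R :=
  bind₁ fun i => ∑ j, C (N i j) * X j

/-- The restriction to the plane `x₁ = a₂ x₂ + a₃ x₃ + a₄ x₄`. -/
def restr (a : Fin 3 → R) : MvPolynomial (Fin 4) R →ₐ[R] MvPolynomial (Fin 4) R :=
  bind₁ fun i => if i = 0 then linForm a else X i

/-- The coefficients of a quadratic form, as an upper triangular matrix. -/
def coeffMatrix (q : MvPolynomial (Fin 4) R) : Matrix (Fin 4) (Fin 4) R :=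
  fun i j => if i ≤ j then coeff (Finsupp.single i 1 + Finsupp.single j 1) q else 0

theorem form_isHomogeneous (U : Matrix (Fin 4) (Fin 4) R) : (form U).IsHomogeneous 2 := by
  refine IsHomogeneous.sum _ _ _ fun i _ => IsHomogeneous.sum _ _ _ fun j _ => ?_
  simpa using ((isHomogeneous_C (Fin 4) (U i j)).mul (isHomogeneous_X R i)).mul
    (isHomogeneous_X R j)

theorem linForm_isHomogeneous (c : Fin 3 → R) : (linForm c).IsHomogeneous 1 := by
  refine IsHomogeneous.sum _ _ _ fun i _ => ?_
  simpa using (isHomogeneous_C (Fin 4) (c i)).mul (isHomogeneous_X R i.succ)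

theorem form_coeffMatrix {q : MvPolynomial (Fin 4) R} (hq : q.IsHomogeneous 2) :
    form (coeffMatrix q) = q := by
  classical
  ext d
  by_cases hd : d.degree = 2
  · have hd' : ∃ i j, i ≤ j ∧ d = Finsupp.single i 1 + Finsupp.single j 1 := by
      obtain ⟨s, hs⟩ : ∃ s : Multiset (Fin 4), Multiset.toFinsupp s = d :=
        ⟨Finsupp.toMultiset d, by simp⟩
      have hc : Multiset.card s = 2 := by
        rw [← hd, ← hs, ← Multiset.toFinsupp_sum_eq]; rfl
      obtain ⟨i, j, rfl⟩ := Multiset.card_eq_two.1 hc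
      have h2 : d = Finsupp.single i 1 + Finsupp.single j 1 := by
        rw [← hs, Multiset.insert_eq_cons, ← Multiset.singleton_add, map_add]; simp
      rcases le_total i j with h | h
      · exact ⟨i, j, h, h2⟩
      · exact ⟨j, i, h, by rw [h2, add_comm]⟩
    obtain ⟨i, j, hij, rfl⟩ := hd'
    have hcoef : ∀ a b : Fin 4, coeff (Finsupp.single i 1 + Finsupp.single j 1)
        (C (coeffMatrix q a b) * X a * X b : MvPolynomial (Fin 4) R) =
        if (Finsupp.single a 1 + Finsupp.single b 1 : Fin 4 →₀ ℕ) =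
          Finsupp.single i 1 + Finsupp.single j 1 then coeffMatrix q a b else 0 := by
      intro a b
      rw [mul_assoc, coeff_C_mul, X, X, monomial_mul, coeff_monomial]
      split_ifs <;> simp
    simp only [form, coeff_sum, hcoef]
    rw [Finset.sum_eq_single i, Finset.sum_eq_single j]
    · simp [coeffMatrix, hij]
    · intro b _ hb
      rw [if_neg]
      intro h
      exact hb (Finsupp.single_left_injective one_ne_zero (add_left_cancel h))
    · simp
    · intro a _ ha
      refine Finset.sum_eq_zero fun b _ => ?_
      split_ifs with h
      · have hbi : b = i ∧ a = j := by
          have h1 := DFunLike.congr_fun h a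
          have h2 := DFunLike.congr_fun h b
          have h3 := DFunLike.congr_fun h i
          simp only [Finsupp.add_apply, Finsupp.single_apply] at h1 h2 h3
          constructor
          · by_contra hb
            simp [hb, ha] at h3
            omega
          · by_contra hb
            simp [Ne.symm ha, Ne.symm hb] at h1
        obtain ⟨rfl, rfl⟩ := hbi
        rw [coeffMatrix, if_neg]
        exact fun h' => ha (le_antisymm h' hij)
      · rfl
    · simp
  · rw [(form_isHomogeneous _).coeff_eq_zero (by simpa using hd),
      hq.coeff_eq_zero (by simpa using hd)]

theorem map_form (φ : R →+* S) (U : Matrix (Fin 4) (Fin 4) R) :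
    MvPolynomial.map φ (form U) = form (U.map φ) := by
  simp [form]

theorem map_linForm (φ : R →+* S) (c : Fin 3 → R) :
    MvPolynomial.map φ (linForm c) = linForm (fun i => φ (c i)) := by
  simp [linForm]

theorem linForm_add (a b : Fin 3 → R) : linForm (a + b) = linForm a + linForm b := by
  simp [linForm, add_mul, Finset.sum_add_distrib]

theorem linForm_smul (t : R) (a : Fin 3 → R) : linForm (t • a) = C t * linForm a := by
  simp [linForm, Finset.mul_sum, mul_assoc]

theorem form_smul_add (s t : R) (U V : Matrix (Fin 4) (Fin 4) R) :
    form (s • U + t • V) = C s * form U + C t * form V := by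
  simp only [form, Finset.mul_sum, ← Finset.sum_add_distrib]
  refine Finset.sum_congr rfl fun i _ => Finset.sum_congr rfl fun j _ => ?_
  simp; ring

theorem form_smul (s : R) (U : Matrix (Fin 4) (Fin 4) R) : form (s • U) = C s * form U := by
  simpa using form_smul_add s 0 U U

open Matrix in
theorem eval_form (U : Matrix (Fin 4) (Fin 4) R) (z : Fin 4 → R) :
    eval z (form U) = z ⬝ᵥ U *ᵥ z := by
  simp only [form, map_sum, map_mul, eval_C, eval_X, dotProduct, mulVec, Finset.mul_sum]
  exact Finset.sum_congr rfl fun i _ => Finset.sum_congr rfl fun j _ => by ring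

open Matrix in
theorem dotProduct_hess (U : Matrix (Fin 4) (Fin 4) R) (z : Fin 4 → R) :
    z ⬝ᵥ QuadricPair.hess U *ᵥ z = 2 * eval z (form U) := by
  rw [eval_form, QuadricPair.hess, add_mulVec, dotProduct_add, mulVec_transpose,
    dotProduct_comm z (z ᵥ* U), ← dotProduct_mulVec]
  ring

theorem pderiv_form (U : Matrix (Fin 4) (Fin 4) R) (k : Fin 4) :
    pderiv k (form U) = ∑ j, C (QuadricPair.hess U k j) * X j := by
  simp only [form, map_sum, Derivation.leibniz, pderiv_C, pderiv_X, smul_eq_mul, mul_zero, add_zero,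
    QuadricPair.hess_apply, C_add, add_mul, Finset.sum_add_distrib, Pi.single_apply, mul_ite, mul_one]
  simp [mul_comm]
  rw [add_comm]

open Matrix in
theorem eval_pderiv_form (U : Matrix (Fin 4) (Fin 4) R) (k : Fin 4) (z : Fin 4 → R) :
    eval z (pderiv k (form U)) = (QuadricPair.hess U *ᵥ z) k := by
  rw [pderiv_form]; simp [mulVec, dotProduct]

theorem hessian_form {K : Type*} [Field K] (U : Matrix (Fin 4) (Fin 4) K) :
    QuadricPair.hessian (form U) = QuadricPair.hess U := by
  ext i j
  rw [QuadricPair.hessian, pderiv_form]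
  simp [Pi.single_apply, QuadricPair.hess_apply, add_comm]

open Matrix in
theorem form_eq_dotProduct (U : Matrix (Fin 4) (Fin 4) R) :
    form U = X ⬝ᵥ U.map C *ᵥ X := by
  simp only [form, dotProduct, mulVec, Finset.mul_sum, Matrix.map_apply]
  exact Finset.sum_congr rfl fun i _ => Finset.sum_congr rfl fun j _ => by ring

open Matrix in
theorem subst_form (N U : Matrix (Fin 4) (Fin 4) R) :
    subst N (form U) = form (Nᵀ * U * N) := by
  have hX : ∀ A : Matrix (Fin 4) (Fin 4) (MvPolynomial (Fin 4) R),
      (A.map (subst N) *ᵥ fun i => subst N (X i)) = fun i => subst N ((A *ᵥ X) i) := fun A => by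
    ext1 i
    simp [mulVec, dotProduct]
  have hN : (fun i => subst N (X i)) = N.map C *ᵥ (X : Fin 4 → MvPolynomial (Fin 4) R) := by
    ext1 i
    simp [subst, mulVec, dotProduct]
  have hU : (U.map C).map (subst N) = U.map C := by
    ext1 i j
    simp [subst]
  have h := hX (U.map C)
  rw [form_eq_dotProduct, form_eq_dotProduct, dotProduct, map_sum]
  simp only [map_mul]
  change (fun i => subst N (X i)) ⬝ᵥ (fun i => subst N ((U.map C *ᵥ X) i)) = _
  rw [← h, hU, hN, Matrix.map_mul, Matrix.map_mul, Matrix.transpose_map, ← mulVec_mulVec,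
    ← mulVec_mulVec, dotProduct_mulVec _ (N.map C)ᵀ, vecMul_transpose]

open Matrix in
theorem eval_subst (N : Matrix (Fin 4) (Fin 4) R) (q : MvPolynomial (Fin 4) R) (z : Fin 4 → R) :
    eval z (subst N q) = eval (N *ᵥ z) q := by
  have : (aeval fun i => aeval z (∑ j, C (N i j) * X j)) = aeval (R := R) (N *ᵥ z) := by
    congr 1
    ext1 i
    simp [mulVec, dotProduct]
  rw [← coe_aeval_eq_eval, ← coe_aeval_eq_eval, RingHom.coe_coe, RingHom.coe_coe, subst,
    aeval_bind₁, this]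

theorem subst_subst (N M : Matrix (Fin 4) (Fin 4) R) (q : MvPolynomial (Fin 4) R) :
    subst M (subst N q) = subst (N * M) q := by
  rw [subst, subst, subst, bind₁_bind₁]
  congr 2
  ext1 i
  simp only [map_sum, map_mul, bind₁_X_right, bind₁_C_right, Matrix.mul_apply, Finset.mul_sum,
    Finset.sum_mul]
  rw [Finset.sum_comm]
  simp [mul_assoc]

theorem subst_one (q : MvPolynomial (Fin 4) R) : subst 1 q = q := by
  have : (fun i => ∑ j, C ((1 : Matrix (Fin 4) (Fin 4) R) i j) * X j) =
      (X : Fin 4 → MvPolynomial (Fin 4) R) := by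
    ext1 i
    simp [Matrix.one_apply]
  rw [subst, this, bind₁_X_left]; rfl

theorem map_subst (φ : R →+* S) (N : Matrix (Fin 4) (Fin 4) R) (q : MvPolynomial (Fin 4) R) :
    MvPolynomial.map φ (subst N q) = subst (N.map φ) (MvPolynomial.map φ q) := by
  rw [subst, map_bind₁, subst]; simp

theorem map_restr (φ : R →+* S) (a : Fin 3 → R) (q : MvPolynomial (Fin 4) R) :
    MvPolynomial.map φ (restr a q) = restr (fun i => φ (a i)) (MvPolynomial.map φ q) := by
  rw [restr, map_bind₁, restr]
  congr 2
  ext1 i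
  split_ifs <;> simp [map_linForm]

theorem constPart_eq_restr (q : MvPolynomial (Fin 4) R) : constPart q = restr 0 q := by
  rw [constPart, restr]; simp [linForm]

theorem restr_X_succ (a : Fin 3 → R) (j : Fin 3) : restr a (X j.succ) = X j.succ := by
  simp [restr, Fin.succ_ne_zero]

theorem restr_X_zero (a : Fin 3 → R) : restr a (X 0) = linForm a := by
  simp [restr]

theorem restr_linForm (a c : Fin 3 → R) : restr a (linForm c) = linForm c := by
  rw [linForm, map_sum]
  simp [restr]

theorem restr_restr (a b : Fin 3 → R) (q : MvPolynomial (Fin 4) R) :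
    restr a (restr b q) = restr b q := by
  conv_lhs => rw [restr, restr, bind₁_bind₁]
  rw [restr]
  congr 2
  ext1 i
  split_ifs with h
  · have := restr_linForm a b
    rwa [restr] at this
  · simp [h]

theorem restr_shearFirst (a b : Fin 3 → R) (q : MvPolynomial (Fin 4) R) :
    restr a (shearFirst b q) = restr (a - b) q := by
  rw [restr, shearFirst, bind₁_bind₁, restr]
  congr 2
  ext1 i
  split_ifs with h
  · have : linForm (a - b) = linForm a - linForm b := by
      simp [linForm, sub_mul, Finset.sum_sub_distrib]
    rw [this, map_sub]
    congr 1
    · simp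
    · exact restr_linForm a b
  · simp [h]

theorem restr_scaleFirst (a : Fin 3 → R) (π : R) (q : MvPolynomial (Fin 4) R) :
    restr a (scaleFirst π q) = restr (π • a) q := by
  rw [restr, scaleFirst, bind₁_bind₁, restr]
  congr 2
  ext1 i
  split_ifs with h
  · simp [linForm_smul]
  · simp [h]

end Forms

section Decomposition

variable {R S : Type*} [CommRing R] [CommRing S]

theorem constPart_mul (p q : MvPolynomial (Fin 4) R) :
    constPart (p * q) = constPart p * constPart q := by simp [constPart]

theorem constPart_add (p q : MvPolynomial (Fin 4) R) :
    constPart (p + q) = constPart p + constPart q := by simp [constPart]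

theorem constPart_C (c : R) : constPart (C c : MvPolynomial (Fin 4) R) = C c := by
  simp [constPart]

theorem constPart_X_zero : constPart (X 0 : MvPolynomial (Fin 4) R) = 0 := by simp [constPart]

theorem constPart_linForm (c : Fin 3 → R) : constPart (linForm c) = linForm c := by
  rw [constPart_eq_restr, restr_linForm]

theorem restr_constPart (a : Fin 3 → R) (q : MvPolynomial (Fin 4) R) :
    restr a (constPart q) = constPart q := by
  rw [constPart_eq_restr, restr_restr]

theorem constPart_constPart (q : MvPolynomial (Fin 4) R) :
    constPart (constPart q) = constPart q := by
  rw [constPart_eq_restr (constPart q), restr_constPart]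

theorem map_constPart (φ : R →+* S) (q : MvPolynomial (Fin 4) R) :
    MvPolynomial.map φ (constPart q) = constPart (MvPolynomial.map φ q) := by
  rw [constPart_eq_restr, constPart_eq_restr, map_restr]
  congr 2
  ext1 i; simp

theorem isHomogeneous_bind₁ {n : ℕ} {q : MvPolynomial (Fin 4) R} (hq : q.IsHomogeneous n)
    (f : Fin 4 → MvPolynomial (Fin 4) R) (hf : ∀ i, (f i).IsHomogeneous 1) :
    (bind₁ f q).IsHomogeneous n := by
  have := hq.aeval f hf
  rwa [one_mul] at this

theorem restr_isHomogeneous {n : ℕ} {q : MvPolynomial (Fin 4) R} (hq : q.IsHomogeneous n)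
    (a : Fin 3 → R) : (restr a q).IsHomogeneous n := by
  refine isHomogeneous_bind₁ hq _ fun i => ?_
  split_ifs
  · exact linForm_isHomogeneous a
  · exact isHomogeneous_X R i

theorem constPart_isHomogeneous {n : ℕ} {q : MvPolynomial (Fin 4) R} (hq : q.IsHomogeneous n) :
    (constPart q).IsHomogeneous n := by
  rw [constPart_eq_restr]; exact restr_isHomogeneous hq 0

theorem subst_isHomogeneous {n : ℕ} {q : MvPolynomial (Fin 4) R} (hq : q.IsHomogeneous n)
    (N : Matrix (Fin 4) (Fin 4) R) : (subst N q).IsHomogeneous n := by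
  refine isHomogeneous_bind₁ hq _ fun i => IsHomogeneous.sum _ _ _ fun j _ => ?_
  simpa using (isHomogeneous_C (Fin 4) (N i j)).mul (isHomogeneous_X R j)

/-- The coefficients of the term `ℓ` of `λ x₁² + ℓ x₁ + q`. -/
def linCoeff (U : Matrix (Fin 4) (Fin 4) R) (j : Fin 3) : R := QuadricPair.hess U 0 j.succ

theorem linPart_form (U : Matrix (Fin 4) (Fin 4) R) :
    linPart (form U) = linForm (linCoeff U) := by
  rw [linPart, pderiv_form, Fin.sum_univ_succ, constPart_add, constPart_mul, constPart_X_zero,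
    mul_zero, zero_add]
  exact constPart_linForm _

theorem form_decomp (U : Matrix (Fin 4) (Fin 4) R) :
    form U = C (U 0 0) * X 0 ^ 2 + X 0 * linForm (linCoeff U) + constPart (form U) := by
  have : constPart (form U) = ∑ i : Fin 3, ∑ j : Fin 3, C (U i.succ j.succ) * X i.succ * X j.succ := by
    simp [constPart, form, Fin.sum_univ_succ]
  rw [this]
  simp only [form, Fin.sum_univ_succ, linForm, linCoeff, QuadricPair.hess_apply]
  simp
  ring

theorem linForm_injective : Function.Injective (linForm : (Fin 3 → R) → _) := by
  intro a b h
  ext j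
  have := congrArg (eval (Pi.single j.succ 1)) h
  simpa [linForm, Pi.single_apply, Fin.succ_inj] using this

theorem linForm_zero : linForm (0 : Fin 3 → R) = 0 := by simp [linForm]

theorem eval_linForm (c : Fin 3 → R) (z : Fin 4 → R) :
    eval z (linForm c) = ∑ j : Fin 3, c j * z j.succ := by simp [linForm]

theorem form_inj {U V : Matrix (Fin 4) (Fin 4) R} (h : form U = form V) :
    QuadricPair.hess U = QuadricPair.hess V ∧ ∀ i, U i i = V i i := by
  constructor
  · ext i j
    have := congrArg (fun q => eval (Pi.single j 1) (pderiv i q)) h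
    simpa [eval_pderiv_form, Matrix.mulVec, dotProduct, Pi.single_apply] using this
  · intro i
    have := congrArg (eval (Pi.single i 1)) h
    simpa [eval_form, Matrix.mulVec, dotProduct, Pi.single_apply] using this

/-- The matrix of the substitution `x₁ ← π x₁`. -/
def scaleMatrix (π : R) : Matrix (Fin 4) (Fin 4) R := Matrix.diagonal (Fin.cons π 1)

/-- The matrix of the substitution `x₁ ← x₁ - (a₂ x₂ + a₃ x₃ + a₄ x₄)`. -/
def shearMatrix (a : Fin 3 → R) : Matrix (Fin 4) (Fin 4) R :=
  !![1, -a 0, -a 1, -a 2; 0, 1, 0, 0; 0, 0, 1, 0; 0, 0, 0, 1]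

theorem scaleFirst_eq_subst (π : R) (q : MvPolynomial (Fin 4) R) :
    scaleFirst π q = subst (scaleMatrix π) q := by
  rw [scaleFirst, subst]
  congr 2
  ext1 i
  refine Fin.cases ?_ (fun i => ?_) i
  · rw [Fin.sum_univ_succ]
    simp [scaleMatrix, Matrix.diagonal_apply, (Fin.succ_ne_zero _).symm]
  · rw [Fin.sum_univ_succ]
    simp [scaleMatrix, Matrix.diagonal_apply]

theorem shearFirst_eq_subst (a : Fin 3 → R) (q : MvPolynomial (Fin 4) R) :
    shearFirst a q = subst (shearMatrix a) q := by
  rw [shearFirst, subst]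
  congr 2
  ext1 i
  fin_cases i
  · simp [shearMatrix, Fin.sum_univ_succ]; ring
  all_goals simp [shearMatrix, Fin.sum_univ_succ]

theorem det_scaleMatrix (π : R) : (scaleMatrix π).det = π := by
  simp [scaleMatrix, Matrix.det_diagonal, Fin.prod_univ_succ]

theorem det_shearMatrix (a : Fin 3 → R) : (shearMatrix a).det = 1 := by
  simp [shearMatrix, Matrix.det_succ_row_zero, Fin.sum_univ_succ]

open Matrix in
theorem scaleMatrix_mulVec (π : R) (z : Fin 4 → R) :
    scaleMatrix π *ᵥ z = Fin.cons (π * z 0) (fun j => z j.succ) := by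
  ext1 i
  refine Fin.cases ?_ (fun i => ?_) i <;> simp [scaleMatrix, mulVec_diagonal]

open Matrix in
theorem shearMatrix_mulVec (a : Fin 3 → R) (z : Fin 4 → R) :
    shearMatrix a *ᵥ z = Fin.cons (z 0 - ∑ j, a j * z j.succ) (fun j => z j.succ) := by
  ext1 i
  fin_cases i
  · simp [mulVec, dotProduct, shearMatrix, Fin.sum_univ_succ]; ring
  all_goals
    simp [mulVec, dotProduct, shearMatrix, Fin.sum_univ_succ]
    try rfl

end Decomposition

namespace QuadricPair

section Congr

variable {R : Type*} [CommRing R]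

theorem F4I_congr {U V U' V' : Matrix (Fin 4) (Fin 4) R} (hU : form U = form U')
    (hV : form V = form V') (x : Fin 4 → R) : F4I U V x = F4I U' V' x ∧ G4I U V x = G4I U' V' x := by
  obtain ⟨hU, dU⟩ := form_inj hU
  obtain ⟨hV, dV⟩ := form_inj hV
  have hT : ∀ {U V U' V' : Matrix (Fin 4) (Fin 4) R}, hess U = hess U' → hess V = hess V' →
      (∀ i, V i i = V' i i) → TI U V x = TI U' V' x := by
    intro U V U' V' hU hV dV
    simp only [TI, dualI, halfAdj, hU, hV, dV]
  have hrd : ∀ i, rdCoeff U V i = rdCoeff U' V' i := fun i => by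
    simp only [rdCoeff, hU, hV, dU, dV]
  have hD : doublingI U V = doublingI U' V' := by
    obtain ⟨ha, hb, hc, hd, he⟩ := doublingI_rd U V
    obtain ⟨ha', hb', hc', hd', he'⟩ := doublingI_rd U' V'
    rw [← hrd] at ha' hb' hc' hd' he'
    generalize h1 : doublingI U V = D at *
    generalize h2 : doublingI U' V' = D' at *
    have hl : D.l = D'.l := by rw [← h1, ← h2, doublingI_l, doublingI_l, hU]
    have hm : D.m = D'.m := by rw [← h1, ← h2, doublingI_m, doublingI_m, hU, hV]
    have hn : D.n = D'.n := by rw [← h1, ← h2, doublingI_n, doublingI_n, hV]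
    cases D; cases D'
    simp_all
  rw [F4I, G4I, F4I, G4I, hD, hT hU hV dV, hT hV hU dU]
  exact ⟨rfl, rfl⟩

/-- The ideal generated by the values of `F₄` and `G₄` at `x`. -/
def covariantIdeal (Q : QuadricPair R) (x : Fin 4 → R) : Ideal R :=
  covIdeal (coeffMatrix (Q 0)) (coeffMatrix (Q 1)) x

theorem covariantIdeal_eq {Q : QuadricPair R} {U V : Matrix (Fin 4) (Fin 4) R} (hU : Q 0 = form U)
    (hV : Q 1 = form V) (x : Fin 4 → R) : Q.covariantIdeal x = covIdeal U V x := by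
  have h1 : form (coeffMatrix (Q 0)) = form U := by
    rw [hU, form_coeffMatrix (form_isHomogeneous U)]
  have h2 : form (coeffMatrix (Q 1)) = form V := by
    rw [hV, form_coeffMatrix (form_isHomogeneous V)]
  obtain ⟨hF, hG⟩ := F4I_congr h1 h2 x
  rw [covariantIdeal, covIdeal, hF, hG, covIdeal]

theorem IsModel.linComb {Q : QuadricPair R} (hQ : Q.IsModel) (M : Matrix (Fin 2) (Fin 2) R) :
    (Q.linComb M).IsModel := by
  intro i
  refine IsHomogeneous.sum _ _ _ fun j _ => ?_
  simpa using (isHomogeneous_C (Fin 4) (M i j)).mul (hQ j)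

variable [IsDomain R] [CharZero R]

open Matrix in
theorem covariantIdeal_subst {Q : QuadricPair R} (hQ : Q.IsModel) (N : Matrix (Fin 4) (Fin 4) R)
    (hN : IsUnit N.det) (x : Fin 4 → R) :
    covariantIdeal (fun i => subst N (Q i)) x = Q.covariantIdeal (N *ᵥ x) := by
  have h0 := form_coeffMatrix (hQ 0)
  have h1 := form_coeffMatrix (hQ 1)
  rw [covariantIdeal_eq h0.symm h1.symm, ← covIdeal_mul N _ _ hN]
  refine covariantIdeal_eq ?_ ?_ x
  · rw [← subst_form, h0]
  · rw [← subst_form, h1]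

theorem covariantIdeal_linComb [IsLocalRing R] {Q : QuadricPair R} (hQ : Q.IsModel)
    (M : Matrix (Fin 2) (Fin 2) R) (hM : IsUnit M.det) (x : Fin 4 → R) (hx : Q.IsZero x) :
    (Q.linComb M).covariantIdeal x = Q.covariantIdeal x := by
  have h0 := form_coeffMatrix (hQ 0)
  have h1 := form_coeffMatrix (hQ 1)
  rw [covariantIdeal_eq h0.symm h1.symm, ← covIdeal_gl M hM]
  · refine covariantIdeal_eq ?_ ?_ x
    · rw [form_smul_add, h0, h1, QuadricPair.linComb, Fin.sum_univ_two]
    · rw [form_smul_add, h0, h1, QuadricPair.linComb, Fin.sum_univ_two]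
  · rw [dotProduct_hess, h0, hx 0, mul_zero]
  · rw [dotProduct_hess, h1, hx 1, mul_zero]

open Matrix in
/-- The effect of the substitution of Step (ii). -/
theorem covariantIdeal_scale {Q Q' : QuadricPair R} (hQ : Q.IsModel) (hQ' : Q'.IsModel) {π : R}
    (hπ : π ≠ 0) (h0 : C π * Q' 0 = scaleFirst π (Q 0)) (h1 : Q' 1 = scaleFirst π (Q 1))
    (x : Fin 4 → R) :
    Q.covariantIdeal (scaleMatrix π *ᵥ x) = Ideal.span {π ^ 2} * Q'.covariantIdeal x := by
  have e0 := form_coeffMatrix (hQ 0)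
  have e1 := form_coeffMatrix (hQ 1)
  have e0' := form_coeffMatrix (hQ' 0)
  have e1' := form_coeffMatrix (hQ' 1)
  generalize coeffMatrix (Q 0) = U at *
  generalize coeffMatrix (Q 1) = V at *
  generalize coeffMatrix (Q' 0) = U' at *
  generalize coeffMatrix (Q' 1) = V' at *
  rw [← e0', ← e0, ← form_smul, scaleFirst_eq_subst, subst_form] at h0
  rw [← e1', ← e1, scaleFirst_eq_subst, subst_form] at h1
  rw [covariantIdeal_eq e0.symm e1.symm, covariantIdeal_eq e0'.symm e1'.symm]
  obtain ⟨hF, hG⟩ := F4I_congr h0 h1 x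
  rw [F4I_smul] at hF
  rw [G4I_smul] at hG
  have hdiag : ∀ U V : Matrix (Fin 4) (Fin 4) R,
      F4I ((scaleMatrix π)ᵀ * U * scaleMatrix π) ((scaleMatrix π)ᵀ * V * scaleMatrix π) x =
        π ^ 10 * F4I U V (scaleMatrix π *ᵥ x) ∧
      G4I ((scaleMatrix π)ᵀ * U * scaleMatrix π) ((scaleMatrix π)ᵀ * V * scaleMatrix π) x =
        π ^ 12 * G4I U V (scaleMatrix π *ᵥ x) := by
    intro U V
    have hpf : ∀ A : Matrix (Fin 4) (Fin 4) R,
        hess ((scaleMatrix π)ᵀ * A * scaleMatrix π) =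
          fun i j => (Fin.cons π 1 : Fin 4 → R) i * hess A i j * (Fin.cons π 1 : Fin 4 → R) j := by
      intro A
      rw [hess_mul, scaleMatrix, diagonal_transpose]
      ext i j
      rw [mul_diagonal, diagonal_mul]
    obtain ⟨e4, e3, e2, e1, e0⟩ := detPencil_coeff U V
    obtain ⟨f4, f3, f2, f1, f0⟩ :=
      detPencil_coeff ((scaleMatrix π)ᵀ * U * scaleMatrix π) ((scaleMatrix π)ᵀ * V * scaleMatrix π)
    rw [detPencil_mul, Polynomial.coeff_C_mul] at f4 f3 f2 f1 f0
    rw [e4] at f4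
    rw [e3] at f3
    rw [e2] at f2
    rw [e1] at f1
    rw [e0] at f0
    have hc : ∀ j : Fin 3, (Fin.cons π 1 : Fin 4 → R) j.succ = 1 := fun j => by simp
    have c1 : (Fin.cons π 1 : Fin 4 → R) 1 = 1 := hc 0
    have c2 : (Fin.cons π 1 : Fin 4 → R) 2 = 1 := hc 1
    have c3 : (Fin.cons π 1 : Fin 4 → R) 3 = 1 := hc 2
    have key := fun x z => GenBinaryQuartic.G₂_shift (doublingI U V) (doublingI _ _)
      (scaleMatrix π).det 0 0 0 x z
      (by rw [doublingI_l, doublingI_l, hpf, det_scaleMatrix]; simp [pf, c1, c2, c3]; ring)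
      (by rw [doublingI_m, doublingI_m, hpf, hpf, det_scaleMatrix]
          simp [pfPolar, c1, c2, c3]; ring)
      (by rw [doublingI_n, doublingI_n, hpf, det_scaleMatrix]; simp [pf, c1, c2, c3]; ring)
      f4.symm f3.symm f2.symm f1.symm f0.symm
    simp only [F4I, G4I, TI_mul, ← mul_neg, GenBinaryQuartic.F₂_smul, GenBinaryQuartic.G₂_smul,
      (key _ _).1, (key _ _).2, det_scaleMatrix]
    exact ⟨by ring, by ring⟩
  rw [(hdiag U V).1] at hF
  rw [(hdiag U V).2] at hG
  have hF' : F4I U V (scaleMatrix π *ᵥ x) = π ^ 2 * F4I U' V' x :=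
    mul_left_cancel₀ (pow_ne_zero 10 hπ) (by linear_combination -hF)
  have hG' : G4I U V (scaleMatrix π *ᵥ x) = π ^ 2 * G4I U' V' x :=
    mul_left_cancel₀ (pow_ne_zero 12 hπ) (by linear_combination -hG)
  rw [covIdeal, covIdeal, hF', hG', Ideal.span_mul_span']
  simp [Set.singleton_mul, Set.image_pair]

end Congr

end QuadricPair

section Linear

variable {σ R : Type*} [CommRing R]

theorem homogeneousComponent_add_mul {n : ℕ} (m : ℕ) (f : MvPolynomial σ R) {g : MvPolynomial σ R}
    (hg : g.IsHomogeneous n) :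
    homogeneousComponent (m + n) (f * g) = homogeneousComponent m f * g := by
  conv_lhs => rw [← sum_homogeneousComponent f, Finset.sum_mul, map_sum]
  have h : ∀ i, homogeneousComponent (m + n) (homogeneousComponent i f * g) =
      if i = m then homogeneousComponent m f * g else 0 := by
    intro i
    rw [homogeneousComponent_of_mem ((homogeneousComponent_isHomogeneous i f).mul hg)]
    by_cases him : i = m
    · simp [him]
    · rw [if_neg (by omega), if_neg him]
  simp only [h, Finset.sum_ite_eq', Finset.mem_range]
  split_ifs with hm
  · rfl
  · rw [homogeneousComponent_eq_zero _ _ (by omega), zero_mul]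

theorem homogeneousComponent_mul_self {n : ℕ} (f : MvPolynomial σ R) {g : MvPolynomial σ R}
    (hg : g.IsHomogeneous n) : homogeneousComponent n (f * g) = C (coeff 0 f) * g := by
  have := homogeneousComponent_add_mul 0 f hg
  rwa [zero_add, homogeneousComponent_zero] at this

theorem IsHomogeneous.exists_linear {f : MvPolynomial (Fin 4) R} (hf : f.IsHomogeneous 1) :
    ∃ c : Fin 4 → R, f = ∑ i, C (c i) * X i := by
  classical
  refine ⟨fun i => coeff (Finsupp.single i 1) f, ?_⟩
  ext d
  by_cases hd : d.degree = 1
  · obtain ⟨i, rfl⟩ : ∃ i, d = Finsupp.single i 1 := by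
      have h1 : d ≠ 0 := by rintro rfl; simp at hd
      obtain ⟨i, hi⟩ := Finsupp.ne_iff.1 h1
      refine ⟨i, ?_⟩
      have hle : Finsupp.single i 1 ≤ d := by
        rw [Finsupp.single_le_iff]; exact Nat.one_le_iff_ne_zero.2 hi
      obtain ⟨e, rfl⟩ := exists_add_of_le hle
      rw [map_add, Finsupp.degree_single] at hd
      have : e = 0 := (Finsupp.degree_eq_zero_iff e).1 (by omega)
      rw [this, add_zero]
    simp [coeff_sum, coeff_C_mul, coeff_X, Finsupp.single_left_inj]
  · rw [hf.coeff_eq_zero (by simpa using hd), IsHomogeneous.coeff_eq_zero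
      (IsHomogeneous.sum _ _ 1 fun i _ => ?_) (by simpa using hd)]
    simpa using (isHomogeneous_C (Fin 4) _).mul (isHomogeneous_X R i)

theorem IsHomogeneous.exists_linForm {f : MvPolynomial (Fin 4) R} (hf : f.IsHomogeneous 1) :
    ∃ c : Fin 3 → R, constPart f = linForm c := by
  obtain ⟨c, rfl⟩ := IsHomogeneous.exists_linear hf
  refine ⟨fun j => c j.succ, ?_⟩
  rw [Fin.sum_univ_succ, constPart_add, constPart_mul, constPart_X_zero, mul_zero, zero_add]
  exact constPart_linForm _

theorem constPart_eq_zero_of_dvd {p : MvPolynomial (Fin 4) R} (h : X 0 ∣ p) : constPart p = 0 := by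
  obtain ⟨g, rfl⟩ := h
  rw [constPart_mul, constPart_X_zero, zero_mul]

end Linear

/-! ### Geometrically irreducible conics -/

section GeomIrred

variable {k : Type*} [Field k]

/-- Over an algebraic closure, `q` is not the product of two linear forms. -/
def GeomIrred (q : MvPolynomial (Fin 4) k) : Prop :=
  ∀ f g : MvPolynomial (Fin 4) (AlgebraicClosure k), f.IsHomogeneous 1 → g.IsHomogeneous 1 →
    MvPolynomial.map (algebraMap k (AlgebraicClosure k)) q ≠ f * g

theorem GeomIrred.ne_mul {q : MvPolynomial (Fin 4) k} (hq : GeomIrred q)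
    {f g : MvPolynomial (Fin 4) k} (hf : f.IsHomogeneous 1) (hg : g.IsHomogeneous 1) :
    q ≠ f * g := by
  rintro rfl
  exact hq _ _ (hf.map _) (hg.map _) (map_mul _ _ _)

theorem GeomIrred.ne_zero {q : MvPolynomial (Fin 4) k} (hq : GeomIrred q) : q ≠ 0 := fun h =>
  hq.ne_mul (isHomogeneous_zero _ _ 1) (isHomogeneous_zero _ _ 1) (by rw [h, zero_mul])

theorem GeomIrred.C_mul {q : MvPolynomial (Fin 4) k} (hq : GeomIrred q) {c : k} (hc : c ≠ 0) :
    GeomIrred (C c * q) := by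
  intro f g hf hg h
  refine hq (C (algebraMap k _ c⁻¹) * f) g ?_ hg ?_
  · simpa using (isHomogeneous_C (Fin 4) _).mul hf
  · rw [mul_assoc, ← h, map_mul, map_C, ← mul_assoc, ← MvPolynomial.C_mul, ← map_mul, inv_mul_cancel₀ hc]
    simp

theorem GeomIrred.C_mul_ne_mul {q : MvPolynomial (Fin 4) k} (hq : GeomIrred q) {c : k}
    {a l : Fin 3 → k} (h : C c * q = linForm a * linForm l) (hl : l ≠ 0) : c = 0 ∧ a = 0 := by
  have hc : c = 0 := by
    by_contra hc
    exact (hq.C_mul hc).ne_mul (linForm_isHomogeneous a) (linForm_isHomogeneous l) h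
  refine ⟨hc, ?_⟩
  rw [hc, C_0, zero_mul, eq_comm, mul_eq_zero, ← linForm_zero, linForm_injective.eq_iff,
    linForm_injective.eq_iff] at h
  exact h.resolve_right hl

end GeomIrred

/-! ### The invariants of the algorithm -/

section Invariants

open QuadricPair

variable {O : Type*} [CommRing O]

/-- Some primitive combination of the two forms vanishes modulo `π ^ n` on a plane
`x₁ = a₂ x₂ + a₃ x₃ + a₄ x₄`. -/
def VanishesOnPlane (π : O) (n : ℕ) (Q : QuadricPair O) : Prop :=
  ∃ c e : Fin 2 → O, c 0 * e 0 + c 1 * e 1 = 1 ∧ ∃ a : Fin 3 → O,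
    C (π ^ n) ∣ restr a (C (c 0) * Q 0 + C (c 1) * Q 1)

/-- Some primitive combination of the two forms vanishes modulo `π ^ n` on a plane
`x₁ = π (a₂ x₂ + a₃ x₃ + a₄ x₄)`. -/
def VanishesNear (π : O) (n : ℕ) (Q : QuadricPair O) : Prop :=
  ∃ c e : Fin 2 → O, c 0 * e 0 + c 1 * e 1 = 1 ∧ ∃ a : Fin 3 → O,
    C (π ^ n) ∣ restr (π • a) (C (c 0) * Q 0 + C (c 1) * Q 1)

theorem VanishesNear.of_linComb {π : O} {n : ℕ} {Q : QuadricPair O} (M : Matrix (Fin 2) (Fin 2) O)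
    (hM : IsUnit M.det) (h : VanishesNear π n (Q.linComb M)) : VanishesNear π n Q := by
  obtain ⟨c, e, hce, a, ha⟩ := h
  obtain ⟨u, hu⟩ := hM
  rw [Matrix.det_fin_two] at hu
  have hu' := u.inv_mul
  rw [hu] at hu'
  refine ⟨fun j => c 0 * M 0 j + c 1 * M 1 j,
    ![(u⁻¹ : Oˣ) * (M 1 1 * e 0 - M 0 1 * e 1), (u⁻¹ : Oˣ) * (M 0 0 * e 1 - M 1 0 * e 0)], ?_, a, ?_⟩
  · simp only [Matrix.cons_val_zero, Matrix.cons_val_one]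
    linear_combination (c 0 * e 0 + c 1 * e 1) * hu' + hce
  · convert ha using 2
    simp only [QuadricPair.linComb, Fin.sum_univ_two, C_add, C_mul]
    ring

theorem linComb_linComb (M N : Matrix (Fin 2) (Fin 2) O) (Q : QuadricPair O) :
    (Q.linComb N).linComb M = Q.linComb (M * N) := by
  ext1 i
  simp only [QuadricPair.linComb, Fin.sum_univ_two, Matrix.mul_apply, C_add, C_mul]
  ring

theorem linComb_one (Q : QuadricPair O) : Q.linComb 1 = Q := by
  ext1 i
  refine (Finset.sum_eq_single i (fun j _ hj => ?_) (by simp)).trans (by simp)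
  rw [Matrix.one_apply_ne hj.symm, C_0, zero_mul]

theorem vanishesNear_linComb {π : O} {n : ℕ} {Q : QuadricPair O} (M : GL (Fin 2) O) :
    VanishesNear π n (Q.linComb M.val) ↔ VanishesNear π n Q := by
  have hdet : ∀ M : GL (Fin 2) O, IsUnit M.val.det := fun M =>
    (Matrix.isUnit_iff_isUnit_det _).1 M.isUnit
  refine ⟨fun h => h.of_linComb _ (hdet M), fun h => ?_⟩
  have h' : (Q.linComb M.val).linComb (M⁻¹).val = Q := by
    rw [linComb_linComb, ← Units.val_mul, inv_mul_cancel, Units.val_one, linComb_one]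
  rw [← h'] at h
  exact h.of_linComb _ (hdet M⁻¹)

variable [IsLocalRing O]

/-- The state of affairs on entering Step (ii): the reductions of the two forms restrict to
multiples of a geometrically irreducible conic in the plane `x₁ = 0`, which has multiplicity one. -/
def AtStepTwo (Q : QuadricPair O) (l : Fin 3 → IsLocalRing.ResidueField O) : Prop :=
  Q.IsModel ∧ ∃ (β : Fin 2 → IsLocalRing.ResidueField O)
    (q : MvPolynomial (Fin 4) (IsLocalRing.ResidueField O)) (lam : IsLocalRing.ResidueField O),
    GeomIrred q ∧ constPart q = q ∧ (∀ i, constPart (red (Q i)) = C (β i) * q) ∧ β ≠ 0 ∧ l ≠ 0 ∧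
    C (β 1) * red (Q 0) - C (β 0) * red (Q 1) = X 0 * (C lam * X 0 + linForm l)

/-- As `AtStepTwo`, after the `GL₂`-transformation of Step (ii). -/
def AfterTransformation (Q : QuadricPair O) (l : Fin 3 → IsLocalRing.ResidueField O) : Prop :=
  Q.IsModel ∧ ∃ lam : IsLocalRing.ResidueField O,
    l ≠ 0 ∧ GeomIrred (constPart (red (Q 1))) ∧ red (Q 0) = X 0 * (C lam * X 0 + linForm l)

/-- The state of affairs on entering Step (iii). -/
def AtStepThree (Q : QuadricPair O) (l : Fin 3 → IsLocalRing.ResidueField O) : Prop :=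
  Q.IsModel ∧ ∃ (q₁ q₂ : MvPolynomial (Fin 4) (IsLocalRing.ResidueField O)),
    l ≠ 0 ∧ GeomIrred q₂ ∧ constPart q₁ = q₁ ∧ constPart q₂ = q₂ ∧
    red (Q 0) = X 0 * linForm l + q₁ ∧ red (Q 1) = q₂

theorem AtStepTwo.afterTransformation {Q : QuadricPair O} {l : Fin 3 → IsLocalRing.ResidueField O}
    (hQ : AtStepTwo Q l) (M : GL (Fin 2) O) (h : X 0 ∣ red (Q.linComb M.val 0)) :
    ∃ γ : IsLocalRing.ResidueField O, γ ≠ 0 ∧ AfterTransformation (Q.linComb M.val) (γ • l) := by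
  obtain ⟨hmod, β, q, lam, hq, hqc, hβ, hβ0, hl, hlin⟩ := hQ
  have hdet : IsUnit M.val.det := (Matrix.isUnit_iff_isUnit_det _).1 M.isUnit
  have hdet0 := (hdet.map (IsLocalRing.residue O)).ne_zero
  rw [Matrix.det_fin_two] at hdet0
  have hred : ∀ i, red (Q.linComb M.val i) = C (IsLocalRing.residue O (M.val i 0)) * red (Q 0) +
      C (IsLocalRing.residue O (M.val i 1)) * red (Q 1) := fun i => by
    simp [QuadricPair.linComb, Fin.sum_univ_two]
  set m : Fin 2 → Fin 2 → IsLocalRing.ResidueField O := fun i j =>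
    IsLocalRing.residue O (M.val i j) with hm
  have hcp : ∀ i, constPart (red (Q.linComb M.val i)) = C (m i 0 * β 0 + m i 1 * β 1) * q := by
    intro i
    rw [hred, constPart_add, constPart_mul, constPart_mul, hβ, hβ, constPart_C, constPart_C]
    simp only [hm, C_add, C_mul]; ring
  have h0 : m 0 0 * β 0 + m 0 1 * β 1 = 0 := by
    have := hcp 0
    rw [constPart_eq_zero_of_dvd h, eq_comm, mul_eq_zero] at this
    exact C_eq_zero.1 (this.resolve_right hq.ne_zero)
  simp only [map_sub, map_mul] at hdet0
  change m 0 0 * m 1 1 - m 0 1 * m 1 0 ≠ 0 at hdet0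
  have h1 : m 1 0 * β 0 + m 1 1 * β 1 ≠ 0 := by
    intro h1
    apply hβ0
    ext i
    apply (mul_eq_zero.1 (?_ : (m 0 0 * m 1 1 - m 0 1 * m 1 0) * β i = 0)).resolve_left hdet0
    fin_cases i
    · simp only [Fin.zero_eta]; linear_combination m 1 1 * h0 - m 0 1 * h1
    · simp only [Fin.mk_one]; linear_combination m 0 0 * h1 - m 1 0 * h0
  obtain ⟨γ, hγ0, hγ1⟩ : ∃ γ, m 0 0 = γ * β 1 ∧ m 0 1 = -γ * β 0 := by
    by_cases hb : β 1 = 0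
    · have hb0 : β 0 ≠ 0 := fun hb0 => hβ0 (by ext i; fin_cases i <;> simp [hb, hb0])
      rw [hb, mul_zero, add_zero, mul_eq_zero] at h0
      refine ⟨-(m 0 1 / β 0), ?_, ?_⟩
      · rw [hb, mul_zero]; exact h0.resolve_right hb0
      · field_simp
    · refine ⟨m 0 0 / β 1, by field_simp, ?_⟩
      field_simp
      linear_combination h0
  have hγ : γ ≠ 0 := by
    rintro rfl
    apply hdet0
    rw [hγ0, hγ1]; ring
  refine ⟨γ, hγ, hmod.linComb _, γ * lam, smul_ne_zero hγ hl, ?_, ?_⟩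
  · rw [hcp]; exact hq.C_mul h1
  · rw [hred]
    change C (m 0 0) * _ + C (m 0 1) * _ = _
    rw [hγ0, hγ1, linForm_smul, C_mul, C_mul, C_mul, C_neg]
    linear_combination C γ * hlin

end Invariants

section Steps

open QuadricPair IsLocalRing

variable {O : Type*} [CommRing O] [IsDomain O] [IsDiscreteValuationRing O] {π : O}

theorem residue_eq_zero_iff_dvd (hπ : Irreducible π) (a : O) : residue O a = 0 ↔ π ∣ a := by
  rw [residue_eq_zero_iff, hπ.maximalIdeal_eq, Ideal.mem_span_singleton]

theorem red_eq_zero_iff (hπ : Irreducible π) (p : MvPolynomial (Fin 4) O) :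
    red p = 0 ↔ C π ∣ p :=
  (C_dvd_iff_map_hom_eq_zero _ _ (residue_eq_zero_iff_dvd hπ) _).symm

theorem C_ne_zero_of_irreducible (hπ : Irreducible π) :
    (C π : MvPolynomial (Fin 4) O) ≠ 0 := by simpa using hπ.ne_zero

theorem red_scaleFirst (hπ : Irreducible π) (q : MvPolynomial (Fin 4) O) :
    red (scaleFirst π q) = constPart (red q) := by
  rw [red, scaleFirst, map_bind₁, constPart]
  congr 2
  ext1 i
  split_ifs
  · simp [(residue_eq_zero_iff_dvd hπ π).2 dvd_rfl]
  · simp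

theorem scaleFirst_combination (a b : O) (p q : MvPolynomial (Fin 4) O) :
    scaleFirst π (C a * p + C b * q) = C a * scaleFirst π p + C b * scaleFirst π q := by
  simp [scaleFirst]

theorem isModel_of_scale (hπ : Irreducible π) {R R' : QuadricPair O} (hR : R.IsModel)
    (h0 : C π * R' 0 = scaleFirst π (R 0)) (h1 : R' 1 = scaleFirst π (R 1)) : R'.IsModel := by
  have hs : ∀ i, (scaleFirst π (R i)).IsHomogeneous 2 := fun i => by
    rw [scaleFirst_eq_subst]; exact subst_isHomogeneous (hR i) _
  have h : (R' 0).IsHomogeneous 2 := by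
    intro d hd
    refine hs 0 ?_
    rw [← h0, coeff_C_mul]
    exact mul_ne_zero hπ.ne_zero hd
  intro i
  fin_cases i
  · exact h
  · simpa [h1] using hs 1

/-- The effect of the scaling of Step (ii) on the form that is divided by `π`. -/
theorem red_of_scale (hπ : Irreducible π) {p p' : MvPolynomial (Fin 4) O} (hp : p.IsHomogeneous 2)
    (hp' : p'.IsHomogeneous 2) (h : C π * p' = scaleFirst π p) {lam : ResidueField O}
    {l : Fin 3 → ResidueField O} (hl : red p = X 0 * (C lam * X 0 + linForm l)) :
    red p' = X 0 * linForm l + constPart (red p') := by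
  have e := form_coeffMatrix hp
  have e' := form_coeffMatrix hp'
  generalize coeffMatrix p = U at *
  generalize coeffMatrix p' = U' at *
  have h2 : form (π • U') = form ((scaleMatrix π).transpose * U * scaleMatrix π) := by
    rw [form_smul, ← subst_form, e, e', h, scaleFirst_eq_subst]
  obtain ⟨hh, hd⟩ := form_inj h2
  have hU : U' 0 0 = π * U 0 0 := by
    have := hd 0
    simp only [Matrix.smul_apply, smul_eq_mul, scaleMatrix, Matrix.diagonal_transpose,
      Matrix.mul_diagonal, Matrix.diagonal_mul, Fin.cons_zero] at this
    exact mul_left_cancel₀ hπ.ne_zero (by linear_combination this)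
  have hlin : linCoeff U' = linCoeff U := by
    ext j
    have := congrFun (congrFun hh 0) j.succ
    rw [hess_smul, hess_mul] at this
    simp only [Matrix.smul_apply, smul_eq_mul, scaleMatrix, Matrix.diagonal_transpose,
      Matrix.mul_diagonal, Matrix.diagonal_mul, Fin.cons_zero, Fin.cons_succ, Pi.one_apply,
      mul_one] at this
    exact mul_left_cancel₀ hπ.ne_zero this
  have hl' : (fun j => residue O (linCoeff U j)) = l := by
    apply linForm_injective
    have h3 := congrArg linPart hl
    rw [← e, red, map_form, linPart_form] at h3
    have h4 : linPart (X 0 * (C lam * X 0 + linForm l)) = linForm l := by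
      rw [linPart, Derivation.leibniz, constPart_add, smul_eq_mul, smul_eq_mul, constPart_mul,
        constPart_mul, constPart_X_zero, zero_mul, zero_add, pderiv_X_self, constPart_add,
        constPart_mul, constPart_X_zero, mul_zero, zero_add, constPart_linForm, ← C_1, constPart_C,
        C_1, mul_one]
    rw [h4] at h3
    rw [← h3]
    congr 1
  rw [← e']
  conv_lhs => rw [form_decomp]
  rw [hlin, map_add, map_add, map_mul, map_mul, map_C, hU, map_mul,
    (residue_eq_zero_iff_dvd hπ π).2 dvd_rfl, map_linForm, hl', map_constPart]
  simp

theorem AfterTransformation.atStepThree (hπ : Irreducible π) {R R' : QuadricPair O}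
    {l : Fin 3 → ResidueField O} (hR : AfterTransformation R l)
    (h0 : C π * R' 0 = scaleFirst π (R 0)) (h1 : R' 1 = scaleFirst π (R 1)) :
    AtStepThree R' l := by
  obtain ⟨hmod, lam, hl, hq, hred⟩ := hR
  have hmod' := isModel_of_scale hπ hmod h0 h1
  refine ⟨hmod', constPart (red (R' 0)), constPart (red (R 1)), hl, hq, constPart_constPart _,
    constPart_constPart _, ?_, ?_⟩
  · exact red_of_scale hπ (hmod 0) (hmod' 0) h0 hred
  · rw [h1, red_scaleFirst hπ]

/-- A combination vanishing on a plane modulo `π` involves the first form. -/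
theorem AtStepThree.isUnit_of_dvd (hπ : Irreducible π) {Q : QuadricPair O}
    {l : Fin 3 → ResidueField O} (hQ : AtStepThree Q l) {c e : Fin 2 → O}
    (hce : c 0 * e 0 + c 1 * e 1 = 1) {a : Fin 3 → O}
    (h : C π ∣ restr a (C (c 0) * Q 0 + C (c 1) * Q 1)) : IsUnit (c 0) := by
  obtain ⟨-, q₁, q₂, hl, hq₂, hc₁, hc₂, h0, h1⟩ := hQ
  by_contra hc
  have hc0 : residue O (c 0) = 0 := by
    rw [residue_eq_zero_iff]; exact hc
  have hc1 : residue O (c 1) ≠ 0 := by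
    intro hc1
    have := congrArg (residue O) hce
    simp [hc0, hc1] at this
  rw [← red_eq_zero_iff hπ, red, map_restr, map_add, map_mul, map_mul, map_C, map_C, hc0, C_0,
    zero_mul, zero_add, map_mul] at h
  change restr _ (C _) * restr _ (red (Q 1)) = 0 at h
  rw [h1, ← hc₂, restr_constPart, hc₂, mul_eq_zero] at h
  rcases h with h | h
  · apply hc1
    rw [restr, bind₁_C_right] at h
    exact C_eq_zero.1 h
  · exact hq₂.ne_zero h

theorem restr_C {R : Type*} [CommRing R] (a : Fin 3 → R) (c : R) : restr a (C c) = C c := by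
  rw [restr, bind₁_C_right]

theorem AtStepThree.relation_of_dvd (hπ : Irreducible π) {Q : QuadricPair O}
    {l : Fin 3 → ResidueField O} (hQ : AtStepThree Q l) {c e : Fin 2 → O}
    (hce : c 0 * e 0 + c 1 * e 1 = 1) {a : Fin 3 → O}
    (h : C π ∣ restr a (C (c 0) * Q 0 + C (c 1) * Q 1)) :
    ∃ b : ResidueField O, constPart (red (Q 0)) =
      linForm (fun j => - residue O (a j)) * linForm l + C b * constPart (red (Q 1)) := by
  have hu := hQ.isUnit_of_dvd hπ hce h
  have hu0 : residue O (c 0) ≠ 0 := (hu.map (residue O)).ne_zero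
  obtain ⟨-, q₁, q₂, hl, hq₂, hc₁, hc₂, h0, h1⟩ := hQ
  rw [← red_eq_zero_iff hπ, red, map_restr, map_add, map_mul, map_mul, map_C, map_C, map_add,
    map_mul, map_mul, restr_C, restr_C] at h
  change C _ * restr _ (red (Q 0)) + C _ * restr _ (red (Q 1)) = 0 at h
  rw [h0, h1, map_add, map_mul, restr_X_zero, restr_linForm, ← hc₁, ← hc₂, restr_constPart,
    restr_constPart, hc₁, hc₂] at h
  refine ⟨-(residue O (c 1) / residue O (c 0)), ?_⟩
  have hneg : linForm (fun j => - residue O (a j)) = - linForm (fun j => residue O (a j)) := by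
    simp [linForm]
  rw [h0, h1, constPart_add, constPart_mul, constPart_X_zero, zero_mul, zero_add, hc₁, hc₂, hneg]
  have hC : (C (residue O (c 0)) : MvPolynomial (Fin 4) (ResidueField O)) ≠ 0 := by simpa using hu0
  apply mul_left_cancel₀ hC
  have hC2 : (C (residue O (c 0)) : MvPolynomial (Fin 4) (ResidueField O)) *
      C (-(residue O (c 1) / residue O (c 0))) = - C (residue O (c 1)) := by
    rw [← C_mul, ← C_neg]; congr 1; field_simp
  linear_combination h - q₂ * hC2

theorem vanishesNear_succ_iff (hπ : Irreducible π) {R R' : QuadricPair O}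
    {l : Fin 3 → ResidueField O} (hR : AfterTransformation R l)
    (h0 : C π * R' 0 = scaleFirst π (R 0)) (h1 : R' 1 = scaleFirst π (R 1)) (n : ℕ) :
    VanishesNear π (n + 1) R ↔ VanishesOnPlane π n R' := by
  have h3 := hR.atStepThree hπ h0 h1
  obtain ⟨hmod, lam, hl, hq, hred⟩ := hR
  have key : ∀ (a : Fin 3 → O) (c₀ c₁ : O),
      restr (π • a) (C c₀ * R 0 + C (π * c₁) * R 1) =
        C π * restr a (C c₀ * R' 0 + C c₁ * R' 1) := by
    intro a c₀ c₁
    rw [← restr_scaleFirst, h1, scaleFirst_combination, ← h0]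
    simp only [map_add, map_mul, restr_C]
    ring
  have hCπ := C_ne_zero_of_irreducible hπ
  constructor
  · rintro ⟨c, e, hce, a, ha⟩
    have hc1 : π ∣ c 1 := by
      have h : C π ∣ restr (π • a) (C (c 0) * R 0 + C (c 1) * R 1) :=
        (map_dvd C (dvd_pow_self π n.succ_ne_zero)).trans ha
      rw [← red_eq_zero_iff hπ, red, map_restr] at h
      have hz : (fun i => residue O ((π • a) i)) = 0 := by
        ext i; simp [(residue_eq_zero_iff_dvd hπ π).2 dvd_rfl]
      rw [hz, ← constPart_eq_restr, map_add, map_mul, map_mul, map_C, map_C, constPart_add,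
        constPart_mul, constPart_mul, constPart_C, constPart_C] at h
      change C _ * constPart (red (R 0)) + C _ * constPart (red (R 1)) = 0 at h
      rw [hred, constPart_mul, constPart_X_zero, zero_mul, mul_zero, zero_add, mul_eq_zero] at h
      rw [← residue_eq_zero_iff_dvd hπ]
      exact C_eq_zero.1 (h.resolve_right hq.ne_zero)
    obtain ⟨c₁, hc₁⟩ := hc1
    have hc0 : IsUnit (c 0) := by
      by_contra hu
      have hm : c 0 ∈ maximalIdeal O := hu
      have h2 : (1 : O) ∈ maximalIdeal O := by
        rw [← hce]
        refine Ideal.add_mem _ (Ideal.mul_mem_right _ _ hm) (Ideal.mul_mem_right _ _ ?_)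
        rw [hπ.maximalIdeal_eq, Ideal.mem_span_singleton, hc₁]
        exact dvd_mul_right _ _
      exact (maximalIdeal.isMaximal O).ne_top ((Ideal.eq_top_iff_one _).2 h2)
    obtain ⟨u, hu⟩ := hc0
    refine ⟨![c 0, c₁], ![(u⁻¹ : Oˣ), 0], by simp [← hu], a, ?_⟩
    rw [hc₁, key, pow_succ', C_mul] at ha
    simpa using (mul_dvd_mul_iff_left hCπ).1 ha
  · rintro ⟨c, e, hce, a, ha⟩
    rcases n with _ | n
    · refine ⟨![1, 0], ![1, 0], by simp, 0, ?_⟩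
      rw [zero_add, pow_one, ← red_eq_zero_iff hπ, smul_zero, ← constPart_eq_restr, red,
        map_constPart]
      change constPart (red _) = 0
      simp only [Matrix.cons_val_zero, Matrix.cons_val_one, C_0, zero_mul, add_zero, C_1, one_mul]
      rw [hred, constPart_mul, constPart_X_zero, zero_mul]
    · have h : C π ∣ restr a (C (c 0) * R' 0 + C (c 1) * R' 1) :=
        (map_dvd C (dvd_pow_self π n.succ_ne_zero)).trans ha
      obtain ⟨u, hu⟩ := h3.isUnit_of_dvd hπ hce h
      refine ⟨![c 0, π * c 1], ![(u⁻¹ : Oˣ), 0], by simp [← hu], a, ?_⟩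
      simp only [Matrix.cons_val_zero, Matrix.cons_val_one]
      rw [key, pow_succ', C_mul]
      exact mul_dvd_mul_left _ ha

end Steps

section Algorithm

open QuadricPair IsLocalRing

theorem pderiv_constPart {R : Type*} [CommRing R] (q : MvPolynomial (Fin 4) R) :
    pderiv 0 (constPart q) = 0 := by
  induction q using MvPolynomial.induction_on with
  | C a => rw [constPart_C, pderiv_C]
  | add p q hp hq => rw [constPart_add, map_add, hp, hq, add_zero]
  | mul_X p i hp =>
    rw [constPart_mul, Derivation.leibniz, hp, smul_zero, add_zero]
    refine Fin.cases ?_ (fun j => ?_) i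
    · rw [constPart_X_zero, map_zero, smul_zero]
    · rw [constPart_eq_restr (X j.succ), restr_X_succ, pderiv_X_of_ne (Fin.succ_ne_zero j),
        smul_zero]

theorem sum_C_mul_X_succ {R : Type*} [CommRing R] (a : Fin 3 → R) :
    ∑ j : Fin 3, C (a j) * X j.succ = linForm a := rfl

variable {O : Type*} [CommRing O] [IsDomain O] [IsDiscreteValuationRing O] {π : O}

theorem AtStepThree.red_eq {Q : QuadricPair O} {l : Fin 3 → ResidueField O}
    (hQ : AtStepThree Q l) : red (linPart (Q 0)) = linForm l ∧
      red (Q 0) = X 0 * linForm l + red (constPart (Q 0)) ∧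
      red (Q 1) = red (constPart (Q 1)) ∧ GeomIrred (red (constPart (Q 1))) := by
  obtain ⟨hmod, q₁, q₂, hl, hq₂, hc₁, hc₂, h0, h1⟩ := hQ
  refine ⟨?_, ?_, ?_, ?_⟩
  · have hpd : red (linPart (Q 0)) = linPart (red (Q 0)) := by
      rw [linPart, red, map_constPart, linPart, pderiv_map]
    rw [hpd, h0, linPart, map_add, ← hc₁, pderiv_constPart, add_zero, Derivation.leibniz,
      constPart_add, smul_eq_mul, smul_eq_mul, constPart_mul, constPart_mul, constPart_X_zero,
      zero_mul, zero_add, pderiv_X_self, constPart_linForm, ← C_1, constPart_C, C_1, mul_one]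
  · rw [red, map_constPart]
    change red (Q 0) = _ + constPart (red (Q 0))
    rw [h0, constPart_add, constPart_mul, constPart_X_zero, zero_mul, zero_add, hc₁]
  · rw [red, map_constPart]
    change red (Q 1) = constPart (red (Q 1))
    rw [h1, hc₂]
  · rw [red, map_constPart]
    change GeomIrred (constPart (red (Q 1)))
    rwa [h1, hc₂]

theorem AtStepThree.exists_congr {Q : QuadricPair O} {l : Fin 3 → ResidueField O}
    (hQ : AtStepThree Q l)
    (hmem : red (constPart (Q 0)) ∈ Ideal.span {red (linPart (Q 0)), red (constPart (Q 1))}) :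
    ∃ (a : Fin 3 → O) (b : O), red (constPart (Q 0)) =
        red ((∑ j : Fin 3, C (a j) * X j.succ) * linPart (Q 0) + C b * constPart (Q 1)) := by
  obtain ⟨hl, h0, h1, hq⟩ := hQ.red_eq
  have hom : ∀ i, (red (constPart (Q i))).IsHomogeneous 2 := fun i =>
    (constPart_isHomogeneous (hQ.1 i)).map _
  have hcc : ∀ i, constPart (red (constPart (Q i))) = red (constPart (Q i)) := fun i => by
    rw [red, ← map_constPart, constPart_constPart]
  rw [hl] at hmem
  obtain ⟨f, g, hfg⟩ := Ideal.mem_span_pair.1 hmem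
  have h2 := congrArg (homogeneousComponent 2) hfg
  rw [map_add, homogeneousComponent_add_mul 1 f (linForm_isHomogeneous l),
    homogeneousComponent_mul_self g (hom 1), homogeneousComponent_eq_self (hom 0)] at h2
  obtain ⟨a, ha⟩ := IsHomogeneous.exists_linForm (homogeneousComponent_isHomogeneous 1 f)
  have h3 := congrArg constPart h2
  rw [constPart_add, constPart_mul, constPart_mul, ha, constPart_C, hcc, hcc, constPart_linForm] at h3
  choose a' ha' using fun j => residue_surjective (a j)
  obtain ⟨b, hb⟩ := residue_surjective (coeff 0 g)
  refine ⟨a', b, ?_⟩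
  rw [sum_C_mul_X_succ, map_add, map_mul, map_mul, hl, red, map_linForm, map_C, hb]
  simp only [ha']
  exact h3.symm

theorem vanishesOnPlane_one_iff (hπ : Irreducible π) {Q : QuadricPair O}
    {l : Fin 3 → ResidueField O} (hQ : AtStepThree Q l) : VanishesOnPlane π 1 Q ↔
      red (constPart (Q 0)) ∈ Ideal.span {red (linPart (Q 0)), red (constPart (Q 1))} := by
  obtain ⟨hl, h0, h1, hq⟩ := hQ.red_eq
  constructor
  · rintro ⟨c, e, hce, a, ha⟩
    rw [pow_one] at ha
    obtain ⟨b, hb⟩ := hQ.relation_of_dvd hπ hce ha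
    rw [hl]
    refine Ideal.mem_span_pair.2 ⟨linForm fun j => -residue O (a j), C b, Eq.symm ?_⟩
    rw [red, map_constPart, map_constPart]
    exact hb
  · intro h
    obtain ⟨a, b, hab⟩ := hQ.exists_congr h
    refine ⟨![1, -b], ![1, 0], by simp, -a, ?_⟩
    rw [pow_one, ← red_eq_zero_iff hπ, red, map_restr]
    simp only [Matrix.cons_val_zero, Matrix.cons_val_one]
    rw [map_add, map_mul, map_mul, map_C, map_C, map_add, map_mul, map_mul, restr_C, restr_C]
    change C _ * restr _ (red (Q 0)) + C _ * restr _ (red (Q 1)) = 0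
    have hneg : linForm (fun j => residue O ((-a) j)) = - linForm (fun j => residue O (a j)) := by
      simp [linForm]
    have hcc : ∀ i (c : Fin 3 → ResidueField O), restr c (red (constPart (Q i))) =
        red (constPart (Q i)) := fun i c => by
      rw [red, map_constPart, restr_constPart]
    rw [sum_C_mul_X_succ, map_add, map_mul, map_mul, hl, red, map_linForm, map_C] at hab
    change red (constPart (Q 0)) = _ + _ * red (constPart (Q 1)) at hab
    rw [h0, h1, map_add, map_mul, restr_X_zero, restr_linForm, hcc, hcc, hneg, hab]
    simp only [map_one, map_neg]
    ring

theorem AtStepThree.shear (hπ : Irreducible π) {Q : QuadricPair O} {l : Fin 3 → ResidueField O}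
    (hQ : AtStepThree Q l) (a : Fin 3 → O) (b : O)
    (hcongr : red (constPart (Q 0)) =
      red ((∑ j : Fin 3, C (a j) * X j.succ) * linPart (Q 0) + C b * constPart (Q 1))) :
    AtStepTwo (fun i => shearFirst a (Q i)) l ∧ ∀ n, VanishesOnPlane π (n + 1) Q ↔
      VanishesNear π (n + 1) (fun i => shearFirst a (Q i)) := by
  obtain ⟨hl, h0, h1, hq⟩ := hQ.red_eq
  have hl0 : l ≠ 0 := by obtain ⟨-, _, _, h, -⟩ := hQ; exact h
  rw [sum_C_mul_X_succ, map_add, map_mul, map_mul, hl, red, map_linForm, map_C] at hcongr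
  change red (constPart (Q 0)) = _ + _ * red (constPart (Q 1)) at hcongr
  have hcc : ∀ i, constPart (red (constPart (Q i))) = red (constPart (Q i)) := fun i => by
    rw [red, ← map_constPart, constPart_constPart]
  have hsc : ∀ p : MvPolynomial (Fin 4) (ResidueField O), constPart p = p →
      shearFirst (fun j => residue O (a j)) p = p := by
    intro p hp
    rw [← hp, constPart, shearFirst, bind₁_bind₁]
    congr 2
    ext1 i
    split_ifs with h
    · simp
    · simp [h]
  have hsl : shearFirst (fun j => residue O (a j)) (linForm l) = linForm l :=
    hsc _ (constPart_linForm l)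
  have hsmul : ∀ p q : MvPolynomial (Fin 4) (ResidueField O),
      shearFirst (fun j => residue O (a j)) (p * q) = shearFirst (fun j => residue O (a j)) p *
        shearFirst (fun j => residue O (a j)) q := fun p q => by simp [shearFirst]
  have hsadd : ∀ p q : MvPolynomial (Fin 4) (ResidueField O),
      shearFirst (fun j => residue O (a j)) (p + q) = shearFirst (fun j => residue O (a j)) p +
        shearFirst (fun j => residue O (a j)) q := fun p q => by simp [shearFirst]
  have hsX : shearFirst (fun j => residue O (a j)) (X 0) =
      X 0 - linForm (fun j => residue O (a j)) := by simp [shearFirst, linForm]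
  have hred : ∀ i, red (shearFirst a (Q i)) = shearFirst (fun j => residue O (a j)) (red (Q i)) := by
    intro i
    rw [shearFirst, red, map_bind₁, shearFirst]
    congr 2
    ext1 i
    split_ifs <;> simp
  have r0 : red (shearFirst a (Q 0)) = X 0 * linForm l + C (residue O b) * red (constPart (Q 1)) := by
    rw [hred, h0, hsadd, hsmul, hsX, hsl, hsc _ (hcc 0), hcongr]
    ring
  have r1 : red (shearFirst a (Q 1)) = red (constPart (Q 1)) := by
    rw [hred, h1, hsc _ (hcc 1)]
  refine ⟨⟨fun i => ?_, ![residue O b, 1], red (constPart (Q 1)), 0, hq, hcc 1, ?_, ?_, hl0, ?_⟩, ?_⟩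
  · change (shearFirst a (Q i)).IsHomogeneous 2
    rw [shearFirst_eq_subst]; exact subst_isHomogeneous (hQ.1 i) _
  · intro i
    fin_cases i
    · change constPart (red (shearFirst a (Q 0))) = C (residue O b) * _
      rw [r0, constPart_add, constPart_mul, constPart_X_zero, zero_mul, zero_add, constPart_mul,
        constPart_C, hcc]
    · change constPart (red (shearFirst a (Q 1))) = C 1 * _
      rw [r1, hcc, C_1, one_mul]
  · intro h
    have := congrFun h 1
    simp at this
  · simp only [Matrix.cons_val_zero, Matrix.cons_val_one]
    rw [r0, r1, C_1, C_0]; ring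
  · intro n
    have hcomb : ∀ (c : Fin 2 → O) (a' : Fin 3 → O),
        restr (a' : Fin 3 → O) (C (c 0) * shearFirst a (Q 0) + C (c 1) * shearFirst a (Q 1)) =
        restr (a' - a) (C (c 0) * Q 0 + C (c 1) * Q 1) := by
      intro c a'
      rw [← restr_shearFirst]
      congr 1
      simp [shearFirst]
    constructor
    · rintro ⟨c, e, hce, a', ha'⟩
      have h : C π ∣ restr a' (C (c 0) * Q 0 + C (c 1) * Q 1) :=
        (map_dvd C (dvd_pow_self π n.succ_ne_zero)).trans ha'
      obtain ⟨b', hb'⟩ := hQ.relation_of_dvd hπ hce h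
      have hrc : ∀ i, constPart (red (Q i)) = red (constPart (Q i)) := fun i => by
        rw [red, map_constPart]
      rw [hrc, hrc, hcongr] at hb'
      have hneg : linForm (fun j => -residue O (a' j)) = - linForm (fun j => residue O (a' j)) := by
        simp [linForm]
      have hrel : C (b' - residue O b) * red (constPart (Q 1)) =
          linForm ((fun j => residue O (a j)) + fun j => residue O (a' j)) * linForm l := by
        rw [linForm_add, C_sub]
        rw [hneg] at hb'
        linear_combination -hb'
      have haa := (hq.C_mul_ne_mul hrel hl0).2
      have hdvd : ∀ j, π ∣ a j + a' j := fun j => by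
        rw [← residue_eq_zero_iff_dvd hπ, map_add]
        exact congrFun haa j
      choose d hd using hdvd
      refine ⟨c, e, hce, d, ?_⟩
      have hda : π • d - a = a' := by
        ext j
        simp [← hd]
      rwa [hcomb, hda]
    · rintro ⟨c, e, hce, a', ha'⟩
      rw [hcomb] at ha'
      exact ⟨c, e, hce, _, ha'⟩

end Algorithm

section Algorithm

open QuadricPair IsLocalRing

variable {O : Type*} [CommRing O] [IsDomain O] [IsDiscreteValuationRing O] {π : O}

theorem AtStepTwo.exists_step (hπ : Irreducible π) {Q : QuadricPair O}
    {l : Fin 3 → ResidueField O} (hQ : AtStepTwo Q l) :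
    ∃ (M : GL (Fin 2) O) (Q' : QuadricPair O), X 0 ∣ red (Q.linComb M.val 0) ∧
      C π * Q' 0 = scaleFirst π (Q.linComb M.val 0) ∧ Q' 1 = scaleFirst π (Q.linComb M.val 1) := by
  obtain ⟨hmod, β, q, lam, hq, hqc, hβ, hβ0, hl, hlin⟩ := hQ
  obtain ⟨b₀, hb₀⟩ := residue_surjective (β 0)
  obtain ⟨b₁, hb₁⟩ := residue_surjective (β 1)
  obtain ⟨M, hM0, hM1⟩ : ∃ M : GL (Fin 2) O, M.val 0 0 = b₁ ∧ M.val 0 1 = -b₀ := by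
    have hunit : ∀ (b : O) (i : Fin 2), residue O b = β i → β i ≠ 0 → IsUnit b := by
      intro b i hb hi
      by_contra h
      exact hi (by rw [← hb, residue_eq_zero_iff]; exact h)
    by_cases h : β 1 = 0
    · have h0 : β 0 ≠ 0 := fun h0 => hβ0 (by ext i; fin_cases i <;> simp [h, h0])
      have hu : IsUnit (!![b₁, -b₀; 1, 0] : Matrix (Fin 2) (Fin 2) O) := by
        rw [Matrix.isUnit_iff_isUnit_det, Matrix.det_fin_two_of]
        simpa using hunit b₀ 0 hb₀ h0
      exact ⟨hu.unit, by simp, by simp⟩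
    · have hu : IsUnit (!![b₁, -b₀; 0, 1] : Matrix (Fin 2) (Fin 2) O) := by
        rw [Matrix.isUnit_iff_isUnit_det, Matrix.det_fin_two_of]
        simpa using hunit b₁ 1 hb₁ h
      exact ⟨hu.unit, by simp, by simp⟩
  have hred : red (Q.linComb M.val 0) = X 0 * (C lam * X 0 + linForm l) := by
    rw [← hlin, QuadricPair.linComb, Fin.sum_univ_two, hM0, hM1, map_add, map_mul, map_mul, map_C,
      map_C, map_neg, hb₀, hb₁, C_neg]
    ring
  have hX : X 0 ∣ red (Q.linComb M.val 0) := hred ▸ dvd_mul_right _ _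
  have hdvd : C π ∣ scaleFirst π (Q.linComb M.val 0) := by
    rw [← red_eq_zero_iff hπ, red_scaleFirst hπ, constPart_eq_zero_of_dvd hX]
  obtain ⟨p, hp⟩ := hdvd
  exact ⟨M, ![p, scaleFirst π (Q.linComb M.val 1)], hX, by simp [hp], by simp⟩

theorem AtStepTwo.atStepThree {Q : QuadricPair O} {l : Fin 3 → ResidueField O}
    (h : AtStepTwo Q l) (M : GL (Fin 2) O) (hX : X 0 ∣ red (Q.linComb M.val 0)) {Q' : QuadricPair O}
    (hπ : Irreducible π) (h0 : C π * Q' 0 = scaleFirst π (Q.linComb M.val 0))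
    (h1 : Q' 1 = scaleFirst π (Q.linComb M.val 1)) :
    ∃ γ : ResidueField O, γ ≠ 0 ∧ AtStepThree Q' (γ • l) ∧
      ∀ n, VanishesNear π (n + 1) Q ↔ VanishesOnPlane π n Q' := by
  obtain ⟨γ, hγ, hA⟩ := h.afterTransformation M hX
  refine ⟨γ, hγ, hA.atStepThree hπ h0 h1, fun n => ?_⟩
  rw [← vanishesNear_linComb M, vanishesNear_succ_iff hπ hA h0 h1]

theorem vanishesOnPlane_zero (Q : QuadricPair O) : VanishesOnPlane π 0 Q :=
  ⟨![1, 0], ![1, 0], by simp, 0, by simp⟩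

theorem VanishesOnPlane.mono {m n : ℕ} (hmn : m ≤ n) {Q : QuadricPair O}
    (h : VanishesOnPlane π n Q) : VanishesOnPlane π m Q := by
  obtain ⟨c, e, hce, a, ha⟩ := h
  exact ⟨c, e, hce, a, (map_dvd C (pow_dvd_pow π hmn)).trans ha⟩

/-- Every run from the state `s` terminates with output `n`. -/
def Returns (π : O) (s : State O) (n : ℕ) : Prop :=
  Acc (fun t s : State O => Step π s t) s ∧
  ∀ u, Relation.ReflTransGen (Step π) s u → (∀ t, ¬ Step π u t) → u = .done n

theorem returns_of_step {s : State O} {n : ℕ} (hs : ∃ t, Step π s t)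
    (h : ∀ t, Step π s t → Returns π t n) : Returns π s n := by
  refine ⟨Acc.intro _ fun t ht => (h t ht).1, fun u hu hstuck => ?_⟩
  rcases hu.cases_head with rfl | ⟨t, hst, htu⟩
  · obtain ⟨t, ht⟩ := hs
    exact absurd ht (hstuck t)
  · exact (h t hst).2 u htu hstuck

theorem returns_done (n : ℕ) : Returns π (.done n) n := by
  have h : ∀ t, ¬ Step π (.done n) t := fun t ht => by cases ht
  refine ⟨Acc.intro _ fun t ht => absurd ht (h t), fun u hu _ => ?_⟩
  rcases hu.cases_head with rfl | ⟨t, hst, -⟩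
  · rfl
  · exact absurd hst (h t)

/-- If `N` is the largest exponent for which some primitive combination of the forms vanishes
modulo `π ^ N` on a plane reducing to `x₁ = 0`, the algorithm returns `N`. -/
theorem AtStepTwo.returns (hπ : Irreducible π) (N : ℕ) : ∀ (Q : QuadricPair O)
    (l : Fin 3 → ResidueField O), AtStepTwo Q l → VanishesNear π N Q → ¬ VanishesNear π (N + 1) Q →
    ∀ α, Returns π (.stepTwo Q α) (α + N) := by
  induction N with
  | zero =>
    intro Q l hQ _ hN
    obtain ⟨M, Q', hX, h0, h1⟩ := hQ.exists_step hπ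
    obtain ⟨γ, -, -, hiff⟩ := hQ.atStepThree M hX hπ h0 h1
    exact absurd ((hiff 0).2 (vanishesOnPlane_zero Q')) hN
  | succ N ih =>
    intro Q l hQ hN hN' α
    apply returns_of_step
    · obtain ⟨M, Q', hX, h0, h1⟩ := hQ.exists_step hπ
      exact ⟨_, Step.two Q Q' α M hX h0 h1⟩
    rintro _ (⟨_, Q', _, M, hX, h0, h1⟩)
    obtain ⟨γ, hγ, h3, hiff⟩ := hQ.atStepThree M hX hπ h0 h1
    rw [hiff] at hN hN'
    rw [← add_assoc, add_right_comm]
    rcases N with _ | N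
    · rw [zero_add, vanishesOnPlane_one_iff hπ h3] at hN'
      refine returns_of_step ⟨_, Step.threeReturn Q' (α + 1) hN'⟩ ?_
      rintro _ (_ | _ | _)
      · exact absurd ‹_› hN'
      · exact returns_done _
    · have hmem := (vanishesOnPlane_one_iff hπ h3).1 (hN.mono (by omega))
      obtain ⟨a, b, hab⟩ := h3.exists_congr hmem
      refine returns_of_step ⟨_, Step.threeLoop Q' (α + 1) a b hmem hab⟩ ?_
      rintro _ (_ | ⟨_, _, a, b, -, hab⟩ | ⟨_, _, hn⟩)
      · obtain ⟨h2, hv⟩ := h3.shear hπ a b hab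
        exact ih _ _ h2 ((hv N).1 hN) (fun h => hN' ((hv (N + 1)).2 h)) _
      · exact absurd hmem hn

end Algorithm

open QuadricPair

section Normal

variable {k : Type*} [CommRing k]

/-- The matrix of `x₁ (u x₂ + w x₄) + r x₃² + s x₃ x₄ + t x₄²`. -/
def normalMatrix₁ (u w r s t : k) : Matrix (Fin 4) (Fin 4) k :=
  !![0, u, 0, w; 0, 0, 0, 0; 0, 0, r, s; 0, 0, 0, t]

/-- The matrix of `x₂ x₄ + ρ x₃² + σ x₃ x₄`. -/
def normalMatrix₂ (ρ σ : k) : Matrix (Fin 4) (Fin 4) k :=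
  !![0, 0, 0, 0; 0, 0, 0, 1; 0, 0, ρ, σ; 0, 0, 0, 0]

theorem F4I_G4I_normal (u w r s t ρ σ : k) :
    F4I (normalMatrix₁ u w r s t) (normalMatrix₂ ρ σ) ![0, 1, 0, 0] =
      u ^ 10 * ρ ^ 2 * (ρ * s - r * σ) ^ 2 ∧
    G4I (normalMatrix₁ u w r s t) (normalMatrix₂ ρ σ) ![0, 1, 0, 0] =
      u ^ 10 * ρ ^ 4 * ((w * r + u * ρ * t) ^ 2 + (r * σ - ρ * s) * (u * s * w + u ^ 2 * σ * t)) := by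
  have i0 : Finset.Ici (0 : Fin 4) = {0, 1, 2, 3} := by decide
  have i1 : Finset.Ici (1 : Fin 4) = {1, 2, 3} := by decide
  have i2 : Finset.Ici (2 : Fin 4) = {2, 3} := by decide
  have i3 : Finset.Ici (3 : Fin 4) = {3} := by decide
  have h1 : TI (normalMatrix₁ u w r s t) (normalMatrix₂ ρ σ) ![0, 1, 0, 0] = ρ * u ^ 2 := by
    simp [normalMatrix₁, normalMatrix₂, TI, dualI, halfAdj, hess, Fin.sum_univ_four, i0, i1, i2, i3,
      Matrix.adjugate_fin_succ_eq_det_submatrix, Matrix.det_fin_three, Fin.succAbove]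
    ring
  have h2 : TI (normalMatrix₂ ρ σ) (normalMatrix₁ u w r s t) ![0, 1, 0, 0] = r * u ^ 2 := by
    simp [normalMatrix₁, normalMatrix₂, TI, dualI, halfAdj, hess, Fin.sum_univ_four, i0, i1, i2, i3,
      Matrix.adjugate_fin_succ_eq_det_submatrix, Matrix.det_fin_three, Fin.succAbove]
  obtain ⟨ha, hb, hc, hd, he⟩ := doublingI_rd (normalMatrix₁ u w r s t) (normalMatrix₂ ρ σ)
  rw [F4I, G4I, h1, h2, GenBinaryQuartic.F₂, GenBinaryQuartic.G₂, ha, hb, hc, hd, he, doublingI_l,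
    doublingI_m, doublingI_n]
  simp only [rdCoeff, prodCoeff, pfPolar, hess, pf, normalMatrix₁, normalMatrix₂]
  simp
  constructor <;> ring

end Normal

open Matrix in
/-- The transformation behaviour under `GL₄` over an arbitrary ring, by reduction to the generic
case. -/
theorem F4I_G4I_transform {R : Type*} [CommRing R] (N U V : Matrix (Fin 4) (Fin 4) R)
    (x : Fin 4 → R) : F4I (Nᵀ * U * N) (Nᵀ * V * N) x = N.det ^ 10 * F4I U V (N *ᵥ x) ∧
      ∃ r, G4I (Nᵀ * U * N) (Nᵀ * V * N) x =
        N.det ^ 12 * G4I U V (N *ᵥ x) + r * F4I U V (N *ᵥ x) := by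
  let φ : MvPolynomial R ℤ →+* R := eval₂Hom (Int.castRingHom R) id
  let lift (A : Matrix (Fin 4) (Fin 4) R) : Matrix (Fin 4) (Fin 4) (MvPolynomial R ℤ) := A.map X
  have hlift : ∀ A : Matrix (Fin 4) (Fin 4) R, (lift A).map φ = A := fun A => by
    ext i j; simp [lift, φ]
  have hx : (fun i => φ (X (x i))) = x := by ext i; simp [φ]
  have hNx : (fun i => φ ((lift N *ᵥ fun i => X (x i)) i)) = N *ᵥ x := by
    ext i
    simp [φ, lift, mulVec, dotProduct]
  have hmul : ∀ A : Matrix (Fin 4) (Fin 4) R, ((lift N)ᵀ * lift A * lift N).map φ = Nᵀ * A * N := by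
    intro A
    have ht : (lift N)ᵀ.map φ = Nᵀ := by rw [← Matrix.transpose_map, hlift]
    rw [Matrix.map_mul, Matrix.map_mul, ht, hlift, hlift]
  have hdet : φ (lift N).det = N.det := by
    rw [RingHom.map_det, RingHom.mapMatrix_apply, hlift]
  obtain ⟨hF, r, hG⟩ := F4I_G4I_mul (lift N) (lift U) (lift V) (fun i => X (x i))
  have hF := congrArg φ hF
  have hG := congrArg φ hG
  simp only [map_add, map_mul, map_pow, ← F4I_map, ← G4I_map, hmul, hlift, hx, hNx, hdet] at hF hG
  exact ⟨hF, φ r, hG⟩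

theorem exists_splitting_of_isAlgClosed {F : Type*} [Field F] [IsAlgClosed F] (A B D : F) :
    ∃ a b c d : F, A = a * c ∧ B = a * d + b * c ∧ D = b * d := by
  by_cases hA : A = 0
  · exact ⟨0, 1, B, D, by simp [hA], by simp, by simp⟩
  · obtain ⟨τ, hτ⟩ := IsAlgClosed.exists_root
      (Polynomial.C A * Polynomial.X ^ 2 + Polynomial.C B * Polynomial.X + Polynomial.C D)
      (by rw [Polynomial.degree_quadratic hA]; decide)
    simp [Polynomial.IsRoot] at hτ
    exact ⟨1, -τ, A, B + A * τ, by ring, by ring, by linear_combination hτ⟩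

section Basis

open Matrix

variable {k : Type*} [Field k]

theorem isUnit_det_of_mulVec_injective {N : Matrix (Fin 4) (Fin 4) k}
    (h : ∀ z, N *ᵥ z = 0 → z = 0) : IsUnit N.det := by
  rw [isUnit_iff_ne_zero]
  intro h0
  obtain ⟨v, hv, hv0⟩ := Matrix.exists_mulVec_eq_zero_iff.2 h0
  exact hv (h v hv0)

theorem transpose_mul_mul_apply {R : Type*} [CommRing R] (n : Fin 4 → Fin 4 → R)
    (U : Matrix (Fin 4) (Fin 4) R) (i j : Fin 4) :
    ((Matrix.of n) * U * (Matrix.of n)ᵀ) i j = n i ⬝ᵥ U *ᵥ n j := by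
  simp only [Matrix.mul_apply, dotProduct, mulVec, Matrix.transpose_apply, Matrix.of_apply,
    Finset.mul_sum, Finset.sum_mul]
  rw [Finset.sum_comm]
  exact Finset.sum_congr rfl fun i _ => Finset.sum_congr rfl fun j _ => by ring

theorem transpose_of_mulVec {R : Type*} [CommRing R] (n : Fin 4 → Fin 4 → R) (z : Fin 4 → R) :
    (Matrix.of n)ᵀ *ᵥ z = ∑ i, z i • n i := by
  ext j
  simp [mulVec, dotProduct, mul_comm]

theorem form_eq_of_hess {R : Type*} [CommRing R] {U V : Matrix (Fin 4) (Fin 4) R}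
    (hd : ∀ i, U i i = V i i) (h : ∀ i j, i < j → hess U i j = hess V i j) : form U = form V := by
  have h01 := h 0 1 (by decide)
  have h02 := h 0 2 (by decide)
  have h03 := h 0 3 (by decide)
  have h12 := h 1 2 (by decide)
  have h13 := h 1 3 (by decide)
  have h23 := h 2 3 (by decide)
  simp only [hess_apply] at *
  have key : ∀ U : Matrix (Fin 4) (Fin 4) R, form U = C (U 0 0) * X 0 ^ 2 + C (U 1 1) * X 1 ^ 2
      + C (U 2 2) * X 2 ^ 2 + C (U 3 3) * X 3 ^ 2 + C (U 0 1 + U 1 0) * (X 0 * X 1)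
      + C (U 0 2 + U 2 0) * (X 0 * X 2) + C (U 0 3 + U 3 0) * (X 0 * X 3)
      + C (U 1 2 + U 2 1) * (X 1 * X 2) + C (U 1 3 + U 3 1) * (X 1 * X 3)
      + C (U 2 3 + U 3 2) * (X 2 * X 3) := by
    intro U
    simp only [form, Fin.sum_univ_four, C_add]
    ring
  rw [key U, key V, hd, hd, hd, hd, h01, h02, h03, h12, h13, h23]

/-- The value of `xᵀ U x` and of its polarisation determine the transformed form. -/
theorem subst_form_eq {R : Type*} [CommRing R] {n : Fin 4 → Fin 4 → R}
    {U V : Matrix (Fin 4) (Fin 4) R} (hd : ∀ i, n i ⬝ᵥ U *ᵥ n i = V i i)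
    (h : ∀ i j, i < j → n i ⬝ᵥ hess U *ᵥ n j = hess V i j) :
    subst (Matrix.of n)ᵀ (form U) = form V := by
  rw [subst_form]
  refine form_eq_of_hess (fun i => ?_) fun i j hij => ?_
  · rw [Matrix.transpose_transpose, transpose_mul_mul_apply, hd]
  · rw [← h i j hij, hess_apply, Matrix.transpose_transpose, transpose_mul_mul_apply,
      transpose_mul_mul_apply, hess, Matrix.add_mulVec, dotProduct_add, Matrix.mulVec_transpose,
      dotProduct_comm (n i) (n j ᵥ* U), Matrix.dotProduct_mulVec (n j)]

theorem subst_injective {R : Type*} [CommRing R] {N : Matrix (Fin 4) (Fin 4) R} (hN : IsUnit N.det) :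
    Function.Injective (subst N) := by
  intro p q h
  have := congrArg (subst N⁻¹) h
  rwa [subst_subst, subst_subst, Matrix.mul_nonsing_inv _ hN, subst_one, subst_one] at this

theorem GeomIrred.subst {q : MvPolynomial (Fin 4) k} (hq : GeomIrred q) {N : Matrix (Fin 4) (Fin 4) k}
    (hN : IsUnit N.det) : GeomIrred (subst N q) := by
  intro f g hf hg h
  set φ := algebraMap k (AlgebraicClosure k)
  have hN' : IsUnit (N.map φ).det := by
    rw [← RingHom.mapMatrix_apply, ← RingHom.map_det]; exact hN.map φ
  apply hq (GenusOne.subst (N.map φ)⁻¹ f) (GenusOne.subst (N.map φ)⁻¹ g)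
    (subst_isHomogeneous hf _) (subst_isHomogeneous hg _)
  rw [← map_mul, ← h, map_subst, subst_subst, Matrix.mul_nonsing_inv _ hN', subst_one]

/-- A quadratic form involving only two of the variables splits over an algebraic closure. -/
theorem not_geomIrred_binary (A B D : k) (i j : Fin 4) :
    ¬ GeomIrred (C A * X i ^ 2 + C B * (X i * X j) + C D * X j ^ 2) := by
  intro h
  set φ := algebraMap k (AlgebraicClosure k)
  obtain ⟨a, b, c, d, hA, hB, hD⟩ := exists_splitting_of_isAlgClosed (φ A) (φ B) (φ D)
  have hom : ∀ a b : AlgebraicClosure k,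
      (C a * X i + C b * X j : MvPolynomial (Fin 4) (AlgebraicClosure k)).IsHomogeneous 1 := by
    intro a b
    exact (isHomogeneous_C_mul_X _ _).add (isHomogeneous_C_mul_X _ _)
  refine h (C a * X i + C b * X j) (C c * X i + C d * X j) (hom _ _) (hom _ _) ?_
  simp only [map_add, map_mul, map_pow, map_C, map_X]
  rw [hA, hB, hD]
  simp only [map_add, map_mul]
  ring

theorem hess_mulVec_ne_zero {V : Matrix (Fin 4) (Fin 4) k} (hV : GeomIrred (form V))
    (h00 : V 0 0 = 0) (h0 : ∀ j, hess V 0 j = 0) {y : Fin 4 → k} (hy : ∃ j : Fin 3, y j.succ ≠ 0)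
    (hVy : y ⬝ᵥ V *ᵥ y = 0) : hess V *ᵥ y ≠ 0 := by
  intro hzero
  obtain ⟨j, hj⟩ := hy
  set n : Fin 4 → Fin 4 → k := ![Pi.single 0 1, y, Pi.single (j + 1).succ 1, Pi.single (j + 2).succ 1]
    with hn
  have hunit : IsUnit (Matrix.of n)ᵀ.det := by
    refine isUnit_det_of_mulVec_injective fun z hz => ?_
    rw [transpose_of_mulVec, Fin.sum_univ_four] at hz
    have e := fun i => congrFun hz i
    simp only [hn, Pi.add_apply, Pi.smul_apply, smul_eq_mul, Matrix.cons_val_zero, Matrix.cons_val_one,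
      Matrix.cons_val, Pi.zero_apply] at e
    have e1 : z 1 = 0 := by
      have : z 1 * y j.succ = 0 := by
        have := e j.succ
        fin_cases j <;> simpa [Pi.single_apply] using this
      exact (mul_eq_zero.1 this).resolve_right hj
    have e0 := e 0
    have e2 := e (j + 1).succ
    have e3 := e (j + 2).succ
    ext i
    fin_cases i
    · simpa [e1] using e0
    · exact e1
    · fin_cases j <;> simpa [e1] using e2
    · fin_cases j <;> simpa [e1] using e3
  have hsym : ∀ x z, x ⬝ᵥ hess V *ᵥ z = z ⬝ᵥ hess V *ᵥ x := by
    intro x z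
    rw [Matrix.dotProduct_mulVec, ← Matrix.mulVec_transpose, hess_transpose, dotProduct_comm]
  have hrow : ∀ z, (Pi.single 0 1 : Fin 4 → k) ⬝ᵥ hess V *ᵥ z = 0 := by
    intro z
    rw [single_one_dotProduct]
    simp [mulVec, dotProduct, h0]
  refine not_geomIrred_binary (n 2 ⬝ᵥ V *ᵥ n 2) (n 2 ⬝ᵥ hess V *ᵥ n 3) (n 3 ⬝ᵥ V *ᵥ n 3) 2 3 ?_
  convert hV.subst hunit
  rw [subst_form_eq (V := !![0, 0, 0, 0; 0, 0, 0, 0; 0, 0, n 2 ⬝ᵥ V *ᵥ n 2, n 2 ⬝ᵥ hess V *ᵥ n 3;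
    0, 0, 0, n 3 ⬝ᵥ V *ᵥ n 3])]
  · simp [form, Fin.sum_univ_four]
    ring
  · intro i
    fin_cases i
    · simp [hn, h00]
    · simpa [hn] using hVy
    · simp
    · simp
  · intro i l hil
    fin_cases i <;> fin_cases l <;> first | exact absurd hil (by decide) | skip
    · exact (hrow _).trans (by simp [hess_apply])
    · exact (hrow _).trans (by simp [hess_apply])
    · exact (hrow _).trans (by simp [hess_apply])
    · change y ⬝ᵥ _ = _
      rw [hsym, hzero]; simp [hess_apply]
    · change y ⬝ᵥ _ = _
      rw [hsym, hzero]; simp [hess_apply]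
    · simp [hess_apply]

theorem subst_sum {R : Type*} [CommRing R] (N : Matrix (Fin 4) (Fin 4) R) (c : Fin 4 → R) :
    subst N (∑ i, C (c i) * X i) = ∑ j, C ((c ᵥ* N) j) * X j := by
  simp only [subst, map_sum, map_mul, bind₁_C_right, bind₁_X_right, vecMul, dotProduct,
    Finset.mul_sum, Finset.sum_mul]
  rw [Finset.sum_comm]
  simp only [mul_assoc]

theorem dotProduct_hess_comm {R : Type*} [CommRing R] (U : Matrix (Fin 4) (Fin 4) R)
    (x z : Fin 4 → R) : x ⬝ᵥ hess U *ᵥ z = z ⬝ᵥ hess U *ᵥ x := by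
  rw [Matrix.dotProduct_mulVec, ← Matrix.mulVec_transpose, hess_transpose, dotProduct_comm]

theorem dotProduct_mulVec_add_smul {R : Type*} [CommRing R] (U : Matrix (Fin 4) (Fin 4) R)
    (x z : Fin 4 → R) (c : R) : (x + c • z) ⬝ᵥ U *ᵥ (x + c • z) =
      x ⬝ᵥ U *ᵥ x + c * (x ⬝ᵥ hess U *ᵥ z) + c ^ 2 * (z ⬝ᵥ U *ᵥ z) := by
  have : x ⬝ᵥ hess U *ᵥ z = x ⬝ᵥ U *ᵥ z + z ⬝ᵥ U *ᵥ x := by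
    rw [hess, Matrix.add_mulVec, dotProduct_add, Matrix.mulVec_transpose,
      dotProduct_comm x (z ᵥ* U), ← Matrix.dotProduct_mulVec]
  rw [this]
  simp only [Matrix.mulVec_add, Matrix.mulVec_smul, add_dotProduct, dotProduct_add, smul_dotProduct,
    dotProduct_smul, smul_eq_mul]
  ring

theorem covariants_ne_zero {U V : Matrix (Fin 4) (Fin 4) k} (hU00 : U 0 0 = 0) (hV00 : V 0 0 = 0)
    (hV0 : ∀ j, hess V 0 j = 0) (hV : GeomIrred (form V)) {y : Fin 4 → k}
    (hUy : y ⬝ᵥ U *ᵥ y = 0) (hVy : y ⬝ᵥ V *ᵥ y = 0) (hl : (hess U *ᵥ y) 0 ≠ 0)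
    (hmem : constPart (form U) ∉ Ideal.span {linForm (linCoeff U), form V}) :
    F4I U V y ≠ 0 ∨ G4I U V y ≠ 0 := by
  by_contra! hFG
  set e : Fin 4 → k := Pi.single 0 1 with he
  have hU0 : hess U 0 0 = 0 := by simp [hess_apply, hU00]
  have heU : ∀ z, e ⬝ᵥ hess U *ᵥ z = (hess U *ᵥ z) 0 := fun z => by simp [he]
  have heV : ∀ z, e ⬝ᵥ hess V *ᵥ z = 0 := fun z => by
    rw [he, single_one_dotProduct]
    simp [mulVec, dotProduct, hV0]
  have heU' : ∀ z, z ⬝ᵥ hess U *ᵥ e = (hess U *ᵥ z) 0 := fun z => by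
    rw [dotProduct_hess_comm, heU]
  have heV' : ∀ z, z ⬝ᵥ hess V *ᵥ e = 0 := fun z => by rw [dotProduct_hess_comm, heV]
  have hqU : e ⬝ᵥ U *ᵥ e = 0 := by simp [he, hU00]
  have hqV : e ⬝ᵥ V *ᵥ e = 0 := by simp [he, hV00]
  have hbV : y ⬝ᵥ hess V *ᵥ y = 0 := by rw [dotProduct_hess, eval_form, hVy, mul_zero]
  have hbUe : (hess U *ᵥ e) 0 = 0 := by simp [he, hU0]
  have hφ : hess V *ᵥ y ≠ 0 := by
    refine hess_mulVec_ne_zero hV hV00 hV0 ?_ hVy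
    by_contra! h
    exact hl (by simp [mulVec, dotProduct, Fin.sum_univ_succ, hU0, h])
  obtain ⟨v, hv, hv0, hφv, hlv⟩ : ∃ v : Fin 4 → k, v ≠ 0 ∧ v 0 = 0 ∧ y ⬝ᵥ hess V *ᵥ v = 0 ∧
      (hess U *ᵥ v) 0 = 0 := by
    obtain ⟨v, hv, h⟩ := Matrix.exists_mulVec_eq_zero_iff.2
      (Matrix.det_eq_zero_of_row_eq_zero (A := Matrix.of ![e, hess V *ᵥ y, hess U 0, 0]) 3
        (by simp))
    have h := fun i => congrFun h i
    refine ⟨v, hv, by simpa [mulVec, he] using h 0, ?_, by simpa [mulVec] using h 2⟩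
    rw [dotProduct_hess_comm, dotProduct_comm]
    exact h 1
  obtain ⟨m, hφm, hqm⟩ : ∃ m : Fin 4 → k, m ⬝ᵥ hess V *ᵥ y = 1 ∧ m ⬝ᵥ V *ᵥ m = 0 := by
    obtain ⟨j, hj⟩ := Function.ne_iff.1 hφ
    have h1 : (Pi.single j ((hess V *ᵥ y) j)⁻¹ : Fin 4 → k) ⬝ᵥ hess V *ᵥ y = 1 := by
      rw [single_dotProduct, inv_mul_cancel₀ hj]
    set m : Fin 4 → k := Pi.single j ((hess V *ᵥ y) j)⁻¹
    refine ⟨m + (-(m ⬝ᵥ V *ᵥ m)) • y, ?_, ?_⟩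
    · rw [add_dotProduct, smul_dotProduct, hbV, h1, smul_zero, add_zero]
    · rw [dotProduct_mulVec_add_smul, h1, hVy]; ring
  set c₂ : k := -(y ⬝ᵥ hess U *ᵥ v) / (hess U *ᵥ y) 0
  set c₃ : k := -(y ⬝ᵥ hess U *ᵥ m) / (hess U *ᵥ y) 0
  have hc₂ : y ⬝ᵥ hess U *ᵥ v + c₂ * (hess U *ᵥ y) 0 = 0 := by simp only [c₂]; field_simp; ring
  have hc₃ : y ⬝ᵥ hess U *ᵥ m + c₃ * (hess U *ᵥ y) 0 = 0 := by simp only [c₃]; field_simp; ring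
  set n : Fin 4 → Fin 4 → k := ![e, y, v + c₂ • e, m + c₃ • e] with hn
  have hunit : IsUnit (Matrix.of n)ᵀ.det := by
    refine isUnit_det_of_mulVec_injective fun z hz => ?_
    rw [transpose_of_mulVec, Fin.sum_univ_four] at hz
    simp only [hn, Matrix.cons_val_zero, Matrix.cons_val_one, Matrix.cons_val] at hz
    have hz3 : z 3 = 0 := by
      have := congrArg (fun x => x ⬝ᵥ hess V *ᵥ y) hz
      have hvy : v ⬝ᵥ hess V *ᵥ y = 0 := by rw [dotProduct_hess_comm, hφv]
      simpa [add_dotProduct, heV, hbV, hvy, hφm] using this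
    have hz1 : z 1 = 0 := by
      have := congrFun (congrArg (fun x => hess U *ᵥ x) hz) 0
      simpa [Matrix.mulVec_add, Matrix.mulVec_smul, hbUe, hlv, hz3, hl] using this
    obtain ⟨i, hi⟩ := Function.ne_iff.1 hv
    have hi0 : i ≠ 0 := by rintro rfl; exact hi hv0
    have hz2 : z 2 = 0 := by
      have := congrFun hz i
      simpa [hz1, hz3, he, hi0, show v i ≠ 0 from hi] using this
    have hz0 : z 0 = 0 := by
      have := congrFun hz 0
      simpa [hz1, hz2, hz3, he] using this
    ext i
    fin_cases i <;> assumption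
  set u := (hess U *ᵥ y) 0 with hu
  set w := (hess U *ᵥ m) 0 with hw
  set r := (v + c₂ • e) ⬝ᵥ U *ᵥ (v + c₂ • e) with hr
  set s := (v + c₂ • e) ⬝ᵥ hess U *ᵥ (m + c₃ • e) with hs
  set t := (m + c₃ • e) ⬝ᵥ U *ᵥ (m + c₃ • e) with ht
  set ρ := (v + c₂ • e) ⬝ᵥ V *ᵥ (v + c₂ • e) with hρ
  set σ := (v + c₂ • e) ⬝ᵥ hess V *ᵥ (m + c₃ • e) with hσ
  have hsU : subst (Matrix.of n)ᵀ (form U) = form (normalMatrix₁ u w r s t) := by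
    refine subst_form_eq (fun i => ?_) fun i j hij => ?_
    · fin_cases i
      · exact hqU
      · exact hUy
      · rfl
      · rfl
    · fin_cases i <;> fin_cases j <;> first | exact absurd hij (by decide) | skip
      · exact (heU y).trans (by simp [hess_apply, normalMatrix₁, hu])
      · refine (heU (v + c₂ • e)).trans ?_
        simp [hess_apply, normalMatrix₁, Matrix.mulVec_add, Matrix.mulVec_smul, hlv, hbUe]
      · refine (heU (m + c₃ • e)).trans ?_
        simp [hess_apply, normalMatrix₁, Matrix.mulVec_add, Matrix.mulVec_smul, hbUe, hw]
      · change y ⬝ᵥ hess U *ᵥ (v + c₂ • e) = _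
        rw [Matrix.mulVec_add, Matrix.mulVec_smul, dotProduct_add, dotProduct_smul, heU', smul_eq_mul,
          hc₂]
        simp [hess_apply, normalMatrix₁]
      · change y ⬝ᵥ hess U *ᵥ (m + c₃ • e) = _
        rw [Matrix.mulVec_add, Matrix.mulVec_smul, dotProduct_add, dotProduct_smul, heU', smul_eq_mul,
          hc₃]
        simp [hess_apply, normalMatrix₁]
      · exact hs.symm.trans (by simp [hess_apply, normalMatrix₁])
  have hsV : subst (Matrix.of n)ᵀ (form V) = form (normalMatrix₂ ρ σ) := by
    refine subst_form_eq (fun i => ?_) fun i j hij => ?_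
    · fin_cases i
      · exact hqV
      · exact hVy
      · rfl
      · change (m + c₃ • e) ⬝ᵥ V *ᵥ (m + c₃ • e) = _
        rw [dotProduct_mulVec_add_smul, hqm, heV', hqV]
        simp [normalMatrix₂]
    · fin_cases i <;> fin_cases j <;> first | exact absurd hij (by decide) | skip
      · exact (heV _).trans (by simp [hess_apply, normalMatrix₂])
      · exact (heV _).trans (by simp [hess_apply, normalMatrix₂])
      · exact (heV _).trans (by simp [hess_apply, normalMatrix₂])
      · change y ⬝ᵥ hess V *ᵥ (v + c₂ • e) = _
        rw [Matrix.mulVec_add, Matrix.mulVec_smul, dotProduct_add, dotProduct_smul, heV', hφv]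
        simp [hess_apply, normalMatrix₂]
      · change y ⬝ᵥ hess V *ᵥ (m + c₃ • e) = _
        rw [Matrix.mulVec_add, Matrix.mulVec_smul, dotProduct_add, dotProduct_smul, heV',
          dotProduct_hess_comm, hφm]
        simp [hess_apply, normalMatrix₂]
      · exact hσ.symm.trans (by simp [hess_apply, normalMatrix₂])
  clear_value u w r s t ρ σ
  have hpoint : (Matrix.of n)ᵀ *ᵥ ![0, 1, 0, 0] = y := by
    rw [transpose_of_mulVec, Fin.sum_univ_four]; simp [hn]
  obtain ⟨hF, hG⟩ : F4I (normalMatrix₁ u w r s t) (normalMatrix₂ ρ σ) ![0, 1, 0, 0] = 0 ∧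
      G4I (normalMatrix₁ u w r s t) (normalMatrix₂ ρ σ) ![0, 1, 0, 0] = 0 := by
    obtain ⟨h1, r', h2⟩ := F4I_G4I_transform (Matrix.of n)ᵀ U V ![0, 1, 0, 0]
    rw [subst_form] at hsU hsV
    obtain ⟨h3, h4⟩ := F4I_congr hsU hsV ![0, 1, 0, 0]
    rw [← h3, ← h4, h1, h2, hpoint, hFG.1, hFG.2]
    simp
  rw [(F4I_G4I_normal ..).1] at hF
  rw [(F4I_G4I_normal ..).2] at hG
  have hρ0 : ρ ≠ 0 := by
    rintro rfl
    refine (hV.subst hunit).ne_mul (f := X 3) (g := C 1 * X 1 + C σ * X 2) (isHomogeneous_X _ _)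
      ((isHomogeneous_C_mul_X _ _).add (isHomogeneous_C_mul_X _ _)) ?_
    rw [hsV]
    simp [form, Fin.sum_univ_four, normalMatrix₂]
    ring
  have h1 : ρ * s - r * σ = 0 := by simpa [hl, hρ0] using hF
  have h2 : w * r + u * ρ * t = 0 := by
    rw [show r * σ - ρ * s = 0 by linear_combination -h1] at hG
    simpa [hl, hρ0] using hG
  apply hmem
  have hlin : subst (Matrix.of n)ᵀ (linForm (linCoeff U)) = C u * X 1 + C w * X 3 := by
    have h := subst_sum (Matrix.of n)ᵀ (hess U 0)
    rw [Fin.sum_univ_succ, hU0, C_0, zero_mul, zero_add] at h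
    refine h.trans ?_
    have hval : ∀ j, (hess U 0 ᵥ* (Matrix.of n)ᵀ) j = (hess U *ᵥ n j) 0 := fun j => by
      rw [Matrix.vecMul_transpose, mulVec, dotProduct_comm]; rfl
    simp only [hval, Fin.sum_univ_four]
    have hn2 : (hess U *ᵥ n 2) 0 = 0 := by
      change (hess U *ᵥ (v + c₂ • e)) 0 = 0
      simp [Matrix.mulVec_add, Matrix.mulVec_smul, hlv, hbUe]
    have hn3 : (hess U *ᵥ n 3) 0 = w := by
      change (hess U *ᵥ (m + c₃ • e)) 0 = w
      simp [Matrix.mulVec_add, Matrix.mulVec_smul, hw, hbUe]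
    have hn0 : (hess U *ᵥ n 0) 0 = 0 := hbUe
    have hn1 : (hess U *ᵥ n 1) 0 = u := hu.symm
    rw [hn0, hn1, hn2, hn3]
    simp
  have hkey : subst (Matrix.of n)ᵀ (form U) =
      (X 0 - C (r / (u * ρ)) * X 3) * subst (Matrix.of n)ᵀ (linForm (linCoeff U))
        + C (r / ρ) * subst (Matrix.of n)ᵀ (form V) := by
    have e1 : (C (r / ρ) * C ρ : MvPolynomial (Fin 4) k) = C r := by
      rw [← C_mul, div_mul_cancel₀ _ hρ0]
    have e2 : (C (r / (u * ρ)) * C u : MvPolynomial (Fin 4) k) = C (r / ρ) := by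
      rw [← C_mul]; congr 1; field_simp
    have e3 : (C t : MvPolynomial (Fin 4) k) = -(C (r / (u * ρ)) * C w) := by
      rw [← C_mul, ← C_neg]; congr 1; field_simp; linear_combination h2
    have e4 : (C s : MvPolynomial (Fin 4) k) = C (r / ρ) * C σ := by
      rw [← C_mul]; congr 1; field_simp; linear_combination h1
    have f1 : form (normalMatrix₁ u w r s t) = X 0 * (C u * X 1 + C w * X 3) + C r * X 2 ^ 2
        + C s * (X 2 * X 3) + C t * X 3 ^ 2 := by
      simp only [form, Fin.sum_univ_four, normalMatrix₁]
      simp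
      ring
    have f2 : form (normalMatrix₂ ρ σ) = X 1 * X 3 + C ρ * X 2 ^ 2 + C σ * (X 2 * X 3) := by
      simp only [form, Fin.sum_univ_four, normalMatrix₂]
      simp
      ring
    rw [hsU, hsV, hlin, f1, f2, e3, e4]
    linear_combination (-X 2 ^ 2) * e1 + X 1 * X 3 * e2
  have h := congrArg (fun p => constPart (subst (Matrix.of n)ᵀ⁻¹ p)) hkey
  have hinv : ∀ p, subst (Matrix.of n)ᵀ⁻¹ (subst (Matrix.of n)ᵀ p) = p := fun p => by
    rw [subst_subst, Matrix.mul_nonsing_inv _ hunit, subst_one]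
  have hVc : constPart (form V) = form V := by
    conv_rhs => rw [form_decomp, hV00]
    have : linCoeff V = 0 := funext fun j => hV0 j.succ
    rw [this, linForm_zero]; simp
  simp only [map_add, map_mul, hinv, constPart_add, constPart_mul, hVc, constPart_linForm] at h
  rw [h]
  exact Ideal.add_mem _ (Ideal.mul_mem_left _ _ (Ideal.subset_span (by simp)))
    (Ideal.mul_mem_left _ _ (Ideal.subset_span (by simp)))

end Basis

section Terminal

open IsLocalRing Matrix

variable {O : Type*} [CommRing O] [IsDomain O] [CharZero O] [IsDiscreteValuationRing O] {π : O}

theorem AtStepThree.covariantIdeal_eq_top (hπ : Irreducible π) {Q : QuadricPair O}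
    {l : Fin 3 → ResidueField O} (hQ : AtStepThree Q l) (hnot : ¬ VanishesOnPlane π 1 Q)
    {u : Fin 4 → O} (hu : Q.IsZero u) (hl : ∑ j : Fin 3, l j * residue O (u j.succ) ≠ 0) :
    Q.covariantIdeal u = ⊤ := by
  rw [vanishesOnPlane_one_iff hπ hQ] at hnot
  obtain ⟨hlin, h0, h1, hirr⟩ := hQ.red_eq
  have e0 := form_coeffMatrix (hQ.1 0)
  have e1 := form_coeffMatrix (hQ.1 1)
  rw [covariantIdeal_eq e0.symm e1.symm]
  rw [h1.symm] at hirr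
  have hu0 := hu 0
  have hu1 := hu 1
  rw [← e0] at hlin h0 hnot hu0
  rw [← e1] at h1 hirr hnot hu1
  generalize coeffMatrix (Q 0) = U at *
  generalize coeffMatrix (Q 1) = V at *
  rw [linPart_form, map_linForm] at hlin
  have hlin : linCoeff (U.map (residue O)) = l := by
    rw [← linForm_injective hlin]
    ext j; simp [linCoeff, hess_map]
  rw [map_constPart, map_form] at h0 h1
  have hU00 : U.map (residue O) 0 0 = 0 := by
    have h := form_decomp (U.map (residue O))
    rw [hlin, add_assoc, ← h0, right_eq_add] at h
    simpa using congrArg (eval (Pi.single 0 1)) h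
  have hV : C (V.map (residue O) 0 0) * X 0 + linForm (linCoeff (V.map (residue O))) = 0 := by
    have h := form_decomp (V.map (residue O))
    rw [← h1, right_eq_add, show C (V.map (residue O) 0 0) * X 0 ^ 2 + X 0 *
      linForm (linCoeff (V.map (residue O))) = X 0 * (C (V.map (residue O) 0 0) * X 0 +
        linForm (linCoeff (V.map (residue O)))) by ring] at h
    exact (mul_eq_zero.1 h).resolve_left (X_ne_zero 0)
  have hVlin : linCoeff (V.map (residue O)) = 0 := by
    have h := congrArg constPart hV
    rw [constPart_add, constPart_mul, constPart_X_zero, mul_zero, zero_add, constPart_linForm] at h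
    apply linForm_injective
    rw [h, linForm_zero]
    simp [constPart]
  have hV00 : V.map (residue O) 0 0 = 0 := by
    rw [hVlin, linForm_zero, add_zero] at hV
    simpa using congrArg (eval (Pi.single 0 1)) hV
  have hzero : ∀ W : Matrix (Fin 4) (Fin 4) O, eval u (form W) = 0 →
      (fun i => residue O (u i)) ⬝ᵥ W.map (residue O) *ᵥ (fun i => residue O (u i)) = 0 := by
    intro W hW
    rw [← eval_form, ← map_form]
    have := congrArg (residue O) hW
    rw [map_zero] at this
    rw [← this]
    exact (MvPolynomial.eval_map _ _ _).trans (MvPolynomial.eval₂_comp _ _ _).symm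
  have key := covariants_ne_zero hU00 hV00 (fun j => by
      refine Fin.cases ?_ (fun i => congrFun hVlin i) j
      rw [hess_apply, hV00, add_zero]) (by rwa [map_form] at hirr) (hzero U hu0) (hzero V hu1) (by
      rw [mulVec, dotProduct, Fin.sum_univ_succ, hess_apply _ 0 0, hU00, add_zero, zero_mul, zero_add]
      rwa [← hlin] at hl) (by
      have hl2 : (fun i => residue O (linCoeff U i)) = linCoeff (U.map (residue O)) := by
        ext j; simp [linCoeff, hess_map]
      rwa [linPart_form, map_linForm, map_constPart, map_constPart, map_form, map_form, ← h1,
        hl2] at hnot)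
  rw [F4I_map, G4I_map] at key
  rw [covIdeal, Ideal.eq_top_iff_one]
  have hunit : IsUnit (F4I U V u) ∨ IsUnit (G4I U V u) := by
    refine key.imp (fun h => ?_) fun h => ?_
    · exact (residue_ne_zero_iff_isUnit _).1 h
    · exact (residue_ne_zero_iff_isUnit _).1 h
  rcases hunit with h | h
  · rw [Ideal.eq_top_of_isUnit_mem _ (Ideal.subset_span (by simp)) h]; trivial
  · rw [Ideal.eq_top_of_isUnit_mem _ (Ideal.subset_span (by simp)) h]; trivial

end Terminal

section Ratio

open QuadricPair IsLocalRing Matrix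

theorem map_eval_eq {R S : Type*} [CommRing R] [CommRing S] (φ : R →+* S) (u : Fin 4 → R)
    (p : MvPolynomial (Fin 4) R) :
    eval (fun i => φ (u i)) (MvPolynomial.map φ p) = φ (eval u p) :=
  (MvPolynomial.eval_map _ _ _).trans (MvPolynomial.eval₂_comp _ _ _).symm

variable {O : Type*} [CommRing O] [IsDomain O] [IsDiscreteValuationRing O] {π : O}

theorem AtStepThree.dvd_of_isZero (hπ : Irreducible π) {Q : QuadricPair O}
    {l : Fin 3 → ResidueField O} (hQ : AtStepThree Q l) {a : Fin 3 → O} {b : O}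
    (hcongr : red (constPart (Q 0)) =
      red ((∑ j : Fin 3, C (a j) * X j.succ) * linPart (Q 0) + C b * constPart (Q 1)))
    {u : Fin 4 → O} (hu : Q.IsZero u) (hl : ∑ j : Fin 3, l j * residue O (u j.succ) ≠ 0) :
    π ∣ u 0 + ∑ j, a j * u j.succ := by
  obtain ⟨hlin, h0, h1, -⟩ := hQ.red_eq
  have z : ∀ i, eval (fun i => residue O (u i)) (red (Q i)) = 0 := fun i => by
    rw [red, map_eval_eq, hu i, map_zero]
  have z0 := z 0
  have z1 := z 1
  rw [h0, hcongr, map_add (red (O := O)), map_mul (red (O := O)), map_mul (red (O := O)), ← h1,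
    hlin, sum_C_mul_X_succ, red, map_linForm] at z0
  simp only [map_add, map_mul, eval_X, eval_linForm] at z0
  change _ + (_ + _ * eval _ (red (Q 1))) = _ at z0
  rw [z1, mul_zero, add_zero] at z0
  rw [← residue_eq_zero_iff_dvd hπ, map_add, map_sum]
  simp only [map_mul]
  refine (mul_eq_zero.1 ?_).resolve_left hl
  linear_combination z0

variable [CharZero O]

/-- At a zero that lies on the plane `x₁ = 0` modulo `π` and is smooth modulo `π`, the covariants
generate the ideal determined by the return value of the algorithm. -/
theorem AtStepTwo.covariantIdeal_eq (hπ : Irreducible π) (N : ℕ) : ∀ (Q : QuadricPair O)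
    (l : Fin 3 → ResidueField O), AtStepTwo Q l → VanishesNear π N Q → ¬ VanishesNear π (N + 1) Q →
    ∀ u, Q.IsZero u → π ∣ u 0 → ∑ j : Fin 3, l j * residue O (u j.succ) ≠ 0 →
    Q.covariantIdeal u = Ideal.span {π ^ (2 * N)} := by
  induction N with
  | zero =>
    intro Q l hQ _ hN
    obtain ⟨M, Q', hX, h0, h1⟩ := hQ.exists_step hπ
    obtain ⟨γ, -, -, hiff⟩ := hQ.atStepThree M hX hπ h0 h1
    exact absurd ((hiff 0).2 (vanishesOnPlane_zero Q')) hN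
  | succ N ih =>
    intro Q l hQ hN hN' u hu ⟨w, hw⟩ hl
    obtain ⟨M, Q', hX, h0, h1⟩ := hQ.exists_step hπ
    obtain ⟨γ, hγ, h3, hiff⟩ := hQ.atStepThree M hX hπ h0 h1
    rw [hiff] at hN hN'
    set u' : Fin 4 → O := Fin.cons w (fun j => u j.succ) with hu'
    have hscale : scaleMatrix π *ᵥ u' = u := by
      rw [scaleMatrix_mulVec]
      ext i
      refine Fin.cases ?_ (fun j => ?_) i <;> simp [hu', hw]
    have hR : (Q.linComb M.val).IsZero u := fun i => by
      simp [QuadricPair.linComb, hu 0, hu 1]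
    have hz' : Q'.IsZero u' := by
      have key : ∀ p, eval u' (scaleFirst π p) = eval u p := fun p => by
        rw [scaleFirst_eq_subst, eval_subst, hscale]
      intro i
      fin_cases i
      · have := congrArg (eval u') h0
        rw [map_mul, eval_C, key, hR 0] at this
        exact (mul_eq_zero.1 this).resolve_left hπ.ne_zero
      · have := congrArg (eval u') h1
        rw [key, hR 1] at this
        exact this
    have hl' : ∑ j : Fin 3, (γ • l) j * residue O (u' j.succ) ≠ 0 := by
      simp only [Pi.smul_apply, smul_eq_mul, mul_assoc, ← Finset.mul_sum]
      exact mul_ne_zero hγ (by simpa [hu'] using hl)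
    rw [← covariantIdeal_linComb hQ.1 M.val ((Matrix.isUnit_iff_isUnit_det _).1 M.isUnit) u hu,
      ← hscale, covariantIdeal_scale (hQ.1.linComb M.val) h3.1 hπ.ne_zero h0 h1]
    rcases N with _ | N
    · rw [zero_add] at hN'
      rw [h3.covariantIdeal_eq_top hπ hN' hz' hl', Ideal.mul_top]
    · have hmem := (vanishesOnPlane_one_iff hπ h3).1 (hN.mono (by omega))
      obtain ⟨a, b, hab⟩ := h3.exists_congr hmem
      obtain ⟨h2, hv⟩ := h3.shear hπ a b hab
      set u'' : Fin 4 → O := Fin.cons (w + ∑ j, a j * u j.succ) (fun j => u j.succ) with hu''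
      have hshear : shearMatrix a *ᵥ u'' = u' := by
        rw [shearMatrix_mulVec]
        ext i
        refine Fin.cases ?_ (fun j => ?_) i <;> simp [hu', hu'']
      have hz'' : QuadricPair.IsZero (fun i => shearFirst a (Q' i)) u'' := fun i => by
        change eval u'' (shearFirst a (Q' i)) = 0
        rw [shearFirst_eq_subst, eval_subst, hshear, hz' i]
      have hdvd : π ∣ u'' 0 := h3.dvd_of_isZero hπ hab hz' hl'
      have key := ih _ _ h2 ((hv N).1 hN) (fun h => hN' ((hv (N + 1)).2 h)) u'' hz'' hdvd hl'
      have hdet : IsUnit (shearMatrix a).det := by rw [det_shearMatrix]; exact isUnit_one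
      have heq := covariantIdeal_subst h3.1 (shearMatrix a) hdet u''
      simp only [shearFirst_eq_subst] at key
      rw [heq, hshear] at key
      rw [key, Ideal.span_singleton_mul_span_singleton, ← pow_add]
      congr 3
      ring

end Ratio

section Nullstellensatz

variable {O : Type*} [CommRing O] [IsDomain O] {K : Type*} [Field K] [Algebra O K]
  [IsFractionRing O K]

/-- An ideal of polynomials without zeros over an algebraic closure of the fraction field contains
a non-zero constant. -/
theorem exists_C_mem_of_no_zero {σ : Type*} [Finite σ] (J : Ideal (MvPolynomial σ O))
    (h : ∀ x : σ → AlgebraicClosure K, ∃ f ∈ J,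
      eval₂Hom ((algebraMap K (AlgebraicClosure K)).comp (algebraMap O K)) x f ≠ 0) :
    ∃ r : O, r ≠ 0 ∧ C r ∈ J := by
  let : Algebra (MvPolynomial σ O) (MvPolynomial σ K) := algebraMvPolynomial
  have htop : J.map (algebraMap (MvPolynomial σ O) (MvPolynomial σ K)) = ⊤ := by
    rw [← Ideal.radical_eq_top, ← vanishingIdeal_zeroLocus_eq_radical (K := AlgebraicClosure K)]
    convert vanishingIdeal_empty
    rw [Set.eq_empty_iff_forall_notMem]
    intro x hx
    obtain ⟨f, hf, hne⟩ := h x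
    apply hne
    have := hx _ (Ideal.mem_map_of_mem _ hf)
    rw [← this, MvPolynomial.algebraMap_def, aeval_def, eval₂_map]
    rfl
  have h1 := htop.symm ▸ (Submodule.mem_top : (1 : MvPolynomial σ K) ∈ ⊤)
  rw [IsLocalization.mem_map_algebraMap_iff ((nonZeroDivisors O).map (C (σ := σ)))] at h1
  obtain ⟨⟨⟨f, hf⟩, ⟨m, hm⟩⟩, hfm⟩ := h1
  obtain ⟨r, hr, rfl⟩ := hm
  rw [one_mul] at hfm
  have hinj : Function.Injective (algebraMap (MvPolynomial σ O) (MvPolynomial σ K)) := by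
    rw [MvPolynomial.algebraMap_def]
    exact map_injective _ (IsFractionRing.injective O K)
  exact ⟨r, nonZeroDivisors.ne_zero hr, (hinj hfm : C r = f) ▸ hf⟩

end Nullstellensatz

section Termination

variable {O : Type*} [CommRing O] [IsDomain O] {K : Type*} [Field K] [Algebra O K]
  [IsFractionRing O K]

/-- The restriction of the generic combination of the two forms to the generic plane. -/
def genericRestriction {O : Type*} [CommRing O] (Q : QuadricPair O) :
    MvPolynomial (Fin 4) (MvPolynomial (Fin 2 ⊕ Fin 2 ⊕ Fin 3) O) :=
  restr (fun i => X (.inr (.inr i))) (∑ i, C (X (.inl i)) * MvPolynomial.map C (Q i))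

theorem map_genericRestriction {O S : Type*} [CommRing O] [CommRing S] (Q : QuadricPair O)
    (φ : O →+* S) (x : Fin 2 ⊕ Fin 2 ⊕ Fin 3 → S) :
    MvPolynomial.map (eval₂Hom φ x) (genericRestriction Q) = restr (fun i => x (.inr (.inr i)))
      (∑ i, C (x (.inl i)) * MvPolynomial.map φ (Q i)) := by
  have hφ : (eval₂Hom φ x).comp C = φ := by ext; simp
  rw [genericRestriction, map_restr, map_sum]
  simp only [map_mul, map_C, MvPolynomial.map_map, hφ]
  simp

/-- If combinations of the two forms vanish on planes modulo arbitrarily high powers of `π`, some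
combination vanishes on a plane over the algebraic closure of the fraction field. -/
theorem exists_restr_eq_zero_of_vanishesOnPlane {π : O} (Q : QuadricPair O)
    (hπ : ∀ r : O, (∀ n, π ^ n ∣ r) → r = 0) (h : ∀ n, VanishesOnPlane π n Q) :
    ∃ (c : Fin 2 → AlgebraicClosure K) (a : Fin 3 → AlgebraicClosure K), c ≠ 0 ∧
      restr a (∑ i, C (c i) * MvPolynomial.map
        ((algebraMap K (AlgebraicClosure K)).comp (algebraMap O K)) (Q i)) = 0 := by
  by_contra! hno
  let c (i : Fin 2) : MvPolynomial (Fin 2 ⊕ Fin 2 ⊕ Fin 3) O := X (.inl i)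
  let e (i : Fin 2) : MvPolynomial (Fin 2 ⊕ Fin 2 ⊕ Fin 3) O := X (.inr (.inl i))
  let J : Ideal (MvPolynomial (Fin 2 ⊕ Fin 2 ⊕ Fin 3) O) :=
    Ideal.span ({∑ i, c i * e i - 1} ∪ Set.range fun d => coeff d (genericRestriction Q))
  obtain ⟨r, hr, hrJ⟩ := exists_C_mem_of_no_zero (K := K) J (by
    intro x
    by_contra! hx
    have h1 := hx _ (Ideal.subset_span (Or.inl rfl))
    refine hno (fun i => x (.inl i)) (fun i => x (.inr (.inr i))) ?_ ?_
    · intro h0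
      have h0 : ∀ i, x (.inl i) = 0 := fun i => congrFun h0 i
      simp [c, e, h0] at h1
    · rw [← map_genericRestriction]
      ext d
      rw [coeff_map, coeff_zero]
      exact hx _ (Ideal.subset_span (Or.inr ⟨d, rfl⟩)))
  refine hr (hπ r fun n => ?_)
  obtain ⟨c', e', hce, a', ha'⟩ := h n
  set φ := Ideal.Quotient.mk (Ideal.span {π ^ n})
  let x : Fin 2 ⊕ Fin 2 ⊕ Fin 3 → O ⧸ Ideal.span {π ^ n} :=
    Sum.elim (fun i => φ (c' i)) (Sum.elim (fun i => φ (e' i)) fun i => φ (a' i))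
  have hJ : J ≤ RingHom.ker (eval₂Hom φ x) := by
    rw [Ideal.span_le]
    rintro _ (rfl | ⟨d, rfl⟩)
    · have := congrArg φ hce
      rw [SetLike.mem_coe, RingHom.mem_ker]
      simpa [x, c, e, sub_eq_zero] using this
    · rw [SetLike.mem_coe, RingHom.mem_ker, ← coeff_map, map_genericRestriction]
      have : MvPolynomial.map φ (restr a' (C (c' 0) * Q 0 + C (c' 1) * Q 1)) = 0 := by
        obtain ⟨g, hg⟩ := ha'
        have h0 : φ (π ^ n) = 0 := Ideal.Quotient.eq_zero_iff_mem.2 (Ideal.mem_span_singleton_self _)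
        rw [hg, map_mul, map_C, h0, C_0, zero_mul]
      rw [map_restr, map_add, map_mul, map_mul, map_C, map_C] at this
      rw [Fin.sum_univ_two]
      change coeff d (restr (fun i => φ (a' i)) (C (φ (c' 0)) * _ + C (φ (c' 1)) * _)) = 0
      rw [this, coeff_zero]
  have := hJ hrJ
  rw [RingHom.mem_ker, eval₂Hom_C, Ideal.Quotient.eq_zero_iff_mem, Ideal.mem_span_singleton] at this
  exact this

end Termination

section Regular

open QuadricPair Matrix

variable {F : Type*} [Field F]

/-- `{Q₁ = Q₂ = 0}` is smooth of dimension one at its rational points. -/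
def IsRegular (Q : QuadricPair F) : Prop := ∀ z : Fin 4 → F, z ≠ 0 → Q.IsZero z → Q.IsSmoothAt z

theorem isSmoothAt_form_iff {Q : QuadricPair F} {W : Fin 2 → Matrix (Fin 4) (Fin 4) F}
    (hW : ∀ i, Q i = form (W i)) (z : Fin 4 → F) :
    Q.IsSmoothAt z ↔ LinearIndependent F fun i => hess (W i) *ᵥ z := by
  rw [IsSmoothAt]
  have : (fun (i : Fin 2) (j : Fin 4) => eval z (pderiv j (Q i))) = fun i => hess (W i) *ᵥ z := by
    ext i j
    rw [hW, eval_pderiv_form]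
  rw [this]

theorem isSmoothAt_subst {Q : QuadricPair F} (hQ : Q.IsModel) {N : Matrix (Fin 4) (Fin 4) F}
    (hN : IsUnit N.det) (z : Fin 4 → F) :
    IsSmoothAt (fun i => subst N (Q i)) z ↔ Q.IsSmoothAt (N *ᵥ z) := by
  have hW : ∀ i, Q i = form (coeffMatrix (Q i)) := fun i => (form_coeffMatrix (hQ i)).symm
  have hW' : ∀ i, subst N (Q i) = form (Nᵀ * coeffMatrix (Q i) * N) := fun i => by
    rw [← subst_form, ← hW]
  rw [isSmoothAt_form_iff hW, isSmoothAt_form_iff hW']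
  have hker : LinearMap.ker (Matrix.mulVecLin Nᵀ) = ⊥ := by
    rw [LinearMap.ker_eq_bot]
    exact Matrix.mulVec_injective_iff_isUnit.2 ((Matrix.isUnit_iff_isUnit_det _).2
      (by rwa [Matrix.det_transpose]))
  have : (fun i => hess (Nᵀ * coeffMatrix (Q i) * N) *ᵥ z) =
      Matrix.mulVecLin Nᵀ ∘ fun i => hess (coeffMatrix (Q i)) *ᵥ N *ᵥ z := by
    ext1 i
    rw [Function.comp, Matrix.mulVecLin_apply, hess_mul, ← Matrix.mulVec_mulVec,
      ← Matrix.mulVec_mulVec]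
  rw [this, LinearMap.linearIndependent_iff _ hker]

theorem IsRegular.subst {Q : QuadricPair F} (h : IsRegular Q) (hQ : Q.IsModel)
    {N : Matrix (Fin 4) (Fin 4) F} (hN : IsUnit N.det) : IsRegular fun i => subst N (Q i) := by
  intro z hz hQz
  rw [isSmoothAt_subst hQ hN]
  refine h _ (fun h0 => hz ?_) fun i => ?_
  · exact Matrix.mulVec_injective_iff_isUnit.2 ((Matrix.isUnit_iff_isUnit_det _).2 hN)
      (by rw [h0, Matrix.mulVec_zero])
  · rw [← eval_subst]
    exact hQz i

theorem exists_pair_mulVec_eq_zero (l : Fin 4 → F) : ∃ f g : Fin 4 → F, f 0 = 0 ∧ g 0 = 0 ∧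
    l ⬝ᵥ f = 0 ∧ l ⬝ᵥ g = 0 ∧ ∀ s t : F, s • f + t • g = 0 → s = 0 ∧ t = 0 := by
  have key : ∀ w : Fin 4 → F, ∃ f : Fin 4 → F, f ≠ 0 ∧ f 0 = 0 ∧ l ⬝ᵥ f = 0 ∧ w ⬝ᵥ f = 0 := by
    intro w
    obtain ⟨v, hv, h⟩ := Matrix.exists_mulVec_eq_zero_iff.2
      (Matrix.det_eq_zero_of_row_eq_zero (A := Matrix.of ![Pi.single 0 1, l, w, 0]) 3 (by simp))
    have h := fun i => congrFun h i
    exact ⟨v, hv, by simpa [mulVec] using h 0, h 1, h 2⟩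
  obtain ⟨f, hf, hf0, hlf, -⟩ := key 0
  obtain ⟨i, hi⟩ := Function.ne_iff.1 hf
  obtain ⟨g, hg, hg0, hlg, hig⟩ := key (Pi.single i 1)
  refine ⟨f, g, hf0, hg0, hlf, hlg, fun s t hst => ?_⟩
  have hs : s = 0 := by
    have := congrFun hst i
    rw [single_one_dotProduct] at hig
    simpa [hig, show f i ≠ 0 from hi] using this
  refine ⟨hs, ?_⟩
  simpa [hs, hg] using hst

theorem IsRegular.constPart_ne_zero [IsAlgClosed F] {Q : QuadricPair F} (h : IsRegular Q)
    (hQ : Q.IsModel) {c : Fin 2 → F} (hc : c ≠ 0) : constPart (∑ i, C (c i) * Q i) ≠ 0 := by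
  intro h0
  have hW : ∀ i, Q i = form (coeffMatrix (Q i)) := fun i => (form_coeffMatrix (hQ i)).symm
  set U := coeffMatrix (Q 0)
  set V := coeffMatrix (Q 1)
  have hsum : ∑ i, C (c i) * Q i = form (c 0 • U + c 1 • V) := by
    rw [form_smul_add, Fin.sum_univ_two, ← hW, ← hW]
  rw [hsum] at h0
  set W := c 0 • U + c 1 • V with hWdef
  have hdec := form_decomp W
  rw [h0, add_zero] at hdec
  obtain ⟨i, hi⟩ := Function.ne_iff.1 hc
  obtain ⟨f, g, hf0, hg0, hlf, hlg, hind⟩ := exists_pair_mulVec_eq_zero (hess W 0)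
  set j : Fin 2 := 1 - i with hj
  set Y := coeffMatrix (Q j)
  obtain ⟨α, β, γ, δ, hA, hB, hD⟩ := exists_splitting_of_isAlgClosed (f ⬝ᵥ Y *ᵥ f)
    (f ⬝ᵥ hess Y *ᵥ g) (g ⬝ᵥ Y *ᵥ g)
  obtain ⟨s, t, hst, hzero⟩ : ∃ s t : F, ¬ (s = 0 ∧ t = 0) ∧ α * s + β * t = 0 := by
    by_cases hαβ : α = 0 ∧ β = 0
    · exact ⟨1, 0, by simp, by simp [hαβ.1]⟩
    · exact ⟨β, -α, by simpa [and_comm] using hαβ, by ring⟩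
  set z := s • f + t • g with hz
  have hz0 : z 0 = 0 := by simp [hz, hf0, hg0]
  have hlz : hess W 0 ⬝ᵥ z = 0 := by simp [hz, dotProduct_add, hlf, hlg]
  have hzne : z ≠ 0 := fun h => hst (hind s t h)
  have hQj : eval z (Q j) = 0 := by
    rw [hW, eval_form, hz, dotProduct_mulVec_add_smul, Matrix.mulVec_smul, smul_dotProduct,
      dotProduct_smul, smul_dotProduct, hA, hB, hD]
    simp only [smul_eq_mul]
    linear_combination (γ * s + δ * t) * hzero
  have hgrad : hess W *ᵥ z = 0 := by
    ext k
    rw [← eval_pderiv_form, hdec]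
    have hlin : linForm (linCoeff W) = ∑ m : Fin 3, C (hess W 0 m.succ) * X m.succ := rfl
    have hev : eval z (linForm (linCoeff W)) = 0 := by
      rw [dotProduct, Fin.sum_univ_succ, hz0, mul_zero, zero_add] at hlz
      rw [eval_linForm]; exact hlz
    simp [Derivation.leibniz, hz0, hev, Derivation.leibniz_pow]
  have hWz : eval z (form W) = 0 := by rw [hdec]; simp [hz0]
  have hzQ : Q.IsZero z := by
    rw [← hsum, map_sum, Fin.sum_univ_two] at hWz
    simp only [map_mul, eval_C] at hWz
    have h2 : ∀ m, m = i ∨ m = j := by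
      intro m
      fin_cases i <;> fin_cases m <;> simp [hj]
    have hi' : eval z (Q i) = 0 := by
      have : c i * eval z (Q i) + c j * eval z (Q j) = 0 := by
        rw [← hWz]
        fin_cases i <;> simp [hj, add_comm]
      rw [hQj, mul_zero, add_zero] at this
      exact (mul_eq_zero.1 this).resolve_left hi
    intro m
    rcases h2 m with rfl | rfl
    · exact hi'
    · exact hQj
  have hsm := (isSmoothAt_form_iff hW z).1 (h z hzne hzQ)
  rw [Fintype.linearIndependent_iff] at hsm
  refine hi (hsm c ?_ i)
  rw [Fin.sum_univ_two, ← Matrix.smul_mulVec, ← Matrix.smul_mulVec, ← Matrix.add_mulVec,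
    ← hess_smul, ← hess_smul, ← hess_add]
  exact hgrad

theorem IsRegular.restr_ne_zero [IsAlgClosed F] {Q : QuadricPair F} (h : IsRegular Q)
    (hQ : Q.IsModel) {c : Fin 2 → F} (hc : c ≠ 0) (a : Fin 3 → F) :
    restr a (∑ i, C (c i) * Q i) ≠ 0 := by
  have hdet : IsUnit (shearMatrix (-a)).det := by rw [det_shearMatrix]; exact isUnit_one
  have := (h.subst hQ hdet).constPart_ne_zero (fun i => subst_isHomogeneous (hQ i) _) hc
  convert this
  have e : ∀ i, C (c i) * GenusOne.subst (shearMatrix (-a)) (Q i) =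
      GenusOne.subst (shearMatrix (-a)) (C (c i) * Q i) := fun i => by
    rw [map_mul, ← algebraMap_eq, AlgHom.commutes]
  simp only [e]
  rw [← map_sum, ← shearFirst_eq_subst, constPart_eq_restr, restr_shearFirst, zero_sub, neg_neg]

end Regular

section Conic

open QuadricPair

variable {k : Type*} [Field k]

theorem prime_of_prime_subst {N : Matrix (Fin 4) (Fin 4) k} (hN : IsUnit N.det)
    {ℓ : MvPolynomial (Fin 4) k} (h : Prime (subst N ℓ)) : Prime ℓ := by
  let e : MvPolynomial (Fin 4) k ≃ₐ[k] MvPolynomial (Fin 4) k :=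
    AlgEquiv.ofAlgHom (subst N) (subst N⁻¹)
      (AlgHom.ext fun p => by
        rw [AlgHom.comp_apply, subst_subst, Matrix.nonsing_inv_mul _ hN, subst_one]; rfl)
      (AlgHom.ext fun p => by
        rw [AlgHom.comp_apply, subst_subst, Matrix.mul_nonsing_inv _ hN, subst_one]; rfl)
  exact (MulEquiv.prime_iff e.toMulEquiv).1 h

theorem dvd_iff_subst {N : Matrix (Fin 4) (Fin 4) k} (hN : IsUnit N.det)
    {p q : MvPolynomial (Fin 4) k} : subst N p ∣ subst N q ↔ p ∣ q := by
  refine ⟨fun h => ?_, fun h => map_dvd _ h⟩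
  have := map_dvd (subst N⁻¹) h
  rwa [subst_subst, subst_subst, Matrix.mul_nonsing_inv _ hN, subst_one, subst_one] at this

theorem X_zero_dvd_sub_constPart {R : Type*} [CommRing R] (p : MvPolynomial (Fin 4) R) :
    X 0 ∣ p - constPart p := by
  induction p using MvPolynomial.induction_on with
  | C a => simp [constPart_C]
  | add p q hp hq =>
    rw [constPart_add, add_sub_add_comm]
    exact dvd_add hp hq
  | mul_X p i hp =>
    rw [constPart_mul]
    refine Fin.cases ?_ (fun j => ?_) i
    · rw [constPart_X_zero, mul_zero, sub_zero]
      exact dvd_mul_left _ _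
    · have : constPart (X j.succ : MvPolynomial (Fin 4) R) = X j.succ := by
        simp [constPart, Fin.succ_ne_zero]
      rw [this, ← sub_mul]
      exact hp.mul_right _

theorem X_zero_dvd_iff {R : Type*} [CommRing R] {p : MvPolynomial (Fin 4) R} :
    X 0 ∣ p ↔ constPart p = 0 := by
  refine ⟨constPart_eq_zero_of_dvd, fun h => ?_⟩
  have := X_zero_dvd_sub_constPart p
  rwa [h, sub_zero] at this

variable {ℓ q : MvPolynomial (Fin 4) k} {Q : QuadricPair k}

theorem exists_linear_of_mem_span {F : Type*} [Field F] {ℓ q f : MvPolynomial (Fin 4) F}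
    (hℓ : ℓ.IsHomogeneous 1) (hq : q.IsHomogeneous 2) (hf : f.IsHomogeneous 1)
    (h : f ∈ Ideal.span {ℓ, q}) : ℓ ∣ f := by
  obtain ⟨a, b, hab⟩ := Ideal.mem_span_pair.1 h
  have h1 := congrArg (homogeneousComponent 1) hab
  rw [map_add, homogeneousComponent_mul_self a hℓ, homogeneousComponent_of_mem hf, if_pos rfl] at h1
  have h2 : homogeneousComponent 1 (b * q) = 0 := by
    conv_lhs => rw [← sum_homogeneousComponent b, Finset.sum_mul, map_sum]
    refine Finset.sum_eq_zero fun i _ => ?_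
    rw [homogeneousComponent_of_mem ((homogeneousComponent_isHomogeneous i b).mul hq),
      if_neg (by omega)]
  rw [h2, add_zero] at h1
  exact ⟨C (coeff 0 a), by rw [← h1, mul_comm]⟩

theorem exists_decomp_of_mem_span {f : MvPolynomial (Fin 4) k}
    (hℓ : ℓ.IsHomogeneous 1) (hq : q.IsHomogeneous 2) (hf : f.IsHomogeneous 2)
    (h : f ∈ Ideal.span {ℓ, q}) : ∃ (m : MvPolynomial (Fin 4) k) (β : k), m.IsHomogeneous 1 ∧
      f = ℓ * m + C β * q := by
  obtain ⟨a, b, hab⟩ := Ideal.mem_span_pair.1 h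
  have h1 := congrArg (homogeneousComponent 2) hab
  rw [map_add, homogeneousComponent_mul_self b hq, homogeneousComponent_of_mem hf, if_pos rfl,
    show (2 : ℕ) = 1 + 1 from rfl, homogeneousComponent_add_mul 1 a hℓ] at h1
  exact ⟨homogeneousComponent 1 a, coeff 0 b, homogeneousComponent_isHomogeneous 1 a, by
    rw [← h1, mul_comm ℓ]⟩

/-- At a component of multiplicity one, the local ring has maximal ideal generated by the
equations. -/
theorem IsComponentOfMultiplicityOne.exists_mul_mem {I : Ideal (MvPolynomial (Fin 4) k)}
    (h : IsComponentOfMultiplicityOne Q I) {f : MvPolynomial (Fin 4) k} (hf : f ∈ I) :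
    ∃ s, s ∉ I ∧ s * f ∈ Ideal.span (Set.range Q) := by
  obtain ⟨-, hI, hlen⟩ := h
  rw [Module.length_eq_one_iff, isSimpleModule_iff_isCoatom] at hlen
  have hmax := IsLocalRing.eq_maximalIdeal (Ideal.isMaximal_def.2 hlen)
  have hf' : algebraMap _ (Localization.AtPrime I) f ∈ IsLocalRing.maximalIdeal _ :=
    (IsLocalization.AtPrime.to_map_mem_maximal_iff _ I f).2 hf
  rw [← hmax, IsLocalization.mem_map_algebraMap_iff I.primeCompl] at hf'
  obtain ⟨⟨⟨a, ha⟩, ⟨s, hs⟩⟩, hfs⟩ := hf'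
  rw [← map_mul, IsLocalization.eq_iff_exists I.primeCompl] at hfs
  obtain ⟨⟨t, ht⟩, hts⟩ := hfs
  refine ⟨t * s, fun hts => (hI.mem_or_mem hts).elim ht hs, ?_⟩
  rw [mul_assoc, mul_comm s, show t * (f * s) = t * a from hts]
  exact Ideal.mul_mem_left _ _ ha

theorem IsComponentOfMultiplicityOne.exists_coeff (hQ : Q.IsModel)
    (hℓ : ℓ.IsHomogeneous 1) (hprime : Prime ℓ) (hq : q.IsHomogeneous 2) (hℓq : ¬ ℓ ∣ q)
    (h : IsComponentOfMultiplicityOne Q (Ideal.span {ℓ, q})) :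
    ∃ (m : Fin 2 → MvPolynomial (Fin 4) k) (β : Fin 2 → k), (∀ i, (m i).IsHomogeneous 1) ∧
      (∀ i, Q i = ℓ * m i + C (β i) * q) ∧ β ≠ 0 ∧ ¬ ℓ ∣ C (β 1) * m 0 - C (β 0) * m 1 := by
  have hle : Ideal.span (Set.range Q) ≤ Ideal.span {ℓ, q} := h.1.1.2
  choose m β hm hmβ using fun i => exists_decomp_of_mem_span hℓ hq (hQ i)
    (hle (Ideal.subset_span ⟨i, rfl⟩))
  have hℓmem : ℓ ∈ Ideal.span {ℓ, q} := Ideal.subset_span (by simp)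
  have hqmem : q ∈ Ideal.span {ℓ, q} := Ideal.subset_span (by simp)
  have hβ : β ≠ 0 := by
    rintro rfl
    have hp : (Ideal.span {ℓ}).IsPrime := (Ideal.span_singleton_prime hprime.ne_zero).2 hprime
    have hIℓ : Ideal.span (Set.range Q) ≤ Ideal.span {ℓ} := by
      rw [Ideal.span_le]
      rintro _ ⟨i, rfl⟩
      rw [SetLike.mem_coe, Ideal.mem_span_singleton, hmβ i]
      simp
    have := h.1.2 ⟨hp, hIℓ⟩ (Ideal.span_mono (by simp)) hqmem
    exact hℓq (Ideal.mem_span_singleton.1 this)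
  refine ⟨m, β, hm, hmβ, hβ, ?_⟩
  rintro ⟨n, hn⟩
  obtain ⟨s, hs, hsℓ⟩ := h.exists_mul_mem hℓmem
  have hrange : Set.range Q = {Q 0, Q 1} := by
    ext; simp [Fin.exists_fin_two, eq_comm]
  rw [hrange] at hsℓ
  obtain ⟨a, b, hab⟩ := Ideal.mem_span_pair.1 hsℓ
  rw [hmβ 0, hmβ 1] at hab
  have hdvd : ℓ ∣ (a * C (β 0) + b * C (β 1)) * q :=
    ⟨s - a * m 0 - b * m 1, by linear_combination hab⟩
  obtain ⟨r, hr⟩ := (hprime.dvd_or_dvd hdvd).resolve_right hℓq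
  have hs' : s = a * m 0 + b * m 1 + r * q := by
    apply mul_left_cancel₀ hprime.ne_zero
    linear_combination -hab + q * hr
  have hmem : ∀ c : k, c ≠ 0 → C c * s ∈ Ideal.span {ℓ, q} → False := by
    intro c hc hcs
    apply hs
    have := Ideal.mul_mem_left _ (C c⁻¹) hcs
    rwa [← mul_assoc, ← C_mul, inv_mul_cancel₀ hc, C_1, one_mul] at this
  by_cases h1 : β 1 = 0
  · have h0 : β 0 ≠ 0 := fun h0 => hβ (by ext i; fin_cases i <;> simp [h0, h1])
    refine hmem _ h0 (Ideal.mem_span_pair.2 ⟨r * m 0 - b * n, C (β 0) * r, ?_⟩)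
    rw [hs']
    linear_combination b * hn - m 0 * hr
  · refine hmem _ h1 (Ideal.mem_span_pair.2 ⟨r * m 1 + a * n, C (β 1) * r, ?_⟩)
    rw [hs']
    linear_combination -a * hn - m 1 * hr

theorem geomIrred_of_isPrime (hℓ : ℓ.IsHomogeneous 1) (hq : q.IsHomogeneous 2) (hℓq : ¬ ℓ ∣ q)
    (hprime : ((Ideal.span {ℓ, q}).map
      (MvPolynomial.map (algebraMap k (AlgebraicClosure k)))).IsPrime)
    {N : Matrix (Fin 4) (Fin 4) k} (hN : IsUnit N.det) {γ : k} (hγ : γ ≠ 0)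
    (hNℓ : subst N ℓ = C γ * X 0) : GeomIrred (constPart (subst N q)) := by
  intro f g hf hg hfg
  set φ := algebraMap k (AlgebraicClosure k)
  have hNφ : IsUnit (N.map φ).det := by
    rw [← RingHom.mapMatrix_apply, ← RingHom.map_det]; exact hN.map φ
  rw [Ideal.map_span, Set.image_pair] at hprime
  have hq0 : constPart (subst N q) ≠ 0 := by
    rw [Ne, ← X_zero_dvd_iff]
    intro h
    apply hℓq
    rw [← dvd_iff_subst hN, hNℓ]
    exact (IsUnit.mul_left_dvd ((isUnit_iff_ne_zero.2 hγ).map C)).2 h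
  have hX : subst (N.map φ) (MvPolynomial.map φ ℓ) = C (φ γ) * X 0 := by
    rw [← map_subst, hNℓ, map_mul, map_C, map_X]
  have hinv : ∀ p, subst (N.map φ)⁻¹ (subst (N.map φ) p) = p := fun p => by
    rw [subst_subst, Matrix.mul_nonsing_inv _ hNφ, subst_one]
  have hinv' : ∀ p, subst (N.map φ) (subst (N.map φ)⁻¹ p) = p := fun p => by
    rw [subst_subst, Matrix.nonsing_inv_mul _ hNφ, subst_one]
  have hXinv : subst (N.map φ)⁻¹ (X 0) = C (φ γ⁻¹) * MvPolynomial.map φ ℓ := by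
    apply subst_injective hNφ
    rw [hinv', map_mul, hX, ← algebraMap_eq, AlgHom.commutes, algebraMap_eq, ← mul_assoc, ← C_mul,
      ← map_mul, inv_mul_cancel₀ hγ, map_one, C_1, one_mul]
  have hmem : subst (N.map φ)⁻¹ f * subst (N.map φ)⁻¹ g ∈
      Ideal.span {MvPolynomial.map φ ℓ, MvPolynomial.map φ q} := by
    obtain ⟨r, hr⟩ := X_zero_dvd_sub_constPart (subst (N.map φ) (MvPolynomial.map φ q))
    rw [← map_subst, ← map_constPart, hfg] at hr
    have := congrArg (subst (N.map φ)⁻¹) hr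
    rw [map_subst, map_sub, map_mul, map_mul, hinv, hXinv] at this
    exact Ideal.mem_span_pair.2 ⟨-(C (φ γ⁻¹) * subst (N.map φ)⁻¹ r), 1, by
      linear_combination this⟩
  have key : ∀ f : MvPolynomial (Fin 4) (AlgebraicClosure k), f.IsHomogeneous 1 →
      subst (N.map φ)⁻¹ f ∈ Ideal.span {MvPolynomial.map φ ℓ, MvPolynomial.map φ q} →
      constPart f = 0 := by
    intro f hf h
    have := exists_linear_of_mem_span (hℓ.map φ) (hq.map φ) (subst_isHomogeneous hf _) h
    rw [← dvd_iff_subst hNφ, hX, hinv'] at this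
    exact constPart_eq_zero_of_dvd (dvd_of_mul_left_dvd this)
  apply hq0
  apply map_injective φ φ.injective
  have hc : MvPolynomial.map φ (constPart (subst N q)) = constPart f * constPart g := by
    rw [← constPart_mul, ← hfg, ← map_constPart, constPart_constPart]
  rw [hc, map_zero]
  rcases hprime.mem_or_mem hmem with h | h
  · rw [key f hf h, zero_mul]
  · rw [key g hg h, mul_zero]

end Conic

section Coordinates

open QuadricPair IsLocalRing Matrix

variable {O : Type*} [CommRing O] [IsLocalRing O]

theorem isUnit_det_of_residue {N : Matrix (Fin 4) (Fin 4) O}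
    (h : IsUnit (N.map (residue O)).det) : IsUnit N.det := by
  rw [← RingHom.mapMatrix_apply, ← RingHom.map_det] at h
  exact (residue_ne_zero_iff_isUnit _).1 h.ne_zero

/-- Coordinates over `O` in which a given plane over the residue field becomes `x₁ = 0`. -/
theorem exists_coordinates {ℓ : MvPolynomial (Fin 4) (ResidueField O)} (hℓ : ℓ.IsHomogeneous 1)
    (h0 : ℓ ≠ 0) : ∃ (N : Matrix (Fin 4) (Fin 4) O) (γ : ResidueField O), IsUnit N.det ∧ γ ≠ 0 ∧
      subst (N.map (residue O)) ℓ = C γ * X 0 := by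
  obtain ⟨c, rfl⟩ := IsHomogeneous.exists_linear hℓ
  obtain ⟨j, hj⟩ : ∃ j, c j ≠ 0 := by
    by_contra! h
    exact h0 (by simp [h])
  choose d hd using fun i => residue_surjective (c i)
  let M : Matrix (Fin 4) (Fin 4) O := Matrix.of (Fin.cons d fun i => Pi.single (j.succAbove i) 1)
  have hM : IsUnit M.det := by
    refine isUnit_det_of_residue (isUnit_det_of_mulVec_injective fun z hz => ?_)
    have h1 : ∀ i, z (j.succAbove i) = 0 := fun i => by
      have := congrFun hz i.succ
      simpa [M, mulVec, dotProduct, Pi.single_apply, apply_ite (residue O)] using this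
    have h2 : z j = 0 := by
      have := congrFun hz 0
      rw [mulVec, dotProduct, Fin.sum_univ_succAbove _ j] at this
      simpa [M, h1, hd, hj] using this
    ext i
    rcases Fin.eq_self_or_eq_succAbove j i with rfl | ⟨i, rfl⟩
    · exact h2
    · exact h1 i
  refine ⟨M⁻¹, 1, by rwa [Matrix.isUnit_nonsing_inv_det_iff], one_ne_zero, ?_⟩
  rw [subst_sum]
  have hc : c ᵥ* (M⁻¹.map (residue O)) = Pi.single 0 1 := by
    have hrow : c = Pi.single 0 1 ᵥ* M.map (residue O) := by
      ext i
      simp [M, hd]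
    have hinv : M.map (residue O) * M⁻¹.map (residue O) = 1 := by
      rw [← Matrix.map_mul, Matrix.mul_nonsing_inv _ hM]
      simp
    rw [hrow, Matrix.vecMul_vecMul, hinv, Matrix.vecMul_one]
  rw [hc]
  simp [Pi.single_apply, Fin.sum_univ_succ, Fin.succ_ne_zero]

theorem atStepTwo_of_conic {Q : QuadricPair O} (hQ : Q.IsModel)
    {ℓ q : MvPolynomial (Fin 4) (ResidueField O)} (hℓ : ℓ.IsHomogeneous 1) (hq : q.IsHomogeneous 2)
    (hℓq : ¬ ℓ ∣ q) (hprime : ((Ideal.span {ℓ, q}).map (MvPolynomial.map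
      (algebraMap (ResidueField O) (AlgebraicClosure (ResidueField O))))).IsPrime)
    (hmult : IsComponentOfMultiplicityOne (Q.baseChange (residue O)) (Ideal.span {ℓ, q}))
    {N : Matrix (Fin 4) (Fin 4) O} (hN : IsUnit N.det) {γ : ResidueField O} (hγ : γ ≠ 0)
    (hNℓ : subst (N.map (residue O)) ℓ = C γ * X 0) :
    ∃ l, AtStepTwo (fun i => subst N (Q i)) l := by
  have hN' : IsUnit (N.map (residue O)).det := by
    rw [← RingHom.mapMatrix_apply, ← RingHom.map_det]; exact hN.map _
  have hCγ : IsUnit (C γ : MvPolynomial (Fin 4) (ResidueField O)) :=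
    (isUnit_iff_ne_zero.2 hγ).map C
  have hℓprime : Prime ℓ := by
    refine prime_of_prime_subst hN' ?_
    rw [hNℓ, mul_comm]
    exact (Associated.prime_iff (associated_mul_unit_right _ _ hCγ)).1 (X_prime (i := 0))
  have hmod : ∀ i, ((Q.baseChange (residue O)) i).IsHomogeneous 2 := fun i => (hQ i).map _
  obtain ⟨m, β, hm, hmβ, hβ, hndvd⟩ := hmult.exists_coeff hmod hℓ hℓprime hq hℓq
  have hred : ∀ i, red (subst N (Q i)) = C γ * X 0 * subst (N.map (residue O)) (m i) +
      C (β i) * subst (N.map (residue O)) q := fun i => by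
    rw [red, map_subst]
    change subst _ (Q.baseChange (residue O) i) = _
    rw [hmβ, map_add, map_mul, map_mul, hNℓ, ← algebraMap_eq, AlgHom.commutes]
  obtain ⟨c, hc⟩ := IsHomogeneous.exists_linear (f := subst (N.map (residue O))
    (C (β 1) * m 0 - C (β 0) * m 1)) (subst_isHomogeneous (by
      have h := fun b i => (isHomogeneous_C (Fin 4) b).mul (hm i)
      simp only [zero_add] at h
      exact (h _ _).sub (h _ _)) _)
  refine ⟨fun j => γ * c j.succ, fun i => subst_isHomogeneous (hQ i) N, β,
    constPart (subst (N.map (residue O)) q), γ * c 0,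
    geomIrred_of_isPrime hℓ hq hℓq hprime hN' hγ hNℓ, constPart_constPart _, fun i => ?_, hβ, ?_, ?_⟩
  · rw [hred]
    simp only [constPart_add, constPart_mul, constPart_X_zero, constPart_C]
    ring
  · intro h0
    apply hndvd
    have h0 : ∀ j : Fin 3, c j.succ = 0 := fun j =>
      (mul_eq_zero.1 (congrFun h0 j)).resolve_left hγ
    rw [← dvd_iff_subst hN', hNℓ, hc, Fin.sum_univ_succ]
    simp only [h0, C_0, zero_mul, Finset.sum_const_zero, add_zero]
    exact (hCγ.mul_left_dvd).2 (dvd_mul_left _ _)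
  · have hlin : (linForm fun j => γ * c j.succ) =
        C γ * ∑ j : Fin 3, C (c j.succ) * X j.succ := by
      simp [linForm, Finset.mul_sum, mul_assoc]
    rw [Fin.sum_univ_succ, map_sub, map_mul, map_mul, ← algebraMap_eq, AlgHom.commutes,
      AlgHom.commutes, algebraMap_eq] at hc
    rw [hred, hred, hlin, C_mul]
    linear_combination C γ * X 0 * hc

theorem AtStepTwo.ne_zero_of_isSmoothAt {Q : QuadricPair O} {l : Fin 3 → ResidueField O}
    (h : AtStepTwo Q l) {z : Fin 4 → ResidueField O} (hz : z 0 = 0)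
    (hsm : (Q.baseChange (residue O)).IsSmoothAt z) : ∑ j : Fin 3, l j * z j.succ ≠ 0 := by
  intro hl
  obtain ⟨-, β, q, lam, -, -, -, hβ, -, hlin⟩ := h
  rw [IsSmoothAt, Fintype.linearIndependent_iff] at hsm
  have key := hsm ![β 1, -β 0] (by
    ext k
    have := congrArg (fun p => eval z (pderiv k p)) hlin
    simp only [map_sub, Derivation.leibniz, map_add, smul_eq_mul, map_mul, pderiv_C, eval_C, eval_X,
      hz, eval_linForm, hl] at this
    simp only [map_zero, mul_zero, add_zero, zero_mul, zero_add] at this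
    simp only [Fin.sum_univ_two, Pi.add_apply, Pi.smul_apply, smul_eq_mul, Matrix.cons_val_zero,
      Matrix.cons_val_one, Pi.zero_apply]
    change _ * eval z (pderiv k (red (Q 0))) + _ * eval z (pderiv k (red (Q 1))) = 0
    linear_combination this)
  apply hβ
  ext i
  fin_cases i
  · simpa using key 1
  · simpa using key 0

end Coordinates

section Termination

open QuadricPair

variable {O : Type*} [CommRing O] [IsDomain O] [IsDiscreteValuationRing O] {K : Type*} [Field K]
  [Algebra O K] [IsFractionRing O K] {π : O}

theorem exists_vanishesNear (hπ : Irreducible π) {Q : QuadricPair O} (hQ : Q.IsModel)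
    (hns : (Q.baseChange (algebraMap O K)).IsNonsingular) {N : Matrix (Fin 4) (Fin 4) O}
    (hN : IsUnit N.det) : ∃ n, VanishesNear π n (fun i => subst N (Q i)) ∧
      ¬ VanishesNear π (n + 1) (fun i => subst N (Q i)) := by
  classical
  have hex : ∃ n, ¬ VanishesNear π n (fun i => subst N (Q i)) := by
    by_contra! h
    have hdvd : ∀ r : O, (∀ n, π ^ n ∣ r) → r = 0 := by
      intro r hr
      by_contra h0
      obtain ⟨n, hn⟩ := FiniteMultiplicity.of_not_isUnit hπ.not_isUnit h0
      exact hn (hr _)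
    have hplane : ∀ n, VanishesOnPlane π n (fun i => subst N (Q i)) := fun n => by
      obtain ⟨c, e, hce, a, ha⟩ := h n
      exact ⟨c, e, hce, π • a, ha⟩
    obtain ⟨c, a, hc, hca⟩ := exists_restr_eq_zero_of_vanishesOnPlane (K := K) _ hdvd hplane
    set φ := (algebraMap K (AlgebraicClosure K)).comp (algebraMap O K)
    have hreg : IsRegular (Q.baseChange φ) := by
      have : Q.baseChange φ =
          (Q.baseChange (algebraMap O K)).baseChange (algebraMap K (AlgebraicClosure K)) := by
        ext1 i
        exact (MvPolynomial.map_map _ _ _).symm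
      rw [this]
      exact hns
    have hNφ : IsUnit (N.map φ).det := by
      rw [← RingHom.mapMatrix_apply, ← RingHom.map_det]; exact hN.map φ
    have hmod : (Q.baseChange φ).IsModel := fun i => (hQ i).map _
    refine (hreg.subst hmod hNφ).restr_ne_zero (fun i => subst_isHomogeneous (hmod i) _) hc a ?_
    simpa only [map_subst, baseChange] using hca
  have h0 : VanishesNear π 0 (fun i => subst N (Q i)) := ⟨![1, 0], ![1, 0], by simp, 0, by simp⟩
  obtain ⟨n, hn⟩ : ∃ n, Nat.find hex = n + 1 :=
    Nat.exists_eq_succ_of_ne_zero fun h => Nat.find_spec hex (h ▸ h0)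
  exact ⟨n, not_not.1 (Nat.find_min hex (by omega)), hn ▸ Nat.find_spec hex⟩

end Termination

section Homogeneity

open QuadricPair

variable {R : Type*} [CommRing R]

theorem TI_smul_point (U V : Matrix (Fin 4) (Fin 4) R) (c : R) (x : Fin 4 → R) :
    TI U V (fun i => c * x i) = c ^ 2 * TI U V x := by
  simp only [TI, Finset.mul_sum]
  refine Finset.sum_congr rfl fun i _ => Finset.sum_congr rfl fun j _ => Finset.sum_congr rfl
    fun r _ => Finset.sum_congr rfl fun s _ => ?_
  ring

theorem F4I_smul_point (U V : Matrix (Fin 4) (Fin 4) R) (c : R) (x : Fin 4 → R) :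
    F4I U V (fun i => c * x i) = c ^ 8 * F4I U V x := by
  rw [F4I, TI_smul_point, TI_smul_point, ← mul_neg, GenBinaryQuartic.F₂_smul, F4I]
  ring

theorem G4I_smul_point (U V : Matrix (Fin 4) (Fin 4) R) (c : R) (x : Fin 4 → R) :
    G4I U V (fun i => c * x i) = c ^ 8 * G4I U V x := by
  rw [G4I, TI_smul_point, TI_smul_point, ← mul_neg, GenBinaryQuartic.G₂_smul, G4I]
  ring

theorem eval_form_smul (U : Matrix (Fin 4) (Fin 4) R) (c : R) (x : Fin 4 → R) :
    eval (fun i => c * x i) (form U) = c ^ 2 * eval x (form U) := by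
  simp only [form, map_sum, map_mul, eval_C, eval_X, Finset.mul_sum]
  refine Finset.sum_congr rfl fun i _ => Finset.sum_congr rfl fun j _ => ?_
  ring

end Homogeneity

section LocalRatio

open QuadricPair IsLocalRing

variable {O : Type*} [CommRing O] [IsDomain O] [CharZero O] [IsDiscreteValuationRing O]
  {K : Type*} [Field K] [Algebra O K] [IsFractionRing O K]

theorem absVal_le_one (a : O) : absVal O (algebraMap O K a) ≤ 1 :=
  (IsDiscreteValuationRing.maximalIdeal O).valuation_le_one a

theorem absVal_isUnit {a : O} (ha : IsUnit a) : absVal O (algebraMap O K a) = 1 := by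
  obtain ⟨b, hb⟩ := ha.exists_right_inv
  refine le_antisymm (absVal_le_one a) ?_
  calc (1 : ℤᵐ⁰) = absVal O (algebraMap O K a) * absVal O (algebraMap O K b) := by
        rw [← map_mul, ← map_mul, hb, map_one, map_one]
    _ ≤ absVal O (algebraMap O K a) * 1 := by gcongr; exact absVal_le_one b
    _ = _ := mul_one _

theorem max_absVal_eq_of_span_eq {f g r : O} (h : Ideal.span {f, g} = Ideal.span {r}) :
    max (absVal O (algebraMap O K f)) (absVal O (algebraMap O K g)) =
      absVal O (algebraMap O K r) := by
  have hle : ∀ a b : O, absVal O (algebraMap O K (a * b)) ≤ absVal O (algebraMap O K b) := by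
    intro a b
    rw [map_mul, map_mul]
    exact mul_le_of_le_one_left' (absVal_le_one a)
  apply le_antisymm
  · have key : ∀ x ∈ ({f, g} : Set O), absVal O (algebraMap O K x) ≤ absVal O (algebraMap O K r) := by
      intro x hx
      have := h ▸ Ideal.subset_span hx
      obtain ⟨a, rfl⟩ := Ideal.mem_span_singleton'.1 this
      exact hle _ _
    exact max_le (key f (by simp)) (key g (by simp))
  · have := h.symm ▸ Ideal.mem_span_singleton_self r
    obtain ⟨a, b, hab⟩ := Ideal.mem_span_pair.1 this
    rw [← hab, map_add]
    exact ((absVal O).map_add _ _).trans (max_le_max (hle _ _) (hle _ _))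

theorem localRatio_eq {Q : QuadricPair O} (hQ : Q.IsModel) {x : Fin 4 → K} {c : K} (hc : c ≠ 0)
    {u : Fin 4 → O} (hx : ∀ i, x i = c * algebraMap O K (u i)) (hu : ∃ i, IsUnit (u i)) {r : O}
    (h : Q.covariantIdeal u = Ideal.span {r}) :
    localRatio O Q x = absVal O (algebraMap O K r) := by
  have hinj : Function.Injective (algebraMap O K) := IsFractionRing.injective O K
  have h2 : (2 : K) ≠ 0 := by
    rw [← map_ofNat (algebraMap O K) 2, Ne, map_eq_zero_iff _ hinj]
    exact two_ne_zero
  have hx' : x = fun i => c * algebraMap O K (u i) := funext hx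
  have hhess : ∀ i, hessian (Q.baseChange (algebraMap O K) i) =
      hess ((coeffMatrix (Q i)).map (algebraMap O K)) := by
    intro i
    rw [← hessian_form, ← map_form, form_coeffMatrix (hQ i), baseChange]
  have hsup : (Finset.univ.sup fun i => absVal O (x i)) = absVal O c := by
    apply le_antisymm
    · refine Finset.sup_le fun i _ => ?_
      rw [hx, map_mul]
      exact mul_le_of_le_one_right' (absVal_le_one _)
    · obtain ⟨i, hi⟩ := hu
      refine le_trans (le_of_eq ?_) (Finset.le_sup (Finset.mem_univ i))
      rw [hx, map_mul, absVal_isUnit hi, mul_one]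
  have hc' : absVal O c ≠ 0 := (Valuation.ne_zero_iff _).2 hc
  rw [localRatio, F₄_eq_F4I h2 _ _ _ (hhess 0) (hhess 1), G₄_eq_G4I h2 _ _ _ (hhess 0) (hhess 1),
    hsup, hx', F4I_smul_point, G4I_smul_point, F4I_map, G4I_map, map_mul, map_mul, map_pow,
    ← mul_max, max_absVal_eq_of_span_eq (r := r) (by rw [← h]; rfl), mul_comm,
    mul_div_cancel_right₀ _ (pow_ne_zero _ hc')]

theorem isZero_of_baseChange {Q : QuadricPair O} (hQ : Q.IsModel) {c : K} (hc : c ≠ 0)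
    {u : Fin 4 → O}
    (h : (Q.baseChange (algebraMap O K)).IsZero fun i => c * algebraMap O K (u i)) :
    Q.IsZero u := by
  intro i
  have := h i
  rw [baseChange, ← form_coeffMatrix (hQ i), map_form, eval_form_smul, ← map_form, map_eval_eq,
    form_coeffMatrix (hQ i)] at this
  exact (map_eq_zero_iff _ (IsFractionRing.injective O K)).1
    ((mul_eq_zero.1 this).resolve_left (pow_ne_zero 2 hc))

end LocalRatio

section Main

open QuadricPair IsLocalRing Matrix

variable {O : Type*} [CommRing O] [IsDomain O] [CharZero O] [IsDiscreteValuationRing O]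
  {K : Type*} [Field K] [Algebra O K] [IsFractionRing O K]

/-- The main theorem over an arbitrary discrete valuation ring of characteristic zero. -/
theorem exists_localRatio_eq_and_computes {π : O} (hπ : Irreducible π) {Q : QuadricPair O}
    (hQ : Q.IsModel) (hns : (Q.baseChange (algebraMap O K)).IsNonsingular)
    {I : Ideal (MvPolynomial (Fin 4) (ResidueField O))} (hI : IsConic I)
    (hmult : IsComponentOfMultiplicityOne (Q.baseChange (residue O)) I) :
    ∃ α : ℤ,
      (∀ (x : Fin 4 → K) (y : Fin 4 → ResidueField O), (Q.baseChange (algebraMap O K)).IsZero x →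
        ReducesTo O x y → LiesOn y I → (Q.baseChange (residue O)).IsSmoothAt y →
        localRatio O Q x = absVal O (algebraMap O K π) ^ (2 * α)) ∧
      (X 0 ∈ I → Computes π Q α) := by
  obtain ⟨⟨ℓ, q, hℓ, hℓ0, hq, hℓq, rfl⟩, hprime⟩ := hI
  obtain ⟨N, γ, hN, hγ, hNℓ, hN1⟩ : ∃ (N : Matrix (Fin 4) (Fin 4) O) (γ : ResidueField O),
      IsUnit N.det ∧ γ ≠ 0 ∧ subst (N.map (residue O)) ℓ = C γ * X 0 ∧
        (X 0 ∈ Ideal.span {ℓ, q} → N = 1) := by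
    by_cases hX : X 0 ∈ Ideal.span {ℓ, q}
    · obtain ⟨r, hr⟩ := exists_linear_of_mem_span hℓ hq (isHomogeneous_X _ _) hX
      have h1 := congrArg (homogeneousComponent 1) hr
      rw [mul_comm, homogeneousComponent_mul_self r hℓ,
        homogeneousComponent_of_mem (isHomogeneous_X _ _), if_pos rfl] at h1
      have hc : coeff 0 r ≠ 0 := fun h0 => by
        rw [h0, C_0, zero_mul] at h1
        exact X_ne_zero 0 h1
      refine ⟨1, (coeff 0 r)⁻¹, by simp, inv_ne_zero hc, ?_, fun _ => rfl⟩
      rw [h1, ← mul_assoc, ← C_mul, inv_mul_cancel₀ hc, C_1, one_mul]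
      simp [subst_one]
    · obtain ⟨N, γ, h1, h2, h3⟩ := exists_coordinates hℓ hℓ0
      exact ⟨N, γ, h1, h2, h3, fun h => absurd h hX⟩
  have hN' : IsUnit (N.map (residue O)).det := by
    rw [← RingHom.mapMatrix_apply, ← RingHom.map_det]; exact hN.map _
  obtain ⟨l, hl⟩ := atStepTwo_of_conic hQ hℓ hq hℓq hprime hmult hN hγ hNℓ
  obtain ⟨n, hn, hn'⟩ := exists_vanishesNear hπ hQ hns hN
  refine ⟨n, ?_, fun hX => ?_⟩
  · rintro x y hx ⟨hy0, c, hc, u, hu, huy⟩ hyI hsm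
    have hux : x = fun i => c * algebraMap O K (u i) := funext hu
    have hzero : Q.IsZero u := isZero_of_baseChange hQ hc (hux ▸ hx)
    set u' := N⁻¹ *ᵥ u with hu'
    have hNu : N *ᵥ u' = u := by
      rw [hu', Matrix.mulVec_mulVec, Matrix.mul_nonsing_inv _ hN, Matrix.one_mulVec]
    set z : Fin 4 → ResidueField O := fun i => residue O (u' i) with hz
    have hNz : N.map (residue O) *ᵥ z = y := by
      ext i
      rw [← huy, ← hNu, RingHom.map_mulVec]
      rfl
    have hz0 : z 0 = 0 := by
      have h1 : eval z (subst (N.map (residue O)) ℓ) = 0 := by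
        rw [eval_subst, hNz]
        exact hyI _ (Ideal.subset_span (by simp))
      rw [hNℓ, map_mul, eval_C, eval_X] at h1
      exact (mul_eq_zero.1 h1).resolve_left hγ
    have hzero' : QuadricPair.IsZero (fun i => subst N (Q i)) u' := fun i => by
      change eval u' (subst N (Q i)) = 0
      rw [eval_subst, hNu, hzero i]
    have hsm' : IsSmoothAt (QuadricPair.baseChange (residue O) fun i => subst N (Q i)) z := by
      have h1 := (isSmoothAt_subst (fun i => (hQ i).map (residue O)) hN' z).2 (hNz.symm ▸ hsm)
      convert h1 using 1
      ext1 i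
      exact map_subst _ _ _
    have key := hl.covariantIdeal_eq hπ n _ _ hn hn' u' hzero'
      ((residue_eq_zero_iff_dvd hπ _).1 hz0) (hl.ne_zero_of_isSmoothAt hz0 hsm')
    rw [covariantIdeal_subst hQ N hN, hNu] at key
    have hunit : ∃ i, IsUnit (u i) := by
      obtain ⟨i, hi⟩ := Function.ne_iff.1 hy0
      exact ⟨i, (residue_ne_zero_iff_isUnit _).1 (by rw [huy]; exact hi)⟩
    rw [localRatio_eq hQ hc hu hunit key, map_pow, map_pow]
    norm_cast
  · obtain rfl := hN1 hX
    simp only [subst_one] at hl hn hn'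
    obtain ⟨h1, h2⟩ := hl.returns hπ n _ _ hn hn' 0
    exact ⟨h1, fun s hs hstuck => ⟨0 + n, h2 s hs hstuck, by simp⟩⟩

end Main

end

end GenusOne

theorem mainTheorem9 (p : ℕ) [Fact p.Prime] (K : Type*) [Field K] [Algebra ℚ_[p] K]
    [FiniteDimensional ℚ_[p] K] [Algebra ℤ_[p] K] [IsScalarTower ℤ_[p] ℚ_[p] K]
    (π : PadicRingOfIntegers p K) (hπ : Irreducible π)
    (Q : GenusOne.QuadricPair (PadicRingOfIntegers p K)) (hQ : Q.IsModel)
    (hns : (Q.baseChange (algebraMap (PadicRingOfIntegers p K) K)).IsNonsingular)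
    (C : Ideal (MvPolynomial (Fin 4) (IsLocalRing.ResidueField (PadicRingOfIntegers p K))))
    (hC : GenusOne.IsConic C)
    (hmult : GenusOne.IsComponentOfMultiplicityOne
      (Q.baseChange (IsLocalRing.residue (PadicRingOfIntegers p K))) C) :
    ∃ α : ℤ,
      (∀ (x : Fin 4 → K) (y : Fin 4 → IsLocalRing.ResidueField (PadicRingOfIntegers p K)),
        x ≠ 0 → (Q.baseChange (algebraMap (PadicRingOfIntegers p K) K)).IsZero x →
        GenusOne.ReducesTo (PadicRingOfIntegers p K) x y → GenusOne.LiesOn y C →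
        (Q.baseChange (IsLocalRing.residue (PadicRingOfIntegers p K))).IsSmoothAt y →
        GenusOne.localRatio (PadicRingOfIntegers p K) Q x =
          GenusOne.absVal (PadicRingOfIntegers p K)
            (algebraMap (PadicRingOfIntegers p K) K π) ^ (2 * α)) ∧
      (MvPolynomial.X 0 ∈ C → GenusOne.Computes π Q α) := by
  have hinj : Function.Injective (algebraMap ℤ_[p] K) := by
    rw [IsScalarTower.algebraMap_eq ℤ_[p] ℚ_[p] K]
    exact (algebraMap ℚ_[p] K).injective.comp (IsFractionRing.injective ℤ_[p] ℚ_[p])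
  have : CharZero K := charZero_of_injective_algebraMap hinj
  have : CharZero (PadicRingOfIntegers p K) :=
    ⟨fun m n h => Nat.cast_injective (R := K) (by simpa using congrArg Subtype.val h)⟩
  obtain ⟨α, h1, h2⟩ := GenusOne.exists_localRatio_eq_and_computes hπ hQ hns hC hmult
  exact ⟨α, fun x y _ => h1 x y, h2⟩
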